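/- **Theorem 8.2 (Quiver equivariant center manifold theorem).** For a linear map $L:E\to E$ of a finite-dimensional real normed space, let $E^c$ (resp. $E^h$) be the center (resp. hyperbolic) subspace of $L$, i.e. the set of vectors of $E$ that lie, in the complexification of $E$, in the sum of the generalised eigenspaces of $L$ for the eigenvalues on (resp. not on) the imaginary axis. Then $E=E^c\oplus E^h$; let $\pi^c:E\to E^c$ and $\pi^h:E\to E^h$ be the corresponding projections. There is a function $\varepsilon$ that assigns to every such $E$, every linear $L:E\to E$ and every integer $k\ge 1$ a number $\varepsilon(L,k)>0$ with the following property. Let ${\bf Q}=\{A\rightrightarrows^s_t V\}$ be a quiver, and let $({\bf E},{\bf R})$ be a representation of ${\bf Q}$: finite-dimensional real (normed) vector spaces $E_v$ $(v\in V)$ and linear maps $R_a:E_{s(a)}\to E_{t(a)}$ $(a\in A)$. Let $k\ge 1$, and for every $v\in V$ let $L_v:E_v\to E_v$ be linear and $F_v:E_v\to E_v$ be $C^k$, with $F_v(0)=0$ and $DF_v(0)=L_v$, such that $$R_a\circ L_{s(a)}=L_{t(a)}\circ R_a\quad\text{and}\quad R_a\circ F_{s(a)}=F_{t(a)}\circ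 R_a\qquad\text{for all } a\in A.$$ Assume that for every $v\in V$ $$\sup_{x\in E_v}\|D^{j}(F_v-L_v)(x)\|<\infty\ \ (0\le j\le k)\qquad\text{and}\qquad \sup_{x\in E_v}\|DF_v(x)-L_v\|<\varepsilon(L_v,k).$$ Then for every $v\in V$ the equation $\frac{dx}{dt}=F_v(x)$ has, for every initial value, exactly one solution defined for all times, so that its flow $e^{tF_v}$ is defined for all $t\in\mathbb R$. Put $$M^c_v:=\Big\{x\in E_v\ \Big|\ \sup_{t\in\mathbb R}\|\pi^h_v(e^{tF_v}(x))\|<\infty\Big\}.$$ 1. For every $v\in V$ there is a unique $C^k$ map $\phi_v:E^c_v\to E^h_v$ with $\phi_v(0)=0$ and $D\phi_v(0)=0$ whose graph $\{x^c+\phi_v(x^c)\mid x^c\in E^c_v\}$ is invariant under the flow of $F_v$ and equals $M^c_v$. The set $M^c_v$ is called the global center manifold of $F_v$. 2. $R_a(M^c_{s(a)})\subset M^c_{t(a)}$ for every $a\in A$. 3. $R_a(E^c_{s(a)})\subset E^c_{t(a)}$ and $R_a(E^h_{s(a)})\subset E^h_{t(a)}$ for every $a\in A$, and $R_a\circ\phi_{s(a)}=\phi_{t(a)}\circ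 R_a$ on $E^c_{s(a)}$. 4. The center manifold reductions $F^c_v:E^c_v\to E^c_v$, $F^c_v(x^c):=\pi^c_v\big(F_v(x^c+\phi_v(x^c))\big)$, satisfy $$R_a\circ F^c_{s(a)}=F^c_{t(a)}\circ R_a\quad\text{on } E^c_{s(a)}\qquad\text{for all } a\in A,$$ that is, they form a ${\bf Q}$-equivariant vector field on the subrepresentation ${\bf E}^c$ of $({\bf E},{\bf R})$ consisting of the center subspaces $E^c_v$. -/

import Mathlib

open scoped TensorProduct

universe w v u

namespace QuiverCM

noncomputable section

section Spectral

variable {E : Type*} [AddCommGroup E] [Module ℝ E]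

/-- The inclusion of a real vector space into its complexification. -/
def toComplexification (E : Type*) [AddCommGroup E] [Module ℝ E] : E →ₗ[ℝ] (ℂ ⊗[ℝ] E) :=
  TensorProduct.mk ℝ ℂ E 1

/-- The sum, inside the complexification, of the generalised eigenspaces of `L` for the
eigenvalues in `S`. (A complex number that is no eigenvalue contributes the zero subspace.) -/
def complexSpectralSubspace (L : E →ₗ[ℝ] E) (S : Set ℂ) : Submodule ℂ (ℂ ⊗[ℝ] E) :=
  ⨆ μ ∈ S, Module.End.maxGenEigenspace (L.baseChange ℂ : Module.End ℂ (ℂ ⊗[ℝ] E)) μ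

/-- The real points of the sum of the generalised eigenspaces of `L` for the eigenvalues in `S`. -/
def spectralSubspace (L : E →ₗ[ℝ] E) (S : Set ℂ) : Submodule ℝ E :=
  ((complexSpectralSubspace L S).restrictScalars ℝ).comap (toComplexification E)

/-- The center subspace `E^c` of `L`: eigenvalues on the imaginary axis. -/
def centerSubspace (L : E →ₗ[ℝ] E) : Submodule ℝ E :=
  spectralSubspace L {μ | μ.re = 0}

/-- The hyperbolic subspace `E^h` of `L`: eigenvalues off the imaginary axis. -/
def hyperbolicSubspace (L : E →ₗ[ℝ] E) : Submodule ℝ E :=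
  spectralSubspace L {μ | μ.re ≠ 0}

theorem toComplexification_injective : Function.Injective (toComplexification E) := by
  refine Function.LeftInverse.injective
    (g := fun z => TensorProduct.lid ℝ E (LinearMap.rTensor E Complex.reLm z)) ?_
  intro x
  simp [toComplexification]

/-- Complex conjugation on the complexification. -/
def conjC (E : Type*) [AddCommGroup E] [Module ℝ E] : (ℂ ⊗[ℝ] E) →ₗ[ℝ] (ℂ ⊗[ℝ] E) :=
  LinearMap.rTensor E Complex.conjAe.toLinearMap

theorem conjC_toComplexification (x : E) :
    conjC E (toComplexification E x) = toComplexification E x := by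
  simp [conjC, toComplexification]

theorem conjC_smul (c : ℂ) (z : ℂ ⊗[ℝ] E) :
    conjC E (c • z) = (starRingEnd ℂ c) • conjC E z := by
  induction z with
  | zero => simp
  | add x y hx hy => simp only [smul_add, map_add, hx, hy]
  | tmul a x => simp [conjC, TensorProduct.smul_tmul']

theorem conjC_baseChange (L : E →ₗ[ℝ] E) (z : ℂ ⊗[ℝ] E) :
    conjC E (L.baseChange ℂ z) = L.baseChange ℂ (conjC E z) := by
  induction z with
  | zero => simp
  | add x y hx hy => simp only [map_add, hx, hy]
  | tmul a x => simp [conjC]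

theorem conjC_eq_self {z : ℂ ⊗[ℝ] E} (h : conjC E z = z) :
    ∃ x : E, toComplexification E x = z := by
  have key : ∀ w : ℂ ⊗[ℝ] E, w + conjC E w = toComplexification E
      ((2 : ℝ) • TensorProduct.lid ℝ E (LinearMap.rTensor E Complex.reLm w)) := by
    intro w
    induction w with
    | zero => simp
    | add x y hx hy =>
      simp only [map_add, smul_add] at hx hy ⊢
      rw [← hx, ← hy]; abel
    | tmul a x =>
      have h2 : a + (starRingEnd ℂ) a = ((2 * a.re : ℝ) • (1 : ℂ)) := by
        rw [Complex.add_conj]; simp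
      simp only [conjC, toComplexification, LinearMap.rTensor_tmul, TensorProduct.lid_tmul,
        TensorProduct.mk_apply, smul_smul, Complex.reLm_coe]
      change a ⊗ₜ[ℝ] x + ((starRingEnd ℂ) a) ⊗ₜ[ℝ] x = _
      rw [← TensorProduct.add_tmul, h2, TensorProduct.smul_tmul]
  have h1 := key z
  rw [h] at h1
  refine ⟨TensorProduct.lid ℝ E (LinearMap.rTensor E Complex.reLm z), ?_⟩
  have h3 : (2 : ℝ) • toComplexification E
      (TensorProduct.lid ℝ E (LinearMap.rTensor E Complex.reLm z)) = (2 : ℝ) • z := by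
    rw [← map_smul, ← h1, two_smul]
  exact smul_right_injective _ (two_ne_zero) h3

theorem conjC_mem (L : E →ₗ[ℝ] E) {S : Set ℂ} (hS : ∀ μ ∈ S, (starRingEnd ℂ) μ ∈ S)
    {z : ℂ ⊗[ℝ] E} (hz : z ∈ complexSpectralSubspace L S) :
    conjC E z ∈ complexSpectralSubspace L S := by
  let C : (ℂ ⊗[ℝ] E) →ₛₗ[starRingEnd ℂ] (ℂ ⊗[ℝ] E) :=
    { toFun := conjC E, map_add' := map_add _, map_smul' := conjC_smul }
  suffices h : complexSpectralSubspace L S ≤ (complexSpectralSubspace L S).comap C from h hz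
  conv_lhs => rw [complexSpectralSubspace]
  refine iSup₂_le fun μ hμ w hw => ?_
  have hle : Module.End.maxGenEigenspace (L.baseChange ℂ : Module.End ℂ (ℂ ⊗[ℝ] E))
      ((starRingEnd ℂ) μ) ≤ complexSpectralSubspace L S :=
    le_iSup₂_of_le (f := fun (μ : ℂ) (_ : μ ∈ S) =>
      Module.End.maxGenEigenspace (L.baseChange ℂ : Module.End ℂ (ℂ ⊗[ℝ] E)) μ)
      _ (hS μ hμ) le_rfl
  refine hle ?_
  change conjC E w ∈ _
  rw [Module.End.mem_maxGenEigenspace] at hw ⊢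
  obtain ⟨k, hk⟩ := hw
  refine ⟨k, ?_⟩
  have hcomm : ∀ (n : ℕ) (y : ℂ ⊗[ℝ] E),
      (((L.baseChange ℂ : Module.End ℂ (ℂ ⊗[ℝ] E)) - (starRingEnd ℂ) μ • 1) ^ n) (conjC E y) =
        conjC E ((((L.baseChange ℂ : Module.End ℂ (ℂ ⊗[ℝ] E)) - μ • 1) ^ n) y) := by
    intro n
    induction n with
    | zero => intro y; simp
    | succ n ih =>
      intro y
      rw [pow_succ, pow_succ, Module.End.mul_apply, Module.End.mul_apply, ← ih]
      congr 1
      simp only [LinearMap.sub_apply, LinearMap.smul_apply, Module.End.one_apply, map_sub,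
        conjC_smul, conjC_baseChange]
  rw [hcomm, hk, map_zero]

/-- The splitting `E = E^c ⊕ E^h`. -/
theorem isCompl_center_hyperbolic [FiniteDimensional ℝ E] (L : E →ₗ[ℝ] E) :
    IsCompl (centerSubspace L) (hyperbolicSubspace L) := by
  have hdis : Disjoint (complexSpectralSubspace L {μ | μ.re = 0})
      (complexSpectralSubspace L {μ | μ.re ≠ 0}) := by
    refine (Module.End.independent_maxGenEigenspace
      (L.baseChange ℂ : Module.End ℂ (ℂ ⊗[ℝ] E))).disjoint_biSup_biSup ?_
    rw [Set.disjoint_left]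
    intro μ h1 h2
    exact h2 h1
  have htop : complexSpectralSubspace L {μ | μ.re = 0} ⊔
      complexSpectralSubspace L {μ | μ.re ≠ 0} = ⊤ := by
    rw [eq_top_iff, ← Module.End.iSup_maxGenEigenspace_eq_top
      (L.baseChange ℂ : Module.End ℂ (ℂ ⊗[ℝ] E))]
    refine iSup_le fun μ => ?_
    by_cases hμ : μ.re = 0
    · exact le_sup_of_le_left (le_iSup₂_of_le (f := fun (μ : ℂ) (_ : μ ∈ {μ : ℂ | μ.re = 0}) =>
        Module.End.maxGenEigenspace (L.baseChange ℂ : Module.End ℂ (ℂ ⊗[ℝ] E)) μ) μ hμ le_rfl)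
    · exact le_sup_of_le_right (le_iSup₂_of_le (f := fun (μ : ℂ) (_ : μ ∈ {μ : ℂ | μ.re ≠ 0}) =>
        Module.End.maxGenEigenspace (L.baseChange ℂ : Module.End ℂ (ℂ ⊗[ℝ] E)) μ) μ hμ le_rfl)
  constructor
  · rw [Submodule.disjoint_def] at hdis ⊢
    intro x hx hy
    exact toComplexification_injective (by rw [map_zero]; exact hdis _ hx hy)
  · rw [codisjoint_iff, eq_top_iff]
    intro x _
    have hx : toComplexification E x ∈ complexSpectralSubspace L {μ | μ.re = 0} ⊔
      complexSpectralSubspace L {μ | μ.re ≠ 0} := by rw [htop]; trivial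
    obtain ⟨u, hu, w, hw, huw⟩ := Submodule.mem_sup.1 hx
    have hu' := conjC_mem L (S := {μ | μ.re = 0}) (by intro μ h; simpa using h) hu
    have hw' := conjC_mem L (S := {μ | μ.re ≠ 0}) (by intro μ h; simpa using h) hw
    have hc : conjC E u + conjC E w = u + w := by
      rw [← map_add, huw, conjC_toComplexification]
    have hd : conjC E u - u = w - conjC E w := by
      rw [sub_eq_sub_iff_add_eq_add, hc, add_comm]
    have h0 : conjC E u - u = 0 := by
      refine Submodule.disjoint_def.1 hdis _ (Submodule.sub_mem _ hu' hu) ?_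
      rw [hd]
      exact Submodule.sub_mem _ hw hw'
    obtain ⟨a, ha⟩ := conjC_eq_self (sub_eq_zero.1 h0)
    obtain ⟨b, hb⟩ := conjC_eq_self (sub_eq_zero.1 (hd.symm.trans h0)).symm
    have hab : a + b = x := by
      apply toComplexification_injective
      rw [map_add, ha, hb, huw]
    rw [← hab]
    refine Submodule.add_mem_sup ?_ ?_
    · change toComplexification E a ∈ complexSpectralSubspace L _
      rw [ha]; exact hu
    · change toComplexification E b ∈ complexSpectralSubspace L _
      rw [hb]; exact hw

/-- The projection `π^c : E → E^c` along `E^h`. -/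
def centerProj [FiniteDimensional ℝ E] (L : E →ₗ[ℝ] E) : E →ₗ[ℝ] centerSubspace L :=
  Submodule.projectionOnto _ _ (isCompl_center_hyperbolic L)

/-- The projection `π^h : E → E^h` along `E^c`. -/
def hyperbolicProj [FiniteDimensional ℝ E] (L : E →ₗ[ℝ] E) : E →ₗ[ℝ] hyperbolicSubspace L :=
  Submodule.projectionOnto _ _ (isCompl_center_hyperbolic L).symm

end Spectral

section CenterManifold

variable {E : Type*} [NormedAddCommGroup E] [NormedSpace ℝ E]

/-- The curve `γ : ℝ → E` is a solution of `dx/dt = F(x)`, defined for all times, with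
initial value `γ(0) = x`. -/
def IsSolution (F : E → E) (x : E) (γ : ℝ → E) : Prop :=
  γ 0 = x ∧ ∀ t : ℝ, HasDerivAt γ (F (γ t)) t

/-- The global bounds on a vector field `F` with linear part `L`: all derivatives of `F - L` of
order at most `k` are bounded on `E`, and the supremum of `‖DF(x) - L‖` is less than `ε`. -/
def GlobalBounds (L : E →L[ℝ] E) (F : E → E) (k : ℕ) (ε : ℝ) : Prop :=
  (∀ j ≤ k, ∃ C : ℝ, ∀ x : E, ‖iteratedFDeriv ℝ j (fun y => F y - L y) x‖ ≤ C) ∧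
    ∃ δ < ε, ∀ x : E, ‖fderiv ℝ F x - L‖ ≤ δ

variable [FiniteDimensional ℝ E]

/-- The set `M^c` of points whose orbit `t ↦ e^{tF}(x)` has a bounded hyperbolic part,
`sup_t ‖π^h(e^{tF}(x))‖ < ∞`. -/
def centerManifold (L : E →L[ℝ] E) (F : E → E) : Set E :=
  {x | ∃ γ : ℝ → E, IsSolution F x γ ∧
    ∃ C : ℝ, ∀ t : ℝ, ‖hyperbolicProj (L : E →ₗ[ℝ] E) (γ t)‖ ≤ C}

/-- The graph `{x + φ(x) | x ∈ E^c} ⊆ E` of a map `φ : E^c → E^h`. -/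
def centerGraph (L : E →L[ℝ] E)
    (φ : centerSubspace (L : E →ₗ[ℝ] E) → hyperbolicSubspace (L : E →ₗ[ℝ] E)) : Set E :=
  Set.range fun x : centerSubspace (L : E →ₗ[ℝ] E) => (x : E) + (φ x : E)

/-- The map `φ : E^c → E^h` is a `C^k` map with `φ(0) = 0` and `Dφ(0) = 0`, whose graph is invariant
under the flow of `F` and equals the global center manifold `M^c` of `F`. -/
structure IsCenterManifoldMap (L : E →L[ℝ] E) (F : E → E) (k : ℕ)
    (φ : centerSubspace (L : E →ₗ[ℝ] E) → hyperbolicSubspace (L : E →ₗ[ℝ] E)) : Prop where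
  contDiff : ContDiff ℝ k φ
  map_zero : φ 0 = 0
  hasFDerivAt_zero : HasFDerivAt φ
    (0 : centerSubspace (L : E →ₗ[ℝ] E) →L[ℝ] hyperbolicSubspace (L : E →ₗ[ℝ] E)) 0
  invariant : ∀ (x : E) (γ : ℝ → E), IsSolution F x γ →
    x ∈ centerGraph L φ → ∀ t : ℝ, γ t ∈ centerGraph L φ
  graph_eq : centerGraph L φ = centerManifold L F

/-- The center manifold reduction `F^c(x) = π^c(F(x + φ(x)))` on `E^c`. -/
def centerReduction (L : E →L[ℝ] E) (F : E → E)
    (φ : centerSubspace (L : E →ₗ[ℝ] E) → hyperbolicSubspace (L : E →ₗ[ℝ] E)) :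
    centerSubspace (L : E →ₗ[ℝ] E) → centerSubspace (L : E →ₗ[ℝ] E) :=
  fun x => centerProj (L : E →ₗ[ℝ] E) (F ((x : E) + (φ x : E)))

end CenterManifold

section Representations

/-- A family of maps `G_v : E_v → E_v` is equivariant for the representation `(E, R)` of a
quiver if `G_{t(a)} ∘ R_a = R_a ∘ G_{s(a)}` for every arrow `a`. -/
def IsEquivariant {V : Type v} [Quiver.{w} V] {E : V → Type u} [∀ v, AddCommGroup (E v)]
    [∀ v, Module ℝ (E v)] (R : ∀ ⦃v w : V⦄, (v ⟶ w) → (E v →ₗ[ℝ] E w))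
    (G : ∀ v, E v → E v) : Prop :=
  ∀ ⦃v w : V⦄ (a : v ⟶ w), G w ∘ R a = R a ∘ G v

/-- A family of subspaces `D_v ⊆ E_v` is a subrepresentation if `R_a(D_{s(a)}) ⊆ D_{t(a)}` for
every arrow `a`. -/
def IsSubrepresentation {V : Type v} [Quiver.{w} V] {E : V → Type u} [∀ v, AddCommGroup (E v)]
    [∀ v, Module ℝ (E v)] (R : ∀ ⦃v w : V⦄, (v ⟶ w) → (E v →ₗ[ℝ] E w))
    (D : ∀ v, Submodule ℝ (E v)) : Prop :=
  ∀ ⦃v w : V⦄ (a : v ⟶ w), ∀ x ∈ D v, R a x ∈ D w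

/-- The restriction of a representation to a subrepresentation. -/
def restrictRep {V : Type v} [Quiver.{w} V] {E : V → Type u} [∀ v, AddCommGroup (E v)]
    [∀ v, Module ℝ (E v)] (R : ∀ ⦃v w : V⦄, (v ⟶ w) → (E v →ₗ[ℝ] E w))
    (D : ∀ v, Submodule ℝ (E v)) (hD : IsSubrepresentation R D) :
    ∀ ⦃v w : V⦄, (v ⟶ w) → (D v →ₗ[ℝ] D w) :=
  fun _ _ a => (R a).restrict (hD a)

end Representations

end

end QuiverCM

open QuiverCM

/-! The method is that of Lyapunov and Perron. Write `F = L + G`, where `G` is bounded and has a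
small Lipschitz constant `δ`. Split `E` into center, stable and unstable parts
(`exists_spectralSplitting`): `exp (tL)` decays at some rate `β` on the stable part forwards and on
the unstable part backwards in time, and grows slower than every `exp (η|t|)` on the center part. By
variation of constants, the orbits `γ` with bounded hyperbolic part and center coordinate `x` at
time `0` are exactly the solutions of `γ(t) = exp (tL) x + ∫ K(t,s) G(γ(s)) ds`. Here `K` integrates
the center component from `0`, the stable one from `-∞` and the unstable one from `+∞`
(`mem_centerManifold`, `eq_of_mem_centerManifold`).

On functions of growth `exp (ξ|t|)`, integration against `K` has norm at most `2N/η`, so for `δ ·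
2N/η < 1` the equation is a contraction and has one solution for every `x`
(`exists_integral_fixedPoint`). Its integral term at time `0` has no center component; this term is
`φ(x)`, and the graph of `φ` is the center manifold.

Smoothness is the delicate point: the `j`-th derivative in `x` grows like `exp (jσ|t|)`, so `K` must
be controlled in `k` different weights, all below `β`, which makes `ε` depend on `k`. The derivative
is first constructed as the solution of the linearised integral equation. The difference quotients
then converge to it pointwise, by a reverse Fatou argument (`tendsto_zero_of_integral_eq`) that
needs domination in one weight only. An induction on the order follows
(`WeightedSmooth.of_integral_eq`, `exists_contDiff_integral_solution`).

Equivariance is formal, because the center manifold is characterised dynamically. An intertwining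
map `R` preserves spectral subspaces, sends orbits to orbits and keeps bounded hyperbolic parts
bounded (`map_mem_centerManifold`). Since a graph determines its map (`centerGraph_injective`), `φ`
is unique and commutes with `R`, and so does the reduced vector field. -/

namespace QuiverCM

open MeasureTheory Filter Topology

/-! ### Integral operators and contractions in exponentially weighted spaces -/

section

theorem integrable_exp_neg_mul_abs_sub {η : ℝ} (hη : 0 < η) (t : ℝ) :
    Integrable fun s : ℝ => Real.exp (-η * |t - s|) := by
  have h0 : Integrable fun s : ℝ => Real.exp (-η * |s|) := by
    rw [← integrableOn_univ, ← Set.Iic_union_Ioi (a := (0 : ℝ)), integrableOn_union]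
    constructor
    · refine (integrableOn_congr_fun (fun s hs => ?_) measurableSet_Iic).1
        (integrableOn_exp_mul_Iic hη 0)
      simp [abs_of_nonpos (Set.mem_Iic.1 hs)]
    · refine (integrableOn_congr_fun (fun s hs => ?_) measurableSet_Ioi).1
        (integrableOn_exp_mul_Ioi (neg_lt_zero.2 hη) 0)
      simp [abs_of_pos (Set.mem_Ioi.1 hs)]
  exact h0.comp_sub_left t

theorem integral_exp_neg_mul_abs_sub {η : ℝ} (hη : 0 < η) (t : ℝ) :
    ∫ s : ℝ, Real.exp (-η * |t - s|) = 2 / η := by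
  rw [integral_sub_left_eq_self (fun s => Real.exp (-η * |s|)) volume t,
    integral_comp_abs (f := fun s => Real.exp (-η * s)), integral_exp_mul_Ioi (by linarith)]
  simp; ring

variable {Y : Type*} [NormedAddCommGroup Y] [NormedSpace ℝ Y]

/-- `K` is a measurable integral kernel whose size decays like `exp (-η |t - s|)` relative to the
weight `exp (ξ |t|)`. -/
structure IsKernel (K : ℝ → ℝ → Y →L[ℝ] Y) (M η ξ : ℝ) : Prop where
  meas : StronglyMeasurable (Function.uncurry K)
  bound : ∀ t s, ‖K t s‖ * Real.exp (ξ * |s|) ≤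
    M * Real.exp (ξ * |t|) * Real.exp (-η * |t - s|)

namespace IsKernel

variable {K : ℝ → ℝ → Y →L[ℝ] Y} {M η ξ : ℝ}

theorem norm_apply_le (hK : IsKernel K M η ξ) {h : ℝ → Y} {C : ℝ}
    (hh : ∀ s, ‖h s‖ ≤ C * Real.exp (ξ * |s|)) (t s : ℝ) :
    ‖K t s (h s)‖ ≤ C * M * Real.exp (ξ * |t|) * Real.exp (-η * |t - s|) := by
  have hC : 0 ≤ C := by
    have := (norm_nonneg _).trans (hh 0)
    simpa using this
  calc ‖K t s (h s)‖ ≤ ‖K t s‖ * (C * Real.exp (ξ * |s|)) :=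
        (K t s).le_opNorm_of_le (hh s)
    _ = C * (‖K t s‖ * Real.exp (ξ * |s|)) := by ring
    _ ≤ C * (M * Real.exp (ξ * |t|) * Real.exp (-η * |t - s|)) := by
        exact mul_le_mul_of_nonneg_left (hK.bound t s) hC
    _ = _ := by ring

/-- The weights cancel and leave the integral of `exp (-η|t - s|)` over `s`, which is `2/η`. Hence
`2M/η` bounds the norm of the integral operator on the space weighted by `exp (ξ|t|)`, and `δ * (2 *
M / η)` is the contraction constant used from here on. -/
theorem norm_integral_le (hK : IsKernel K M η ξ) (hη : 0 < η) {h : ℝ → Y} {C : ℝ}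
    (hh : ∀ s, ‖h s‖ ≤ C * Real.exp (ξ * |s|)) (t : ℝ) :
    ‖∫ s, K t s (h s)‖ ≤ C * (2 * M / η) * Real.exp (ξ * |t|) := by
  refine (norm_integral_le_of_norm_le
    ((integrable_exp_neg_mul_abs_sub hη t).const_mul (C * M * Real.exp (ξ * |t|)))
    (ae_of_all _ (hK.norm_apply_le hh t))).trans_eq ?_
  rw [integral_const_mul, integral_exp_neg_mul_abs_sub hη]
  ring

theorem stronglyMeasurable_apply (hK : IsKernel K M η ξ) {h : ℝ → Y} (hm : StronglyMeasurable h) :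
    StronglyMeasurable fun p : ℝ × ℝ => K p.1 p.2 (h p.2) := by
  have : Continuous fun q : (Y →L[ℝ] Y) × Y => q.1 q.2 :=
    continuous_fst.clm_apply continuous_snd
  exact this.comp_stronglyMeasurable (hK.meas.prodMk (hm.comp_measurable measurable_snd))

theorem integrable (hK : IsKernel K M η ξ) (hη : 0 < η) {h : ℝ → Y} {C : ℝ}
    (hm : StronglyMeasurable h) (hh : ∀ s, ‖h s‖ ≤ C * Real.exp (ξ * |s|)) (t : ℝ) :
    Integrable fun s => K t s (h s) :=
  Integrable.mono' ((integrable_exp_neg_mul_abs_sub hη t).const_mul (C * M * Real.exp (ξ * |t|)))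
    ((hK.stronglyMeasurable_apply hm).comp_measurable
      (measurable_const.prodMk measurable_id)).aestronglyMeasurable
    (ae_of_all _ (hK.norm_apply_le hh t))

theorem stronglyMeasurable_integral (hK : IsKernel K M η ξ) {h : ℝ → Y}
    (hm : StronglyMeasurable h) : StronglyMeasurable fun t => ∫ s, K t s (h s) :=
  (hK.stronglyMeasurable_apply hm).integral_prod_right'

/-- The kernel acting on operators into `Y` by composition. -/
theorem compL (hK : IsKernel K M η ξ) (P : Type*) [NormedAddCommGroup P] [NormedSpace ℝ P] :
    IsKernel (fun t s => ContinuousLinearMap.compL ℝ P Y Y (K t s)) M η ξ where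
  meas := (ContinuousLinearMap.compL ℝ P Y Y).continuous.comp_stronglyMeasurable hK.meas
  bound t s := by
    refine le_trans ?_ (hK.bound t s)
    refine mul_le_mul_of_nonneg_right ?_ (Real.exp_pos _).le
    exact ContinuousLinearMap.opNorm_le_bound _ (norm_nonneg _)
      fun g => ContinuousLinearMap.opNorm_comp_le _ _

end IsKernel

/-- A bound that improves itself by a factor `κ < 1` up to a constant. -/
theorem le_div_one_sub_of_self_improving {ρ ω : ℝ → ℝ} {κ C : ℝ} (hκ : 0 ≤ κ) (hκ1 : κ < 1)
    (hC : 0 ≤ C) (hb : ∃ C', ∀ t, ρ t ≤ C' * ω t) (hω : ∀ t, 0 ≤ ω t)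
    (hstep : ∀ C', 0 ≤ C' → (∀ t, ρ t ≤ C' * ω t) → ∀ t, ρ t ≤ (κ * C' + C) * ω t) (t : ℝ) :
    ρ t ≤ C / (1 - κ) * ω t := by
  obtain ⟨C₀, hC₀⟩ := hb
  have h1 : 0 < 1 - κ := by linarith
  -- The map `C' ↦ κ C' + C` contracts to its fixed point `C / (1 - κ)`; start it at `|C₀|` and let
  -- `n → ∞`.
  have hn : ∀ n : ℕ, ∀ t, ρ t ≤ (κ ^ n * |C₀| + C / (1 - κ)) * ω t := by
    intro n
    induction n with
    | zero =>
      intro t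
      refine (hC₀ t).trans ?_
      have := hω t
      gcongr
      have : 0 ≤ C / (1 - κ) := by positivity
      have := le_abs_self C₀
      simp; linarith
    | succ n ih =>
      intro t
      refine (hstep _ (by positivity) ih t).trans_eq ?_
      field_simp
      ring
  have hlim : Tendsto (fun n : ℕ => (κ ^ n * |C₀| + C / (1 - κ)) * ω t) atTop
      (𝓝 ((0 * |C₀| + C / (1 - κ)) * ω t)) :=
    (((tendsto_pow_atTop_nhds_zero_of_lt_one hκ hκ1).mul_const _).add_const _).mul_const _
  simpa using ge_of_tendsto' hlim fun n => hn n t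

/-- Picard iteration for a nonlinear integral equation in a weighted space. -/
theorem exists_integral_fixedPoint [CompleteSpace Y] {K : ℝ → ℝ → Y →L[ℝ] Y} {M η ξ δ C : ℝ}
    (hK : IsKernel K M η ξ) (hη : 0 < η) (hM : 0 ≤ M) (hδ : 0 ≤ δ) (hκ : δ * (2 * M / η) < 1)
    {f : ℝ → Y → Y}
    (hf : ∀ s y y', ‖f s y - f s y'‖ ≤ δ * ‖y - y'‖)
    (hf0 : ∀ s, ‖f s 0‖ ≤ C * Real.exp (ξ * |s|))
    (hfm : ∀ w : ℝ → Y, StronglyMeasurable w → StronglyMeasurable fun s => f s (w s)) :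
    ∃ w : ℝ → Y, StronglyMeasurable w ∧ (∃ C', ∀ t, ‖w t‖ ≤ C' * Real.exp (ξ * |t|)) ∧
      ∀ t, w t = ∫ s, K t s (f s (w s)) := by
  set κ := δ * (2 * M / η) with hκdef
  have hκ0 : 0 ≤ κ := by positivity
  have h1κ : 0 < 1 - κ := by linarith
  let T : (ℝ → Y) → ℝ → Y := fun w t => ∫ s, K t s (f s (w s))
  have hC : 0 ≤ C := by simpa using (norm_nonneg _).trans (hf0 0)
  have hgrow : ∀ (w : ℝ → Y) C', (∀ t, ‖w t‖ ≤ C' * Real.exp (ξ * |t|)) →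
      ∀ s, ‖f s (w s)‖ ≤ (δ * C' + C) * Real.exp (ξ * |s|) := by
    intro w C' hw s
    have h1 := hf s (w s) 0
    rw [sub_zero] at h1
    calc ‖f s (w s)‖ ≤ ‖f s (w s) - f s 0‖ + ‖f s 0‖ := norm_le_norm_sub_add _ _
      _ ≤ δ * (C' * Real.exp (ξ * |s|)) + C * Real.exp (ξ * |s|) := by
          gcongr
          · exact h1.trans (by gcongr; exact hw s)
          · exact hf0 s
      _ = _ := by ring
  have hcontr : ∀ w w' : ℝ → Y, StronglyMeasurable w → StronglyMeasurable w' →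
      (∃ C', ∀ t, ‖w t‖ ≤ C' * Real.exp (ξ * |t|)) →
      (∃ C', ∀ t, ‖w' t‖ ≤ C' * Real.exp (ξ * |t|)) →
      ∀ D, (∀ t, ‖w t - w' t‖ ≤ D * Real.exp (ξ * |t|)) →
      ∀ t, ‖T w t - T w' t‖ ≤ κ * D * Real.exp (ξ * |t|) := by
    rintro w w' hw hw' ⟨C₁, h₁⟩ ⟨C₂, h₂⟩ D hD t
    have : T w t - T w' t = ∫ s, K t s (f s (w s) - f s (w' s)) := by
      simp only [map_sub]
      exact (integral_sub (hK.integrable hη (hfm w hw) (hgrow w C₁ h₁) t)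
        (hK.integrable hη (hfm w' hw') (hgrow w' C₂ h₂) t)).symm
    rw [this]
    refine (hK.norm_integral_le hη (C := δ * D) (fun s => ?_) t).trans_eq (by rw [hκdef]; ring)
    refine (hf s _ _).trans ?_
    rw [mul_assoc]
    gcongr
    exact hD s
  let W : ℕ → ℝ → Y := fun n => T^[n] 0
  have hWs : ∀ n, W (n + 1) = T (W n) := fun n => Function.iterate_succ_apply' T n 0
  have hWm : ∀ n, StronglyMeasurable (W n) := by
    intro n
    induction n with
    | zero => exact stronglyMeasurable_zero
    | succ n ih => rw [hWs]; exact hK.stronglyMeasurable_integral (hfm _ ih)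
  have hWb : ∀ n, ∃ C', ∀ t, ‖W n t‖ ≤ C' * Real.exp (ξ * |t|) := by
    intro n
    induction n with
    | zero => exact ⟨0, fun t => by simp [W]⟩
    | succ n ih =>
      obtain ⟨C', hC'⟩ := ih
      rw [hWs]
      exact ⟨_, hK.norm_integral_le hη (hgrow _ _ hC')⟩
  obtain ⟨C₁, hC₁⟩ := hWb 1
  have hgeo : ∀ n t, ‖W (n + 1) t - W n t‖ ≤ κ ^ n * C₁ * Real.exp (ξ * |t|) := by
    intro n
    induction n with
    | zero => intro t; simpa [W] using hC₁ t
    | succ n ih =>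
      intro t
      have h := hcontr _ _ (hWm (n + 1)) (hWm n) (hWb _) (hWb _) _ ih t
      rw [← hWs, ← hWs, ← mul_assoc κ, ← pow_succ'] at h
      exact h
  have hdist : ∀ t n, dist (W n t) (W (n + 1) t) ≤ (C₁ * Real.exp (ξ * |t|)) * κ ^ n := by
    intro t n
    rw [dist_comm, dist_eq_norm]
    exact (hgeo n t).trans_eq (by ring)
  have hex : ∀ t, ∃ y, Tendsto (fun n => W n t) atTop (𝓝 y) := fun t =>
    cauchySeq_tendsto_of_complete (cauchySeq_of_le_geometric κ _ hκ (hdist t))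
  choose y hy using hex
  have hym : StronglyMeasurable y :=
    stronglyMeasurable_of_tendsto atTop hWm (tendsto_pi_nhds.2 hy)
  have hdy : ∀ n t, ‖W n t - y t‖ ≤ (C₁ / (1 - κ) * κ ^ n) * Real.exp (ξ * |t|) := by
    intro n t
    rw [← dist_eq_norm]
    exact (dist_le_of_le_geometric_of_tendsto κ _ hκ (hdist t) (hy t) n).trans_eq (by ring)
  have hyb : ∃ C', ∀ t, ‖y t‖ ≤ C' * Real.exp (ξ * |t|) :=
    ⟨_, fun t => by simpa [W] using hdy 0 t⟩
  refine ⟨y, hym, hyb, fun t => ?_⟩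
  -- The iterates converge in the weighted norm with geometric rate, so the contraction estimate
  -- carries the limit through `T` without a separate convergence theorem for the integrals.
  have hlim : Tendsto (fun n => W (n + 1) t) atTop (𝓝 (T y t)) := by
    rw [tendsto_iff_norm_sub_tendsto_zero]
    have h0 : Tendsto (fun n : ℕ => κ * (C₁ / (1 - κ) * κ ^ n) * Real.exp (ξ * |t|)) atTop
        (𝓝 (κ * (C₁ / (1 - κ) * 0) * Real.exp (ξ * |t|))) :=
      (((tendsto_pow_atTop_nhds_zero_of_lt_one hκ0 hκ).const_mul _).const_mul _).mul_const _
    rw [mul_zero, mul_zero, zero_mul] at h0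
    refine squeeze_zero (fun n => norm_nonneg _) (fun n => ?_) h0
    rw [hWs]
    exact hcontr _ _ (hWm n) hym (hWb n) hyb _ (hdy n) t
  exact tendsto_nhds_unique ((tendsto_add_atTop_iff_nat 1).2 (hy t)) hlim

/-- Solutions of a linear integral equation with pointwise vanishing, dominated inhomogeneities
tend to zero pointwise. -/
theorem tendsto_zero_of_integral_eq {K : ℝ → ℝ → Y →L[ℝ] Y} {M η ξ δ C : ℝ}
    (hK : IsKernel K M η ξ) (hη : 0 < η) (hM : 0 ≤ M) (hδ : 0 ≤ δ) (hκ : δ * (2 * M / η) < 1)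
    {A : ℝ → Y →L[ℝ] Y} (hA : ∀ s, ‖A s‖ ≤ δ) {D q : ℕ → ℝ → Y}
    (hDm : ∀ n, StronglyMeasurable (D n)) (hqm : ∀ n, StronglyMeasurable (q n))
    (hDb : ∀ n t, ‖D n t‖ ≤ C * Real.exp (ξ * |t|))
    (hqb : ∀ n t, ‖q n t‖ ≤ C * Real.exp (ξ * |t|))
    (hq : ∀ t, Tendsto (fun n => q n t) atTop (𝓝 0))
    (hD : ∀ n t, D n t = ∫ s, K t s (A s (D n s) + q n s)) (t : ℝ) :
    Tendsto (fun n => D n t) atTop (𝓝 0) := by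
  set κ := δ * (2 * M / η) with hκdef
  have hκ0 : 0 ≤ κ := by positivity
  have hC : 0 ≤ C := by simpa using (norm_nonneg _).trans (hDb 0 0)
  let k : ℝ → ℝ → ENNReal := fun t s => ENNReal.ofReal ‖K t s‖
  have hkm : ∀ t, Measurable (k t) := fun t =>
    ((hK.meas.comp_measurable (measurable_const.prodMk measurable_id)).norm.measurable).ennreal_ofReal
  -- The estimate is carried out in `ENNReal`, where upper limits and integrals exist
  -- unconditionally.
  let F : ℕ → ℝ → ℝ → ENNReal := fun n t s =>
    k t s * (ENNReal.ofReal δ * ENNReal.ofReal ‖D n s‖ + ENNReal.ofReal ‖q n s‖)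
  have hFm : ∀ n t, Measurable (F n t) := fun n t =>
    (hkm t).mul (((hDm n).norm.measurable.ennreal_ofReal.const_mul _).add
      (hqm n).norm.measurable.ennreal_ofReal)
  have hDF : ∀ n t, ENNReal.ofReal ‖D n t‖ ≤ ∫⁻ s, F n t s := by
    intro n t
    rw [hD n t, ofReal_norm]
    refine (enorm_integral_le_lintegral_enorm _).trans (lintegral_mono fun s => ?_)
    rw [← ofReal_norm]
    simp only [F, k]
    rw [← ENNReal.ofReal_mul hδ, ← ENNReal.ofReal_add (by positivity) (by positivity),
      ← ENNReal.ofReal_mul (by positivity)]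
    refine ENNReal.ofReal_le_ofReal (((K t s).le_opNorm _).trans ?_)
    gcongr
    refine (norm_add_le _ _).trans ?_
    gcongr
    exact (A s).le_of_opNorm_le (hA s) _
  have hker : ∀ (c : ℝ), 0 ≤ c → ∀ t,
      ∫⁻ s, k t s * ENNReal.ofReal (c * Real.exp (ξ * |s|)) ≤
        ENNReal.ofReal (c * (2 * M / η) * Real.exp (ξ * |t|)) := by
    intro c hc t
    have h1 : ∀ s, k t s * ENNReal.ofReal (c * Real.exp (ξ * |s|)) ≤
        ENNReal.ofReal (c * M * Real.exp (ξ * |t|) * Real.exp (-η * |t - s|)) := by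
      intro s
      simp only [k]
      rw [← ENNReal.ofReal_mul (norm_nonneg _)]
      refine ENNReal.ofReal_le_ofReal ?_
      have := mul_le_mul_of_nonneg_left (hK.bound t s) hc
      linarith
    refine (lintegral_mono h1).trans ?_
    rw [← ofReal_integral_eq_lintegral_ofReal
      ((integrable_exp_neg_mul_abs_sub hη t).const_mul _) (ae_of_all _ fun s => by positivity),
      integral_const_mul, integral_exp_neg_mul_abs_sub hη]
    exact ENNReal.ofReal_le_ofReal (le_of_eq (by ring))
  -- The upper limit `a` of the norms satisfies the homogeneous inequality `a ≤ ∫ k δ a`, because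
  -- reverse Fatou moves the upper limit under the integral and `q n` vanishes in the limit. Fatou
  -- needs an integrable majorant; the uniform bounds on `D n` and `q n` provide it.
  let a : ℝ → ENNReal := fun t => limsup (fun n => ENNReal.ofReal ‖D n t‖) atTop
  have ha : ∀ t, a t ≤ ∫⁻ s, k t s * (ENNReal.ofReal δ * a s) := by
    intro t
    calc a t ≤ limsup (fun n => ∫⁻ s, F n t s) atTop :=
          limsup_le_limsup (Eventually.of_forall fun n => hDF n t)
      _ ≤ ∫⁻ s, limsup (fun n => F n t s) atTop := by
          refine limsup_lintegral_le
            (fun s => k t s * ENNReal.ofReal ((δ * C + C) * Real.exp (ξ * |s|)))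
            (fun n => hFm n t) (fun n => ae_of_all _ fun s => ?_) ?_
          · simp only [F]
            gcongr
            rw [← ENNReal.ofReal_mul hδ, ← ENNReal.ofReal_add (by positivity) (by positivity)]
            refine ENNReal.ofReal_le_ofReal ?_
            have h1 := mul_le_mul_of_nonneg_left (hDb n s) hδ
            have h2 := hqb n s
            linarith
          · exact ne_top_of_le_ne_top ENNReal.ofReal_ne_top
              (hker (δ * C + C) (by positivity) t)
      _ ≤ ∫⁻ s, k t s * (ENNReal.ofReal δ * a s) := by
          refine lintegral_mono fun s => ?_
          simp only [F]
          rw [ENNReal.limsup_const_mul_of_ne_top ENNReal.ofReal_ne_top]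
          gcongr
          have h0 : Tendsto (fun n => ENNReal.ofReal ‖q n s‖) atTop (𝓝 0) := by
            simpa using ENNReal.tendsto_ofReal (hq s).norm
          have h1 := ENNReal.limsup_add_of_right_tendsto_zero h0
            (fun n => ENNReal.ofReal δ * ENNReal.ofReal ‖D n s‖)
          rw [ENNReal.limsup_const_mul_of_ne_top ENNReal.ofReal_ne_top] at h1
          exact h1.le
  -- Iterating the homogeneous inequality gains a factor `κ` each time, so `a` vanishes.
  have hpow : ∀ m : ℕ, ∀ t, a t ≤ ENNReal.ofReal (κ ^ m * C * Real.exp (ξ * |t|)) := by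
    intro m
    induction m with
    | zero =>
      intro t
      refine (limsup_le_limsup (Eventually.of_forall fun n =>
        ENNReal.ofReal_le_ofReal (hDb n t))).trans ?_
      simp
    | succ m ih =>
      intro t
      refine (ha t).trans ?_
      refine (lintegral_mono (g := fun s => k t s * ENNReal.ofReal
        ((δ * (κ ^ m * C)) * Real.exp (ξ * |s|))) fun s => ?_).trans
        ((hker _ (by positivity) t).trans_eq ?_)
      · dsimp only
        rw [mul_assoc δ, ENNReal.ofReal_mul hδ]
        gcongr
        exact ih s
      · congr 1
        rw [hκdef, pow_succ]; ring
  have ha0 : a t = 0 := by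
    have hlim : Tendsto (fun m : ℕ => ENNReal.ofReal (κ ^ m * C * Real.exp (ξ * |t|))) atTop
        (𝓝 0) := by
      have := ENNReal.tendsto_ofReal
        (((tendsto_pow_atTop_nhds_zero_of_lt_one hκ0 hκ).mul_const C).mul_const
          (Real.exp (ξ * |t|)))
      simpa using this
    exact le_antisymm (ge_of_tendsto' hlim fun m => hpow m t) zero_le
  have hT : Tendsto (fun n => ENNReal.ofReal ‖D n t‖) atTop (𝓝 0) :=
    tendsto_of_le_liminf_of_limsup_le zero_le (le_of_eq ha0)
  rw [tendsto_zero_iff_norm_tendsto_zero]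
  have := (ENNReal.tendsto_toReal ENNReal.zero_ne_top).comp hT
  simpa [Function.comp_def, ENNReal.toReal_ofReal] using this

end

/-! ### Differentiating integral equations with respect to a parameter -/

section Differentiability

variable {Y : Type*} [NormedAddCommGroup Y] [NormedSpace ℝ Y]
  {P : Type*} [NormedAddCommGroup P] [NormedSpace ℝ P]

/-- Gronwall-type estimate for integral inequalities with a contracting kernel. -/
theorem IsKernel.norm_le_of_integral_eq {K : ℝ → ℝ → Y →L[ℝ] Y} {M η ξ δ C : ℝ}
    (hK : IsKernel K M η ξ) (hη : 0 < η) (hM : 0 ≤ M) (hδ : 0 ≤ δ) (hκ : δ * (2 * M / η) < 1)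
    (hC : 0 ≤ C) {w g : ℝ → Y} (hw : ∀ t, w t = ∫ s, K t s (g s))
    (hg : ∀ s, ‖g s‖ ≤ δ * ‖w s‖ + C * Real.exp (ξ * |s|))
    (hb : ∃ C', ∀ t, ‖w t‖ ≤ C' * Real.exp (ξ * |t|)) (t : ℝ) :
    ‖w t‖ ≤ C * (2 * M / η) / (1 - δ * (2 * M / η)) * Real.exp (ξ * |t|) := by
  refine le_div_one_sub_of_self_improving (ρ := fun t => ‖w t‖)
    (ω := fun t => Real.exp (ξ * |t|)) (by positivity) hκ (by positivity) hb
    (fun _ => (Real.exp_pos _).le) (fun C' hC' h t => ?_) t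
  rw [hw t]
  refine (hK.norm_integral_le hη (C := δ * C' + C) (fun s => ?_) t).trans_eq (by ring)
  refine (hg s).trans ?_
  rw [add_mul, mul_assoc]
  gcongr
  exact h s

/-- Differentiation of an integral equation with respect to a parameter. -/
theorem IsKernel.hasFDerivAt_of_integral_eq [CompleteSpace Y]
    {K : ℝ → ℝ → Y →L[ℝ] Y} {M η ξ δ C : ℝ}
    (hK : IsKernel K M η ξ) (hη : 0 < η) (hM : 0 ≤ M) (hδ : 0 ≤ δ) (hκ : δ * (2 * M / η) < 1)
    {w g : ℝ → P → Y} {x₀ : P} {A : ℝ → Y →L[ℝ] Y} {B W : ℝ → P →L[ℝ] Y}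
    (hwm : ∀ x, StronglyMeasurable fun s => w s x)
    (hgm : ∀ x, StronglyMeasurable fun s => g s x)
    (hAm : StronglyMeasurable A) (hBm : StronglyMeasurable B) (hWm : StronglyMeasurable W)
    (hw : ∀ t x, w t x = ∫ s, K t s (g s x))
    (hgb : ∀ x, ∃ C', ∀ s, ‖g s x‖ ≤ C' * Real.exp (ξ * |s|))
    (hwl : ∀ s x, ‖w s x - w s x₀‖ ≤ C * Real.exp (ξ * |s|) * ‖x - x₀‖)
    (hgl : ∀ s x, ‖g s x - g s x₀‖ ≤ C * Real.exp (ξ * |s|) * ‖x - x₀‖)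
    (hA : ∀ s, ‖A s‖ ≤ δ) (hB : ∀ s, ‖B s‖ ≤ C * Real.exp (ξ * |s|))
    (hWb : ∀ s, ‖W s‖ ≤ C * Real.exp (ξ * |s|))
    (hW : ∀ t, W t = ∫ s, ContinuousLinearMap.compL ℝ P Y Y (K t s) (A s ∘L W s + B s))
    (hlin : ∀ s, (fun x => g s x - g s x₀ - A s (w s x - w s x₀) - B s (x - x₀))
      =o[𝓝 x₀] fun x => x - x₀) (t : ℝ) :
    HasFDerivAt (w t) (W t) x₀ := by
  have hC : 0 ≤ C := by simpa using (norm_nonneg _).trans (hB 0)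
  rw [hasFDerivAt_iff_tendsto]
  refine tendsto_of_seq_tendsto fun x hx => ?_
  -- When `x n = x₀` this factor is `0`, so the quotients below need no case distinction.
  let c : ℕ → ℝ := fun n => ‖x n - x₀‖⁻¹
  let D : ℕ → ℝ → Y := fun n s => c n • (w s (x n) - w s x₀ - W s (x n - x₀))
  let q : ℕ → ℝ → Y := fun n s => c n •
    (g s (x n) - g s x₀ - A s (w s (x n) - w s x₀) - B s (x n - x₀))
  have happ : ∀ {Z : Type _} [NormedAddCommGroup Z] [NormedSpace ℝ Z] {T : ℝ → Z →L[ℝ] Y}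
      {z : ℝ → Z}, StronglyMeasurable T → StronglyMeasurable z →
      StronglyMeasurable fun s => T s (z s) := fun hT hz =>
    (continuous_fst.clm_apply continuous_snd).comp_stronglyMeasurable (hT.prodMk hz)
  have happ' : ∀ {T : ℝ → P →L[ℝ] Y} (z : P), StronglyMeasurable T →
      StronglyMeasurable fun s => T s z := fun z hT =>
    (ContinuousLinearMap.apply ℝ Y z).continuous.comp_stronglyMeasurable hT
  have hAW : StronglyMeasurable fun s => A s ∘L W s + B s :=
    (((continuous_fst.clm_comp continuous_snd).comp_stronglyMeasurable (hAm.prodMk hWm))).add hBm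
  have hAWb : ∀ s, ‖A s ∘L W s + B s‖ ≤ (δ * C + C) * Real.exp (ξ * |s|) := by
    intro s
    refine (norm_add_le _ _).trans ?_
    rw [add_mul, mul_assoc]
    refine add_le_add ((ContinuousLinearMap.opNorm_comp_le _ _).trans ?_) (hB s)
    exact mul_le_mul (hA s) (hWb s) (norm_nonneg _) hδ
  have hcC : ∀ n (a : ℝ), 0 ≤ a → c n * (a * ‖x n - x₀‖) ≤ a := by
    intro n a ha
    rw [mul_left_comm]
    exact mul_le_of_le_one_right ha (inv_mul_le_one)
  have hc0 : ∀ n, 0 ≤ c n := fun n => inv_nonneg.2 (norm_nonneg _)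
  -- Subtracting the equations of `w (x n)`, `w x₀` and `W` shows that the normalised remainder `D`
  -- solves the linear equation with coefficient `A` and inhomogeneity `q`. By `hlin`, `q` tends to
  -- zero for each fixed time, which suffices here; no uniformity in time is needed.
  have key := tendsto_zero_of_integral_eq (K := K) (A := A) (D := D) (q := q)
    (C := (2 + δ) * C) hK hη hM hδ hκ hA
    (fun n => (((hwm _).sub (hwm _)).sub (happ' _ hWm)).const_smul _)
    (fun n => ((((hgm _).sub (hgm _)).sub (happ hAm ((hwm _).sub (hwm _)))).sub
      (happ' _ hBm)).const_smul _) ?_ ?_ ?_ ?_ t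
  · have := key.norm
    simpa [D, c, norm_smul, Function.comp_def] using this
  · intro n s
    simp only [D]
    rw [norm_smul, Real.norm_of_nonneg (hc0 n)]
    have h1 : ‖w s (x n) - w s x₀ - W s (x n - x₀)‖ ≤
        ((2 + δ) * C * Real.exp (ξ * |s|)) * ‖x n - x₀‖ := by
      refine (norm_sub_le _ _).trans ?_
      have h2 := hwl s (x n)
      have h3 := (W s).le_of_opNorm_le (hWb s) (x n - x₀)
      have h4 : 0 ≤ δ * C * Real.exp (ξ * |s|) * ‖x n - x₀‖ := by positivity
      linarith
    exact (mul_le_mul_of_nonneg_left h1 (hc0 n)).trans (hcC n _ (by positivity))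
  · intro n s
    simp only [q]
    rw [norm_smul, Real.norm_of_nonneg (hc0 n)]
    have h1 : ‖g s (x n) - g s x₀ - A s (w s (x n) - w s x₀) - B s (x n - x₀)‖ ≤
        ((2 + δ) * C * Real.exp (ξ * |s|)) * ‖x n - x₀‖ := by
      refine (norm_sub_le _ _).trans ?_
      have h0 := norm_sub_le (g s (x n) - g s x₀) (A s (w s (x n) - w s x₀))
      have h2 := hgl s (x n)
      have h3 := (B s).le_of_opNorm_le (hB s) (x n - x₀)
      have h4 := (A s).le_of_opNorm_le (hA s) (w s (x n) - w s x₀)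
      have h5 := mul_le_mul_of_nonneg_left (hwl s (x n)) hδ
      linarith
    exact (mul_le_mul_of_nonneg_left h1 (hc0 n)).trans (hcC n _ (by positivity))
  · intro s
    have h1 := (hlin s).norm_norm.tendsto_div_nhds_zero.comp hx
    rw [tendsto_zero_iff_norm_tendsto_zero]
    refine h1.congr fun n => ?_
    simp only [q, c, Function.comp_apply, norm_smul, norm_inv, norm_norm]
    rw [div_eq_inv_mul]
  · intro n t
    obtain ⟨C₁, hC₁⟩ := hgb (x n)
    obtain ⟨C₀, hC₀⟩ := hgb x₀
    have hi1 := hK.integrable hη (hgm (x n)) hC₁ t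
    have hi0 := hK.integrable hη (hgm x₀) hC₀ t
    have hi : Integrable fun s => K t s (g s (x n)) - K t s (g s x₀) := hi1.sub hi0
    have hiW := (hK.compL P).integrable hη hAW hAWb t
    have hWa : W t (x n - x₀) = ∫ s, K t s ((A s ∘L W s + B s) (x n - x₀)) := by
      rw [hW t, ContinuousLinearMap.integral_apply hiW]
      rfl
    have hiWa : Integrable fun s => K t s ((A s ∘L W s + B s) (x n - x₀)) :=
      hiW.apply_continuousLinearMap _
    simp only [D]
    rw [hw, hw, hWa, ← integral_sub hi1 hi0, ← integral_sub hi hiWa, ← integral_smul]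
    refine integral_congr_ae (ae_of_all _ fun s => ?_)
    simp only [q, map_sub, map_add, map_smul, add_apply,
      ContinuousLinearMap.comp_apply]
    module

end Differentiability

/-! ### Smooth families with exponentially growing derivatives -/

/-- Families of `C^m` maps whose `j`-th derivatives grow at most like `exp ((r + j) σ |s|)`. -/
structure WeightedSmooth {P Z : Type*} [NormedAddCommGroup P] [NormedSpace ℝ P]
    [NormedAddCommGroup Z] [NormedSpace ℝ Z] (σ : ℝ) (m r : ℕ) (f : ℝ → P → Z) : Prop where
  contDiff : ∀ s, ContDiff ℝ m (f s)
  meas : ∀ x, StronglyMeasurable fun s => f s x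
  bound : ∃ C, ∀ j ≤ m, ∀ s x,
    ‖iteratedFDeriv ℝ j (f s) x‖ ≤ C * Real.exp ((r + j : ℕ) * σ * |s|)

namespace WeightedSmooth

variable {P Z Z₁ Z₂ Z₃ : Type*} [NormedAddCommGroup P] [NormedSpace ℝ P]
  [NormedAddCommGroup Z] [NormedSpace ℝ Z] [NormedAddCommGroup Z₁] [NormedSpace ℝ Z₁]
  [NormedAddCommGroup Z₂] [NormedSpace ℝ Z₂] [NormedAddCommGroup Z₃] [NormedSpace ℝ Z₃]
  {σ : ℝ} {m r r₁ r₂ : ℕ}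

theorem of_le {f : ℝ → P → Z} (hf : WeightedSmooth σ m r f) {m' : ℕ} (h : m' ≤ m) :
    WeightedSmooth σ m' r f where
  contDiff s := (hf.contDiff s).of_le (by exact_mod_cast h)
  meas := hf.meas
  bound := hf.bound.imp fun _ hC j hj => hC j (hj.trans h)

theorem exists_norm_le {f : ℝ → P → Z} (hf : WeightedSmooth σ m r f) :
    ∃ C, 0 ≤ C ∧ ∀ s x, ‖f s x‖ ≤ C * Real.exp (r * σ * |s|) := by
  obtain ⟨C, hC⟩ := hf.bound
  have h : ∀ s x, ‖f s x‖ ≤ C * Real.exp (r * σ * |s|) := fun s x => by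
    simpa using hC 0 (zero_le) s x
  exact ⟨C, by simpa using (norm_nonneg _).trans (h 0 0), h⟩

theorem add {f g : ℝ → P → Z} (hf : WeightedSmooth σ m r f) (hg : WeightedSmooth σ m r g) :
    WeightedSmooth σ m r fun s x => f s x + g s x where
  contDiff s := (hf.contDiff s).add (hg.contDiff s)
  meas x := (hf.meas x).add (hg.meas x)
  bound := by
    obtain ⟨C₁, h₁⟩ := hf.bound
    obtain ⟨C₂, h₂⟩ := hg.bound
    refine ⟨C₁ + C₂, fun j hj s x => ?_⟩
    have hj' : (j : WithTop ℕ∞) ≤ (m : WithTop ℕ∞) := by exact_mod_cast hj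
    have : iteratedFDeriv ℝ j (fun x => f s x + g s x) x =
        iteratedFDeriv ℝ j (f s) x + iteratedFDeriv ℝ j (g s) x :=
      iteratedFDeriv_add_apply ((hf.contDiff s).of_le hj').contDiffAt
        ((hg.contDiff s).of_le hj').contDiffAt
    rw [this, add_mul]
    exact (norm_add_le _ _).trans (add_le_add (h₁ j hj s x) (h₂ j hj s x))

/-- Leibniz rule. The term with `i` and `j - i` derivatives grows at rate `(r₁ + i) + (r₂ + j - i)`,
independent of `i`, so the offsets add; the binomial coefficients sum to at most `2 ^ m`. -/
theorem bilinear (B : Z₁ →L[ℝ] Z₂ →L[ℝ] Z₃) {f : ℝ → P → Z₁} {g : ℝ → P → Z₂}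
    (hf : WeightedSmooth σ m r₁ f) (hg : WeightedSmooth σ m r₂ g) :
    WeightedSmooth σ m (r₁ + r₂) fun s x => B (f s x) (g s x) where
  contDiff s := (B.contDiff.comp (hf.contDiff s)).clm_apply (hg.contDiff s)
  meas x := ((B.continuous.comp continuous_fst).clm_apply continuous_snd).comp_stronglyMeasurable
    ((hf.meas x).prodMk (hg.meas x))
  bound := by
    obtain ⟨C₁, h₁⟩ := hf.bound
    obtain ⟨C₂, h₂⟩ := hg.bound
    have hC₁ : 0 ≤ C₁ := by simpa using (norm_nonneg _).trans (h₁ 0 zero_le 0 0)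
    have hC₂ : 0 ≤ C₂ := by simpa using (norm_nonneg _).trans (h₂ 0 zero_le 0 0)
    refine ⟨‖B‖ * (2 ^ m * (C₁ * C₂)), fun j hj s x => ?_⟩
    have hj' : (j : WithTop ℕ∞) ≤ (m : WithTop ℕ∞) := by exact_mod_cast hj
    refine (B.norm_iteratedFDeriv_le_of_bilinear (hf.contDiff s) (hg.contDiff s) x hj').trans ?_
    rw [mul_assoc]
    refine mul_le_mul_of_nonneg_left ?_ (ContinuousLinearMap.opNorm_nonneg B)
    have hterm : ∀ i ∈ Finset.range (j + 1), (j.choose i : ℝ) * ‖iteratedFDeriv ℝ i (f s) x‖ *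
        ‖iteratedFDeriv ℝ (j - i) (g s) x‖ ≤
        (j.choose i : ℝ) * (C₁ * C₂ * Real.exp ((r₁ + r₂ + j : ℕ) * σ * |s|)) := by
      intro i hi
      have hij : i ≤ j := Nat.lt_succ_iff.1 (Finset.mem_range.1 hi)
      rw [mul_assoc]
      refine mul_le_mul_of_nonneg_left ?_ (by positivity)
      refine (mul_le_mul (h₁ i (hij.trans hj) s x) (h₂ (j - i) ((Nat.sub_le _ _).trans hj) s x)
        (norm_nonneg _) (by positivity)).trans_eq ?_
      rw [mul_mul_mul_comm, ← Real.exp_add, ← add_mul, ← add_mul, ← Nat.cast_add]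
      rw [show r₁ + i + (r₂ + (j - i)) = r₁ + r₂ + j by omega]
    refine (Finset.sum_le_sum hterm).trans ?_
    rw [← Finset.sum_mul, ← Nat.cast_sum, Nat.sum_range_choose]
    push_cast
    rw [← mul_assoc]
    gcongr
    norm_num

theorem clm (T : Z₁ →L[ℝ] Z₂) {f : ℝ → P → Z₁} (hf : WeightedSmooth σ m r f) :
    WeightedSmooth σ m r fun s x => T (f s x) where
  contDiff s := T.contDiff.comp (hf.contDiff s)
  meas x := T.continuous.comp_stronglyMeasurable (hf.meas x)
  bound := by
    obtain ⟨C, h⟩ := hf.bound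
    refine ⟨‖T‖ * C, fun j hj s x => ?_⟩
    have hj' : (j : WithTop ℕ∞) ≤ (m : WithTop ℕ∞) := by exact_mod_cast hj
    refine (T.norm_iteratedFDeriv_comp_left (hf.contDiff s).contDiffAt hj').trans ?_
    rw [mul_assoc]
    exact mul_le_mul_of_nonneg_left (h j hj s x) (norm_nonneg _)

/-- A family of operators on a finite-dimensional space that is measurable at each vector is
measurable. -/
theorem _root_.QuiverCM.stronglyMeasurable_clm_of_apply [FiniteDimensional ℝ P]
    {T : ℝ → P →L[ℝ] Z} (h : ∀ v, StronglyMeasurable fun s => T s v) : StronglyMeasurable T := by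
  let b := Module.finBasis ℝ P
  have hT : T = fun s => ∑ i, ContinuousLinearMap.smulRightL ℝ P Z
      (LinearMap.toContinuousLinearMap (b.coord i)) (T s (b i)) := by
    funext s
    ext v
    conv_lhs => rw [← b.sum_repr v, map_sum]
    simp [b]
  rw [hT]
  exact Finset.stronglyMeasurable_fun_sum _ fun i _ =>
    (ContinuousLinearMap.smulRightL ℝ P Z _).continuous.comp_stronglyMeasurable (h (b i))

/-- Derivative number `j` of the differential is derivative number `j + 1` of the family: one order
of smoothness is traded for one unit of growth offset. `of_hasFDerivAt` is the reverse trade. -/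
theorem fderiv_family [FiniteDimensional ℝ P] {f : ℝ → P → Z} (hf : WeightedSmooth σ (m + 1) r f) :
    WeightedSmooth σ m (r + 1) fun s x => fderiv ℝ (f s) x where
  contDiff s := (hf.contDiff s).fderiv_right (by push_cast; rfl)
  meas x := by
    refine stronglyMeasurable_clm_of_apply fun v => ?_
    have hd : ∀ s, DifferentiableAt ℝ (f s) x := fun s =>
      (hf.contDiff s).differentiable (by simp) x
    -- Directional derivatives are limits of difference quotients, which are measurable in `s`.
    refine stronglyMeasurable_of_tendsto (u := atTop)
      (f := fun (n : ℕ) s => (n : ℝ) • (f s (x + (n : ℝ)⁻¹ • v) - f s x)) (fun n =>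
        ((hf.meas _).sub (hf.meas _)).const_smul _) (tendsto_pi_nhds.2 fun s => ?_)
    exact (hd s).hasFDerivAt.lim v (c := fun n : ℕ => (n : ℝ)) (by
      simpa using tendsto_natCast_atTop_atTop) 
  bound := by
    obtain ⟨C, h⟩ := hf.bound
    refine ⟨C, fun j hj s x => ?_⟩
    rw [norm_iteratedFDeriv_fderiv]
    have := h (j + 1) (Nat.succ_le_succ hj) s x
    rwa [show r + 1 + j = r + (j + 1) by omega]

theorem of_hasFDerivAt {f : ℝ → P → Z} {f' : ℝ → P → P →L[ℝ] Z}
    (hd : ∀ s x, HasFDerivAt (f s) (f' s x) x) (hm : ∀ x, StronglyMeasurable fun s => f s x)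
    (hb : ∃ C, ∀ s x, ‖f s x‖ ≤ C * Real.exp (r * σ * |s|))
    (hf' : WeightedSmooth σ m (r + 1) f') : WeightedSmooth σ (m + 1) r f where
  contDiff s := by
    push_cast
    exact contDiff_succ_iff_hasFDerivAt.2 ⟨f' s, hf'.contDiff s, hd s⟩
  meas := hm
  bound := by
    obtain ⟨C₁, h₁⟩ := hb
    obtain ⟨C₂, h₂⟩ := hf'.bound
    refine ⟨max C₁ C₂, fun j hj s x => ?_⟩
    cases j with
    | zero =>
      rw [norm_iteratedFDeriv_zero]
      refine (h₁ s x).trans ?_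
      simp only [add_zero]
      gcongr
      exact le_max_left _ _
    | succ j =>
      have hfd : fderiv ℝ (f s) = f' s := funext fun x => (hd s x).fderiv
      rw [← norm_iteratedFDeriv_fderiv, hfd]
      refine (h₂ j (Nat.le_of_succ_le_succ hj) s x).trans ?_
      rw [show r + 1 + j = r + (j + 1) by omega]
      gcongr
      exact le_max_right _ _

/-- Composition of a fixed map having bounded derivatives with a family whose derivatives of
order `j ≥ 1` grow at most like `exp (j σ |s|)`. -/
theorem comp {g : Z₁ → Z₂} (hg : ContDiff ℝ m g) 
    (hgb : ∀ j ≤ m, ∃ C, ∀ x, ‖iteratedFDeriv ℝ j g x‖ ≤ C) {f : ℝ → P → Z₁}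
    (hf : ∀ s, ContDiff ℝ m (f s)) (hm : ∀ x, StronglyMeasurable fun s => f s x)
    (hb : ∃ C, ∀ j, 1 ≤ j → j ≤ m → ∀ s x,
      ‖iteratedFDeriv ℝ j (f s) x‖ ≤ C * Real.exp (j * σ * |s|)) :
    WeightedSmooth σ m 0 fun s x => g (f s x) where
  contDiff s := hg.comp (hf s)
  meas x := hg.continuous.comp_stronglyMeasurable (hm x)
  bound := by
    choose! C hC using hgb
    obtain ⟨D, hD⟩ := hb
    let C' := ∑ j ∈ Finset.range (m + 1), |C j|
    have hC' : ∀ j ≤ m, ∀ x, ‖iteratedFDeriv ℝ j g x‖ ≤ C' := fun j hj x =>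
      (hC j hj x).trans ((le_abs_self _).trans (Finset.single_le_sum (f := fun j => |C j|)
        (fun _ _ => abs_nonneg _) (Finset.mem_range.2 (Nat.lt_succ_of_le hj))))
    have hC'0 : 0 ≤ C' := Finset.sum_nonneg fun _ _ => abs_nonneg _
    -- Faà di Bruno asks for a bound of the form `D' ^ i` on the `i`-th derivative. With `1 ≤ D'`,
    -- the power `D' ^ i` dominates `D` for `i ≥ 1` and is dominated by `D' ^ m`.
    let D' := max 1 D
    have hD1 : 1 ≤ D' := le_max_left _ _
    refine ⟨m.factorial * C' * D' ^ m, fun j hj s x => ?_⟩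
    have hj' : (j : WithTop ℕ∞) ≤ (m : WithTop ℕ∞) := by exact_mod_cast hj
    refine (norm_iteratedFDeriv_comp_le hg (hf s) hj' x (C := C')
      (D := D' * Real.exp (σ * |s|)) (fun i hi => hC' i (hi.trans hj) _)
      (fun i hi hij => ?_)).trans ?_
    · refine (hD i hi (hij.trans hj) s x).trans ?_
      rw [mul_pow, ← Real.exp_nat_mul, mul_assoc]
      gcongr
      exact (le_max_right 1 D).trans (le_self_pow₀ hD1 (by omega))
    · rw [mul_pow, ← Real.exp_nat_mul, zero_add, mul_assoc (j : ℝ), ← mul_assoc]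
      gcongr

end WeightedSmooth

/-- Solutions of linear integral equations depend on parameters as smoothly as the
coefficients. -/
theorem WeightedSmooth.of_integral_eq {P : Type u} [NormedAddCommGroup P] [NormedSpace ℝ P]
    [FiniteDimensional ℝ P] {M η σ δ : ℝ} (hη : 0 < η) (hσ : 0 ≤ σ) (hM : 0 ≤ M) (hδ : 0 ≤ δ)
    (hκ : δ * (2 * M / η) < 1) (m : ℕ) :
    ∀ (Y : Type u) [NormedAddCommGroup Y] [NormedSpace ℝ Y] [CompleteSpace Y] (r : ℕ)
      {K : ℝ → ℝ → Y →L[ℝ] Y}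
      (_ : ∀ i : ℕ, r ≤ i → i ≤ r + m → IsKernel K M η (i * σ))
      {A : ℝ → P → Y →L[ℝ] Y} {b w : ℝ → P → Y} (_ : WeightedSmooth σ m 0 A)
      (_ : WeightedSmooth σ m r b) (_ : ∀ s x, ‖A s x‖ ≤ δ)
      (_ : ∀ x, StronglyMeasurable fun s => w s x)
      (_ : ∀ x, ∃ C, ∀ s, ‖w s x‖ ≤ C * Real.exp (r * σ * |s|))
      (_ : ∀ t x, w t x = ∫ s, K t s (A s x (w s x) + b s x)),
      WeightedSmooth σ m r w := by
  -- The constant in the hypothesis on `w` may depend on `x`; the contraction estimate replaces it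
  -- by one that is uniform in `x`.
  have hA0 : ∀ {Y : Type u} [NormedAddCommGroup Y] [NormedSpace ℝ Y] {m r : ℕ}
      {K : ℝ → ℝ → Y →L[ℝ] Y} {A : ℝ → P → Y →L[ℝ] Y} {b w : ℝ → P → Y},
      IsKernel K M η (r * σ) → WeightedSmooth σ m r b → (∀ s x, ‖A s x‖ ≤ δ) →
      (∀ x, ∃ C, ∀ s, ‖w s x‖ ≤ C * Real.exp (r * σ * |s|)) →
      (∀ t x, w t x = ∫ s, K t s (A s x (w s x) + b s x)) →
      ∃ C, 0 ≤ C ∧ ∀ s x, ‖w s x‖ ≤ C * Real.exp (r * σ * |s|) := by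
    intro Y _ _ m r K A b w hK hb hAδ hwb hw
    obtain ⟨C, hC0, hC⟩ := hb.exists_norm_le
    have h1 : 0 < 1 - δ * (2 * M / η) := by linarith
    refine ⟨C * (2 * M / η) / (1 - δ * (2 * M / η)), by positivity, fun s x => ?_⟩
    exact hK.norm_le_of_integral_eq hη hM hδ hκ hC0 (w := fun t => w t x) (fun t => hw t x)
      (fun s => (norm_add_le _ _).trans
        (add_le_add ((A s x).le_of_opNorm_le (hAδ s x) _) (hC s x))) (hwb x) s
  -- The induction hypothesis covers all spaces `Y` and all offsets `r`: the derivative of `w` takes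
  -- values in `P →L[ℝ] Y`, which lies in the same universe, and satisfies an equation of the same
  -- type with `r + 1` and one order less. The required kernel weights `r + 1, …, r + 1 + m` are
  -- among those available.
  induction m with
  | zero =>
    intro Y _ _ _ r K hK A b w hA hb hAδ hwm hwb hw
    have hKr := hK r le_rfl (by omega)
    obtain ⟨C, hC0, hC⟩ := hA0 hKr hb hAδ hwb hw
    obtain ⟨Cb, hCb0, hCb⟩ := hb.exists_norm_le
    refine ⟨fun t => ?_, hwm, C, fun j hj s x => ?_⟩
    · rw [Nat.cast_zero, contDiff_zero]
      refine continuous_iff_continuousAt.2 fun x₀ => tendsto_of_seq_tendsto fun x hx => ?_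
      have hAc : ∀ s, Continuous (A s) := fun s => (hA.contDiff s).continuous
      have hbc : ∀ s, Continuous (b s) := fun s => (hb.contDiff s).continuous
      have hAwm : ∀ x y, StronglyMeasurable fun s => A s x (w s y) := fun x y =>
        (continuous_fst.clm_apply continuous_snd).comp_stronglyMeasurable
          ((hA.meas x).prodMk (hwm y))
      have hAwb : ∀ s x y, ‖A s x (w s y)‖ ≤ δ * C * Real.exp (r * σ * |s|) := fun s x y =>
        ((A s x).le_of_opNorm_le (hAδ s x) _).trans (by
          rw [mul_assoc]; exact mul_le_mul_of_nonneg_left (hC s y) hδ)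
      -- Sequential continuity: the difference `w (x n) - w x₀` solves the equation with frozen
      -- coefficient `A s x₀`, and the error of freezing tends to zero pointwise.
      have key := tendsto_zero_of_integral_eq (K := K) (A := fun s => A s x₀)
        (D := fun n s => w s (x n) - w s x₀)
        (q := fun n s => (A s (x n) (w s (x n)) - A s x₀ (w s (x n))) + (b s (x n) - b s x₀))
        (C := 2 * C + 2 * δ * C + 2 * Cb) hKr hη hM hδ hκ
        (fun s => hAδ s x₀) (fun n => (hwm _).sub (hwm _))
        (fun n => ((hAwm _ _).sub (hAwm _ _)).add ((hb.meas _).sub (hb.meas _))) ?_ ?_ ?_ ?_ t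
      · exact tendsto_sub_nhds_zero_iff.1 key
      · intro n s
        refine (norm_sub_le _ _).trans ?_
        have h1 := hC s (x n)
        have h2 := hC s x₀
        have h3 : 0 ≤ (2 * δ * C + 2 * Cb) * Real.exp (r * σ * |s|) := by positivity
        linarith
      · intro n s
        refine (norm_add_le _ _).trans ?_
        have h1 := norm_sub_le (A s (x n) (w s (x n))) (A s x₀ (w s (x n)))
        have h2 := norm_sub_le (b s (x n)) (b s x₀)
        have h3 := hAwb s (x n) (x n)
        have h4 := hAwb s x₀ (x n)
        have h5 := hCb s (x n)
        have h6 := hCb s x₀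
        have h7 : 0 ≤ (2 * C) * Real.exp (r * σ * |s|) := by positivity
        linarith
      · intro s
        have h1 : Tendsto (fun n => A s (x n) - A s x₀) atTop (𝓝 0) :=
          tendsto_sub_nhds_zero_iff.2 (((hAc s).tendsto x₀).comp hx)
        have h2 : Tendsto (fun n => b s (x n) - b s x₀) atTop (𝓝 0) :=
          tendsto_sub_nhds_zero_iff.2 (((hbc s).tendsto x₀).comp hx)
        have h3 : Tendsto (fun n => (A s (x n) - A s x₀) (w s (x n))) atTop (𝓝 0) := by
          have h4 := h1.norm.mul_const (C * Real.exp (r * σ * |s|))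
          rw [norm_zero, zero_mul] at h4
          refine squeeze_zero_norm (fun n => ?_) h4
          exact (ContinuousLinearMap.le_opNorm _ _).trans
            (mul_le_mul_of_nonneg_left (hC s _) (norm_nonneg _))
        simpa using h3.add h2
      · intro n t
        have hi : ∀ y, Integrable fun s => K t s (A s y (w s y) + b s y) := fun y =>
          hKr.integrable hη (C := δ * C + Cb) ((hAwm y y).add (hb.meas y)) (fun s =>
            (norm_add_le _ _).trans
              ((add_le_add (hAwb s y y) (hCb s y)).trans_eq (by ring))) t
        rw [hw t (x n), hw t x₀, ← integral_sub (hi _) (hi _)]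
        refine integral_congr_ae (ae_of_all _ fun s => ?_)
        simp only [map_sub, map_add]
        abel
    · obtain rfl : j = 0 := by omega
      simpa using hC s x
  | succ m ih =>
    intro Y _ _ _ r K hK A b w hA hb hAδ hwm hwb hw
    have hw_m : WeightedSmooth σ m r w :=
      ih Y r (fun i h1 h2 => hK i h1 (by omega)) (hA.of_le (Nat.le_succ m))
        (hb.of_le (Nat.le_succ m)) hAδ hwm hwb hw
    have hKr := hK r le_rfl (by omega)
    -- Differentiating `A` costs a factor `exp (σ|s|)`, so increments and derivatives of `w` are
    -- controlled only in the weight of index `r + 1`.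
    have hKr1 := hK (r + 1) (by omega) (by omega)
    obtain ⟨C, hC0, hC⟩ := hw_m.exists_norm_le
    -- The formally differentiated equation: `Dw = ∫ K (A ∘ Dw + b')`, where `b'` collects `DA`
    -- applied to `w`, and `Db`.
    let A' : ℝ → P → (P →L[ℝ] Y) →L[ℝ] (P →L[ℝ] Y) := fun s x =>
      ContinuousLinearMap.compL ℝ P Y Y (A s x)
    let b' : ℝ → P → P →L[ℝ] Y := fun s x =>
      (fderiv ℝ (A s) x).flip (w s x) + fderiv ℝ (b s) x
    have hA' : WeightedSmooth σ m 0 A' := 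
      WeightedSmooth.clm (Z₂ := (P →L[ℝ] Y) →L[ℝ] (P →L[ℝ] Y))
        (ContinuousLinearMap.compL ℝ P Y Y) (hA.of_le (Nat.le_succ m))
    have hDA := hA.fderiv_family
    have hDAw : WeightedSmooth σ m (r + 1) fun s x => (fderiv ℝ (A s) x).flip (w s x) := by
      have := WeightedSmooth.bilinear
        (ContinuousLinearMap.flipₗᵢ ℝ P Y Y).toContinuousLinearEquiv.toContinuousLinearMap hDA hw_m
      rw [show r + 1 = 0 + 1 + r by omega]
      exact this
    have hb' : WeightedSmooth σ m (r + 1) b' := hDAw.add hb.fderiv_family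
    have hA'δ : ∀ s x, ‖A' s x‖ ≤ δ := fun s x =>
      ContinuousLinearMap.opNorm_le_bound _ hδ fun g =>
        (ContinuousLinearMap.opNorm_comp_le _ _).trans
          (mul_le_mul_of_nonneg_right (hAδ s x) (norm_nonneg g))
    obtain ⟨Cb, hCb0, hCb⟩ := hb'.exists_norm_le
    have hWex : ∀ x, ∃ W : ℝ → P →L[ℝ] Y, StronglyMeasurable W ∧
        (∃ C', ∀ t, ‖W t‖ ≤ C' * Real.exp (((r + 1 : ℕ) : ℝ) * σ * |t|)) ∧
        ∀ t, W t = ∫ s, ContinuousLinearMap.compL ℝ P Y Y (K t s) (A' s x (W s) + b' s x) := by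
      intro x
      refine exists_integral_fixedPoint (hKr1.compL P) hη hM hδ hκ
        (f := fun s y => A' s x y + b' s x) (C := Cb) (fun s y y' => ?_) (fun s => ?_)
        (fun w hw => ?_)
      · rw [add_sub_add_right_eq_sub, ← map_sub]
        exact (A' s x).le_of_opNorm_le (hA'δ s x) _
      · simpa using hCb s x
      · exact ((continuous_fst.clm_apply continuous_snd).comp_stronglyMeasurable
          ((hA'.meas x).prodMk hw)).add (hb'.meas x)
    choose W hWm hWb hW using hWex
    -- The candidate derivative is smooth by induction, even before it is known to be the derivative
    -- of `w`.
    have hWs : WeightedSmooth σ m (r + 1) fun t x => W x t :=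
      ih (P →L[ℝ] Y) (r + 1) (fun i h1 h2 => (hK i (by omega) (by omega)).compL P)
        hA' hb' hA'δ hWm hWb (fun t x => hW x t)
    obtain ⟨CW, hCW0, hCW⟩ := hWs.exists_norm_le
    obtain ⟨CA, hCA0, hCA⟩ := hDA.exists_norm_le
    obtain ⟨CB, hCB0, hCB⟩ := hb.fderiv_family.exists_norm_le
    -- Lipschitz estimates for the coefficients
    have hlipA : ∀ s x y, ‖A s x - A s y‖ ≤ CA * Real.exp (σ * |s|) * ‖x - y‖ := by
      intro s x y
      refine Convex.norm_image_sub_le_of_norm_fderiv_le (s := Set.univ)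
        (fun z _ => (hA.contDiff s).differentiable (by simp) z) (fun z _ => ?_) convex_univ
        (Set.mem_univ y) (Set.mem_univ x)
      simpa using hCA s z
    have hlipb : ∀ s x y, ‖b s x - b s y‖ ≤
        CB * Real.exp (((r + 1 : ℕ) : ℝ) * σ * |s|) * ‖x - y‖ := by
      intro s x y
      exact Convex.norm_image_sub_le_of_norm_fderiv_le (s := Set.univ)
        (fun z _ => (hb.contDiff s).differentiable (by simp) z) (fun z _ => hCB s z) convex_univ
        (Set.mem_univ y) (Set.mem_univ x)
    let g : ℝ → P → Y := fun s x => A s x (w s x) + b s x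
    have hgm : ∀ x, StronglyMeasurable fun s => g s x := fun x =>
      ((continuous_fst.clm_apply continuous_snd).comp_stronglyMeasurable
        ((hA.meas x).prodMk (hwm x))).add (hb.meas x)
    have hexp : ∀ s : ℝ, Real.exp (r * σ * |s|) ≤ Real.exp (((r + 1 : ℕ) : ℝ) * σ * |s|) := by
      intro s
      gcongr
      omega
    have hexp' : ∀ s : ℝ, Real.exp (σ * |s|) * Real.exp (r * σ * |s|) =
        Real.exp (((r + 1 : ℕ) : ℝ) * σ * |s|) := by
      intro s
      rw [← Real.exp_add]
      congr 1
      push_cast; ring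
    obtain ⟨Cg, hCg0, hCg⟩ := (hb.of_le (Nat.zero_le _)).exists_norm_le
    have hgb : ∀ x s, ‖g s x‖ ≤ (δ * C + Cg) * Real.exp (((r + 1 : ℕ) : ℝ) * σ * |s|) := by
      intro x s
      refine ((norm_add_le _ _).trans (add_le_add
        (((A s x).le_of_opNorm_le (hAδ s x) _).trans (mul_le_mul_of_nonneg_left (hC s x) hδ))
        (hCg s x))).trans ?_
      rw [← mul_assoc, ← add_mul]
      exact mul_le_mul_of_nonneg_left (hexp s) (by positivity)
    have hgl₀ : ∀ s x y, ‖g s x - g s y‖ ≤ δ * ‖w s x - w s y‖ +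
        (CA * C + CB) * ‖x - y‖ * Real.exp (((r + 1 : ℕ) : ℝ) * σ * |s|) := by
      intro s x y
      have h0 : g s x - g s y =
          A s x (w s x - w s y) + ((A s x - A s y) (w s y) + (b s x - b s y)) := by
        simp only [g, map_sub, sub_apply]
        abel
      rw [h0]
      refine (norm_add_le _ _).trans (add_le_add ((A s x).le_of_opNorm_le (hAδ s x) _) ?_)
      refine (norm_add_le _ _).trans ((add_le_add
        (((A s x - A s y).le_opNorm _).trans (mul_le_mul (hlipA s x y) (hC s y)
          (norm_nonneg _) (by positivity))) (hlipb s x y)).trans_eq ?_)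
      rw [← hexp']
      ring
    let Cl := (CA * C + CB) * (2 * M / η) / (1 - δ * (2 * M / η))
    have h1κ : 0 < 1 - δ * (2 * M / η) := by linarith
    have hCl0 : 0 ≤ Cl := by positivity
    have hwl : ∀ s x y, ‖w s x - w s y‖ ≤
        Cl * Real.exp (((r + 1 : ℕ) : ℝ) * σ * |s|) * ‖x - y‖ := by
      intro s x y
      refine (hKr1.norm_le_of_integral_eq hη hM hδ hκ
        (C := (CA * C + CB) * ‖x - y‖) (by positivity) (w := fun t => w t x - w t y)
        (g := fun s => g s x - g s y) (fun t => ?_) (fun s => hgl₀ s x y)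
        ⟨2 * C, fun t => ?_⟩ s).trans_eq (by simp only [Cl]; ring)
      · rw [hw t x, hw t y, ← integral_sub (hKr1.integrable hη (hgm x) (hgb x) t)
          (hKr1.integrable hη (hgm y) (hgb y) t)]
        simp only [map_sub]
      · refine (norm_sub_le _ _).trans ?_
        have h1 := hC t x
        have h2 := hC t y
        have h3 := mul_le_mul_of_nonneg_left (hexp t) hC0
        linarith
    refine WeightedSmooth.of_hasFDerivAt (f' := fun t x => W x t) (fun t x₀ => ?_) hwm
      ⟨C, hC⟩ hWs
    let Ct := Cl + (δ * Cl + (CA * C + CB)) + Cb + CW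
    have hCt : 0 ≤ Ct := by positivity
    have hle : ∀ {a : ℝ} (s : ℝ), a ≤ Ct → a * Real.exp (((r + 1 : ℕ) : ℝ) * σ * |s|) ≤
      Ct * Real.exp (((r + 1 : ℕ) : ℝ) * σ * |s|) := fun s h =>
        mul_le_mul_of_nonneg_right h (Real.exp_pos _).le
    have hδl : 0 ≤ δ * Cl := by positivity
    have hAB : 0 ≤ CA * C + CB := by positivity
    refine hKr1.hasFDerivAt_of_integral_eq (C := Ct) (g := g) (A := fun s => A s x₀)
      (B := fun s => b' s x₀) (W := W x₀) hη hM hδ hκ hwm hgm (hA.meas x₀) (hb'.meas x₀)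
      (hWm x₀) hw (fun x => ⟨_, hgb x⟩) (fun s x => ?_) (fun s x => ?_) (fun s => hAδ s x₀)
      (fun s => (hCb s x₀).trans (hle s ?_)) (fun s => (hCW s x₀).trans (hle s ?_))
      (fun t => hW x₀ t) (fun s => ?_) t
    · exact (hwl s x x₀).trans (mul_le_mul_of_nonneg_right (hle s (by simp only [Ct]; linarith))
        (norm_nonneg _))
    · refine (hgl₀ s x x₀).trans ?_
      have h1 := mul_le_mul_of_nonneg_left (hwl s x x₀) hδ
      have h2 := mul_le_mul_of_nonneg_right
        (hle (a := δ * Cl + (CA * C + CB)) s (by simp only [Ct]; linarith)) (norm_nonneg (x - x₀))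
      linarith
    · simp only [Ct]; linarith
    · simp only [Ct]; linarith
    -- The remainder of the product `A (w)` splits into the mixed increment `(A s x - A s x₀) (w s x
    -- - w s x₀)`, which is `o(1) · O(x - x₀)`, and the Taylor remainders of `A` and `b`.
    · have hdA := ((hA.contDiff s).differentiable (by simp) x₀).hasFDerivAt
      have hdb := ((hb.contDiff s).differentiable (by simp) x₀).hasFDerivAt
      have hoA := hdA.isLittleO
      have hob := hdb.isLittleO
      have hO : (fun x => w s x - w s x₀) =O[𝓝 x₀] fun x => x - x₀ :=
        Asymptotics.IsBigO.of_bound _ (Eventually.of_forall fun x => hwl s x x₀)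
      have hA0' : (fun x => A s x - A s x₀) =o[𝓝 x₀] fun _ => (1 : ℝ) :=
        (Asymptotics.isLittleO_one_iff ℝ).2 (tendsto_sub_nhds_zero_iff.2
          ((hA.contDiff s).continuous.tendsto x₀))
      have h1 : (fun x => (A s x - A s x₀) (w s x - w s x₀)) =o[𝓝 x₀] fun x => x - x₀ := by
        have h2 : (fun x => ‖A s x - A s x₀‖ * ‖w s x - w s x₀‖) =o[𝓝 x₀]
            fun x => (1 : ℝ) * ‖x - x₀‖ := hA0'.norm_left.mul_isBigO hO.norm_norm
        simp only [one_mul] at h2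
        refine Asymptotics.IsBigO.trans_isLittleO (Asymptotics.IsBigO.of_bound 1
          (Eventually.of_forall fun x => ?_)) h2.of_norm_right
        rw [one_mul, norm_mul, norm_norm, norm_norm]
        exact ContinuousLinearMap.le_opNorm _ _
      have h3 : (fun x => (A s x - A s x₀ - fderiv ℝ (A s) x₀ (x - x₀)) (w s x₀))
          =o[𝓝 x₀] fun x => x - x₀ := by
        refine Asymptotics.IsBigO.trans_isLittleO (Asymptotics.IsBigO.of_bound ‖w s x₀‖
          (Eventually.of_forall fun x => ?_)) hoA
        rw [mul_comm]
        exact ContinuousLinearMap.le_opNorm _ _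
      refine ((h1.add h3).add hob).congr_left fun x => ?_
      simp only [g, b', map_sub, sub_apply, add_apply,
        ContinuousLinearMap.flip_apply]
      abel

theorem WeightedSmooth.const {P Z : Type*} [NormedAddCommGroup P] [NormedSpace ℝ P]
    [NormedAddCommGroup Z] [NormedSpace ℝ Z] {σ C : ℝ} {m r : ℕ} {c : ℝ → Z}
    (hc : StronglyMeasurable c) (hb : ∀ s, ‖c s‖ ≤ C * Real.exp (r * σ * |s|)) :
    WeightedSmooth σ m r fun s (_ : P) => c s where
  contDiff _ := contDiff_const
  meas _ := hc
  bound := by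
    have hC : 0 ≤ C := by simpa using (norm_nonneg _).trans (hb 0)
    refine ⟨C, fun j _ s x => ?_⟩
    rcases Nat.eq_zero_or_pos j with rfl | hj
    · simpa using hb s
    · rw [iteratedFDeriv_const_of_ne (by omega)]
      simp only [Pi.zero_apply, norm_zero]
      positivity

/-! ### Smooth dependence for the nonlinear integral equation -/

/-- Solutions of the Lyapunov–Perron equation `u = ∫ K G(ℓ x + u)` depend smoothly on the
parameter `x`. -/
theorem exists_contDiff_integral_solution {P Y : Type u} [NormedAddCommGroup P] [NormedSpace ℝ P]
    [FiniteDimensional ℝ P] [NormedAddCommGroup Y] [NormedSpace ℝ Y] [CompleteSpace Y]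
    {M η σ δ Cℓ : ℝ} (hη : 0 < η) (hσ : 0 ≤ σ) (hM : 0 ≤ M) (hδ : 0 ≤ δ)
    (hκ : δ * (2 * M / η) < 1) {k : ℕ} {K : ℝ → ℝ → Y →L[ℝ] Y}
    (hK : ∀ i : ℕ, 1 ≤ i → i ≤ k + 1 → IsKernel K M η (i * σ))
    {ℓ : ℝ → P →L[ℝ] Y} (hℓm : StronglyMeasurable ℓ) (hℓ : ∀ s, ‖ℓ s‖ ≤ Cℓ * Real.exp (σ * |s|))
    {G : Y → Y} (hG : ContDiff ℝ (k + 1 : ℕ) G)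
    (hGb : ∀ j ≤ k + 1, ∃ C, ∀ x, ‖iteratedFDeriv ℝ j G x‖ ≤ C)
    (hGδ : ∀ x, ‖fderiv ℝ G x‖ ≤ δ) (hG0 : G 0 = 0) (hG0' : fderiv ℝ G 0 = 0) :
    ∃ u : ℝ → P → Y, (∀ x, StronglyMeasurable fun t => u t x) ∧
      (∀ t x, u t x = ∫ s, K t s (G (ℓ s x + u s x))) ∧
      (∀ t, ContDiff ℝ (k + 1 : ℕ) (u t)) ∧ (∀ t, u t 0 = 0) ∧
      ∀ t, HasFDerivAt (u t) (0 : P →L[ℝ] Y) 0 := by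
  have hCℓ : 0 ≤ Cℓ := by simpa using (norm_nonneg _).trans (hℓ 0)
  have hK1 : IsKernel K M η σ := by simpa using hK 1 le_rfl (by omega)
  have h1κ : 0 < 1 - δ * (2 * M / η) := by linarith
  have hGd : Differentiable ℝ G := hG.differentiable (by simp)
  have hDG : ContDiff ℝ k (fderiv ℝ G) := hG.fderiv_right (by push_cast; rfl)
  have hGlip : ∀ y y', ‖G y - G y'‖ ≤ δ * ‖y - y'‖ := fun y y' =>
    Convex.norm_image_sub_le_of_norm_fderiv_le (s := Set.univ) (fun z _ => hGd z)
      (fun z _ => hGδ z) convex_univ (Set.mem_univ y') (Set.mem_univ y)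
  obtain ⟨C₀, hC₀⟩ := hGb 0 (zero_le)
  have hGC : ∀ y, ‖G y‖ ≤ C₀ := fun y => by simpa using hC₀ y
  have hC₀0 : 0 ≤ C₀ := (norm_nonneg _).trans (hGC 0)
  have hexp1 : ∀ s : ℝ, 1 ≤ Real.exp (σ * |s|) := fun s => Real.one_le_exp (by positivity)
  have hGC' : ∀ y s, ‖G y‖ ≤ C₀ * Real.exp (σ * |s|) := fun y s =>
    (hGC y).trans (le_mul_of_one_le_right hC₀0 (hexp1 s))
  have hℓxm : ∀ x, StronglyMeasurable fun s => ℓ s x := fun x =>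
    (ContinuousLinearMap.apply ℝ Y x).continuous.comp_stronglyMeasurable hℓm
  have huex : ∀ x, ∃ w : ℝ → Y, StronglyMeasurable w ∧
      (∃ C', ∀ t, ‖w t‖ ≤ C' * Real.exp (σ * |t|)) ∧
      ∀ t, w t = ∫ s, K t s (G (ℓ s x + w s)) := fun x =>
    exists_integral_fixedPoint hK1 hη hM hδ hκ (f := fun s y => G (ℓ s x + y)) (C := C₀)
      (fun s y y' => by simpa using hGlip (ℓ s x + y) (ℓ s x + y')) (fun s => hGC' _ s)
      (fun w hw => hGd.continuous.comp_stronglyMeasurable ((hℓxm x).add hw))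
  choose v hvm hvb hv using huex
  let u : ℝ → P → Y := fun t x => v x t
  let y : ℝ → P → Y := fun s x => ℓ s x + u s x
  let g : ℝ → P → Y := fun s x => G (y s x)
  have hum : ∀ x, StronglyMeasurable fun t => u t x := hvm
  have hym : ∀ x, StronglyMeasurable fun t => y t x := fun x => (hℓxm x).add (hum x)
  have hgm : ∀ x, StronglyMeasurable fun t => g t x := fun x =>
    hGd.continuous.comp_stronglyMeasurable (hym x)
  have hu : ∀ t x, u t x = ∫ s, K t s (g s x) := fun t x => hv x t
  -- For `x = 0` there is no inhomogeneity, as `G 0 = 0`, so the a priori estimate applies with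
  -- constant `0`.
  have hu0 : ∀ t, u t 0 = 0 := by
    intro t
    have := hK1.norm_le_of_integral_eq hη hM hδ hκ le_rfl (w := fun t => u t 0)
      (fun t => hu t 0) (fun s => by simpa [g, y, hG0] using hGlip (y s 0) 0) (hvb 0) t
    simpa using this
  -- Lipschitz dependence on the parameter
  let Cl := δ * Cℓ * (2 * M / η) / (1 - δ * (2 * M / η))
  have hCl0 : 0 ≤ Cl := by positivity
  have hgl₀ : ∀ s x x', ‖g s x - g s x'‖ ≤ δ * ‖u s x - u s x'‖ +
      δ * Cℓ * ‖x - x'‖ * Real.exp (σ * |s|) := by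
    intro s x x'
    refine (hGlip _ _).trans ?_
    have h1 : y s x - y s x' = (u s x - u s x') + ℓ s (x - x') := by
      simp only [y, map_sub]; abel
    rw [h1]
    have h2 := norm_add_le (u s x - u s x') (ℓ s (x - x'))
    have h3 := (ℓ s).le_of_opNorm_le (hℓ s) (x - x')
    have h4 := mul_le_mul_of_nonneg_left (h2.trans (add_le_add_right h3 _)) hδ
    linarith
  have hul : ∀ s x x', ‖u s x - u s x'‖ ≤ Cl * Real.exp (σ * |s|) * ‖x - x'‖ := by
    intro s x x'
    obtain ⟨C₁, h₁⟩ := hvb x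
    obtain ⟨C₂, h₂⟩ := hvb x'
    refine (hK1.norm_le_of_integral_eq hη hM hδ hκ
      (C := δ * Cℓ * ‖x - x'‖) (by positivity) (w := fun t => u t x - u t x')
      (g := fun s => g s x - g s x') (fun t => ?_) (fun s => hgl₀ s x x')
      ⟨C₁ + C₂, fun t => ?_⟩ s).trans_eq (by simp only [Cl]; ring)
    · rw [hu t x, hu t x', ← integral_sub (hK1.integrable hη (hgm x) (fun s => hGC' _ s) t)
        (hK1.integrable hη (hgm x') (fun s => hGC' _ s) t)]
      simp only [map_sub]
    · rw [add_mul]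
      exact (norm_sub_le _ _).trans (add_le_add (h₁ t) (h₂ t))
  -- the derivative
  let A : ℝ → P → Y →L[ℝ] Y := fun s x => fderiv ℝ G (y s x)
  have hAm : ∀ x, StronglyMeasurable fun s => A s x := fun x =>
    hDG.continuous.comp_stronglyMeasurable (hym x)
  have hAδ : ∀ s x, ‖A s x‖ ≤ δ := fun s x => hGδ _
  -- The linearised equation for the derivative `W` of `u` in `x` is `W = ∫ K DG(y) (ℓ + W)`.
  let A' : ℝ → P → (P →L[ℝ] Y) →L[ℝ] (P →L[ℝ] Y) := fun s x =>
    ContinuousLinearMap.compL ℝ P Y Y (A s x)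
  let b' : ℝ → P → P →L[ℝ] Y := fun s x => ContinuousLinearMap.compL ℝ P Y Y (A s x) (ℓ s)
  have hA'm : ∀ x, StronglyMeasurable fun s => A' s x := fun x =>
    (ContinuousLinearMap.compL ℝ P Y Y).continuous.comp_stronglyMeasurable (hAm x)
  have hb'm : ∀ x, StronglyMeasurable fun s => b' s x := fun x =>
    (continuous_fst.clm_apply continuous_snd).comp_stronglyMeasurable ((hA'm x).prodMk hℓm)
  have hA'δ : ∀ s x, ‖A' s x‖ ≤ δ := fun s x =>
    ContinuousLinearMap.opNorm_le_bound _ hδ fun g =>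
      (ContinuousLinearMap.opNorm_comp_le _ _).trans
        (mul_le_mul_of_nonneg_right (hAδ s x) (norm_nonneg g))
  have hb'b : ∀ s x, ‖b' s x‖ ≤ δ * Cℓ * Real.exp (σ * |s|) := fun s x => by
    rw [mul_assoc]
    exact (ContinuousLinearMap.opNorm_comp_le _ _).trans
      (mul_le_mul (hAδ s x) (hℓ s) (norm_nonneg _) hδ)
  have hWex : ∀ x, ∃ W : ℝ → P →L[ℝ] Y, StronglyMeasurable W ∧
      (∃ C', ∀ t, ‖W t‖ ≤ C' * Real.exp (σ * |t|)) ∧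
      ∀ t, W t = ∫ s, ContinuousLinearMap.compL ℝ P Y Y (K t s) (A' s x (W s) + b' s x) := by
    intro x
    refine exists_integral_fixedPoint (hK1.compL P) hη hM hδ hκ
      (f := fun s y => A' s x y + b' s x) (C := δ * Cℓ) (fun s y y' => ?_) (fun s => ?_)
      (fun w hw => ?_)
    · rw [add_sub_add_right_eq_sub, ← map_sub]
      exact (A' s x).le_of_opNorm_le (hA'δ s x) _
    · simpa using hb'b s x
    · exact ((continuous_fst.clm_apply continuous_snd).comp_stronglyMeasurable
        ((hA'm x).prodMk hw)).add (hb'm x)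
  choose W hWm hWb hW using hWex
  have hWu : ∀ t x, ‖W x t‖ ≤
      δ * Cℓ * (2 * M / η) / (1 - δ * (2 * M / η)) * Real.exp (σ * |t|) := by
    intro t x
    exact (hK1.compL P).norm_le_of_integral_eq hη hM hδ hκ (by positivity) (hW x)
      (fun s => (norm_add_le _ _).trans
        (add_le_add ((A' s x).le_of_opNorm_le (hA'δ s x) _) (hb'b s x))) (hWb x) t
  have hder : ∀ t x, HasFDerivAt (u t) (W x t) x := by
    intro t x₀
    have hδl : 0 ≤ δ * Cl := by positivity
    have hδℓ : 0 ≤ δ * Cℓ := by positivity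
    refine hK1.hasFDerivAt_of_integral_eq (C := Cl + (δ * Cl + δ * Cℓ)) (g := g)
      (A := fun s => A s x₀) (B := fun s => b' s x₀) (W := W x₀) hη hM hδ hκ hum hgm (hAm x₀)
      (hb'm x₀) (hWm x₀) hu (fun x => ⟨_, fun s => hGC' _ s⟩) (fun s x => ?_) (fun s x => ?_)
      (fun s => hAδ s x₀) (fun s => (hb'b s x₀).trans ?_) (fun s => (hWu s x₀).trans ?_)
      (fun t => hW x₀ t) (fun s => ?_) t
    · refine (hul s x x₀).trans ?_
      gcongr
      linarith
    · refine (hgl₀ s x x₀).trans ?_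
      have h1 := mul_le_mul_of_nonneg_left (hul s x x₀) hδ
      have h2 : 0 ≤ Cl * Real.exp (σ * |s|) * ‖x - x₀‖ := by positivity
      linarith
    · gcongr
      linarith
    · change Cl * _ ≤ _
      gcongr
      linarith
    · have hO : (fun x => y s x - y s x₀) =O[𝓝 x₀] fun x => x - x₀ := by
        have h1 : (fun x => u s x - u s x₀) =O[𝓝 x₀] fun x => x - x₀ :=
          Asymptotics.IsBigO.of_bound _ (Eventually.of_forall fun x => hul s x x₀)
        refine (((ℓ s).isBigO_sub (𝓝 x₀) x₀).add h1).congr_left fun x => ?_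
        simp only [y, map_sub]; abel
      have hyc : Tendsto (y s) (𝓝 x₀) (𝓝 (y s x₀)) := by
        rw [← tendsto_sub_nhds_zero_iff]
        exact hO.trans_tendsto (tendsto_sub_nhds_zero_iff.2 tendsto_id)
      have ho := ((hGd (y s x₀)).hasFDerivAt.isLittleO.comp_tendsto hyc).trans_isBigO hO
      refine ho.congr_left fun x => ?_
      simp only [g, A, b', y, Function.comp_apply, map_sub, map_add,
        ContinuousLinearMap.compL_apply, ContinuousLinearMap.comp_apply]
      abel
  have hydd : ∀ s x, HasFDerivAt (y s) (ℓ s + W x s) x := fun s x =>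
    (ℓ s).hasFDerivAt.add (hder s x)
  have hℓ1 : ∀ s, ‖ℓ s‖ ≤ Cℓ * Real.exp ((1 : ℕ) * σ * |s|) := by simpa using hℓ
  -- Bootstrap: if `y` is `C^m` with these bounds, then `DG(y)` is a weighted family of offset `0`,
  -- the linear theory gives `W` with offset `1`, and `y`, whose derivative is `ℓ + W`, is
  -- `C^(m+1)`. The bounds start at `j = 1` because `ℓ s x` is not bounded in `x`.
  have hboot : ∀ m ≤ k + 1, (∀ s, ContDiff ℝ m (y s)) ∧ ∃ C, ∀ j, 1 ≤ j → j ≤ m → ∀ s x,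
      ‖iteratedFDeriv ℝ j (y s) x‖ ≤ C * Real.exp (j * σ * |s|) := by
    intro m
    induction m with
    | zero =>
      intro _
      refine ⟨fun s => ?_, 0, fun j h1 h2 => by omega⟩
      rw [Nat.cast_zero, contDiff_zero]
      exact continuous_iff_continuousAt.2 fun x => (hydd s x).continuousAt
    | succ m ih =>
      intro hm
      obtain ⟨hyC, hyb⟩ := ih (by omega)
      have hmk : (m : WithTop ℕ∞) ≤ (k : WithTop ℕ∞) := by
        exact_mod_cast Nat.le_of_succ_le_succ hm
      have hAs : WeightedSmooth σ m 0 A :=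
        WeightedSmooth.comp (hDG.of_le hmk) (fun j hj => by
          obtain ⟨C, hC⟩ := hGb (j + 1) (by omega)
          exact ⟨C, fun x => by rw [norm_iteratedFDeriv_fderiv]; exact hC x⟩) hyC hym hyb
      have hA's : WeightedSmooth σ m 0 A' :=
        WeightedSmooth.clm (Z₂ := (P →L[ℝ] Y) →L[ℝ] (P →L[ℝ] Y))
          (ContinuousLinearMap.compL ℝ P Y Y) hAs
      have hℓs : WeightedSmooth σ m 1 fun s (_ : P) => ℓ s := WeightedSmooth.const hℓm hℓ1
      have hb's : WeightedSmooth σ m 1 b' := by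
        have := WeightedSmooth.bilinear (Z₂ := P →L[ℝ] Y) (Z₃ := P →L[ℝ] Y)
          (ContinuousLinearMap.compL ℝ P Y Y) hAs hℓs
        rwa [zero_add] at this
      have hWs : WeightedSmooth σ m 1 fun t x => W x t :=
        WeightedSmooth.of_integral_eq hη hσ hM hδ hκ m (P →L[ℝ] Y) 1
          (fun i h1 h2 => (hK i h1 (by omega)).compL P) hA's hb's hA'δ hWm
          (fun x => by simpa using hWb x) (fun t x => hW x t)
      have hDy := hℓs.add hWs
      refine ⟨fun s => ?_, ?_⟩
      · push_cast
        exact contDiff_succ_iff_hasFDerivAt.2 ⟨_, hDy.contDiff s, hydd s⟩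
      · obtain ⟨C, hC⟩ := hDy.bound
        refine ⟨C, fun j h1 h2 s x => ?_⟩
        obtain ⟨i, rfl⟩ : ∃ i, j = i + 1 := ⟨j - 1, by omega⟩
        rw [← norm_iteratedFDeriv_fderiv, show fderiv ℝ (y s) = fun x => ℓ s + W x s from
          funext fun x => (hydd s x).fderiv, add_comm i 1]
        exact hC i (by omega) s x
  refine ⟨u, hum, hu, fun t => ?_, hu0, fun t => ?_⟩
  · have h1 := ((hboot (k + 1) le_rfl).1 t).sub (ℓ t).contDiff
    have h2 : u t = fun x => y t x - ℓ t x := funext fun x => by simp [y]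
    rwa [h2]
  · have h1 := hder t 0
    -- Along the zero solution the coefficient `DG` vanishes, hence so does the whole integrand.
    have h2 : W 0 t = 0 := by
      rw [hW 0 t]
      simp [A', b', A, y, hu0, hG0']
    rwa [h2] at h1

/-! ### Spectral subspaces and intertwining maps -/

section Splitting

variable {E E' : Type*} [AddCommGroup E] [Module ℝ E] [AddCommGroup E'] [Module ℝ E']

theorem complexSpectralSubspace_mono (L : E →ₗ[ℝ] E) {S T : Set ℂ} (h : S ⊆ T) :
    complexSpectralSubspace L S ≤ complexSpectralSubspace L T :=
  biSup_mono fun _ hμ => h hμ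

theorem spectralSubspace_mono (L : E →ₗ[ℝ] E) {S T : Set ℂ} (h : S ⊆ T) :
    spectralSubspace L S ≤ spectralSubspace L T :=
  fun _ hx => complexSpectralSubspace_mono L h hx

theorem disjoint_complexSpectralSubspace (L : E →ₗ[ℝ] E) {S T : Set ℂ} (h : Disjoint S T) :
    Disjoint (complexSpectralSubspace L S) (complexSpectralSubspace L T) :=
  (Module.End.independent_maxGenEigenspace
    (L.baseChange ℂ : Module.End ℂ (ℂ ⊗[ℝ] E))).disjoint_biSup_biSup h

theorem disjoint_spectralSubspace (L : E →ₗ[ℝ] E) {S T : Set ℂ} (h : Disjoint S T) :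
    Disjoint (spectralSubspace L S) (spectralSubspace L T) := by
  rw [Submodule.disjoint_def]
  intro x hx hy
  exact toComplexification_injective (by
    rw [map_zero]
    exact Submodule.disjoint_def.1 (disjoint_complexSpectralSubspace L h) _ hx hy)

theorem spectralSubspace_univ [FiniteDimensional ℝ E] (L : E →ₗ[ℝ] E) :
    spectralSubspace L Set.univ = ⊤ := by
  rw [eq_top_iff]
  intro x _
  change toComplexification E x ∈ complexSpectralSubspace L Set.univ
  simp only [complexSpectralSubspace, Set.mem_univ, iSup_pos, Module.End.iSup_maxGenEigenspace_eq_top]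
  exact Submodule.mem_top

/-- Real vectors decompose along a splitting of the spectrum into conjugation-invariant parts. -/
theorem exists_add_of_mem_spectralSubspace_union (L : E →ₗ[ℝ] E) {S T : Set ℂ}
    (hST : Disjoint S T) (hS : ∀ μ ∈ S, (starRingEnd ℂ) μ ∈ S)
    (hT : ∀ μ ∈ T, (starRingEnd ℂ) μ ∈ T) {x : E} (hx : x ∈ spectralSubspace L (S ∪ T)) :
    ∃ a ∈ spectralSubspace L S, ∃ b ∈ spectralSubspace L T, a + b = x := by
  have hx' : toComplexification E x ∈
      complexSpectralSubspace L S ⊔ complexSpectralSubspace L T := by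
    have h : toComplexification E x ∈ complexSpectralSubspace L (S ∪ T) := hx
    rwa [complexSpectralSubspace, iSup_union] at h
  obtain ⟨p, hp, q, hq, hpq⟩ := Submodule.mem_sup.1 hx'
  have hp' := conjC_mem L hS hp
  have hq' := conjC_mem L hT hq
  have hc : conjC E p + conjC E q = p + q := by
    rw [← map_add, hpq, conjC_toComplexification]
  -- The left side lies in the `S`-part and the right side in the `T`-part, so both vanish. Thus `p`
  -- and `q` are fixed by conjugation, that is, real.
  have hd : conjC E p - p = q - conjC E q := by
    rw [sub_eq_sub_iff_add_eq_add, hc, add_comm]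
  have h0 : conjC E p - p = 0 := by
    refine Submodule.disjoint_def.1 (disjoint_complexSpectralSubspace L hST) _
      (Submodule.sub_mem _ hp' hp) ?_
    rw [hd]
    exact Submodule.sub_mem _ hq hq'
  obtain ⟨a, ha⟩ := conjC_eq_self (sub_eq_zero.1 h0)
  obtain ⟨b, hb⟩ := conjC_eq_self (sub_eq_zero.1 (hd.symm.trans h0)).symm
  refine ⟨a, ?_, b, ?_, toComplexification_injective (by rw [map_add, ha, hb, hpq])⟩
  · change toComplexification E a ∈ complexSpectralSubspace L _
    rwa [ha]
  · change toComplexification E b ∈ complexSpectralSubspace L _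
    rwa [hb]

/-- Intertwining maps preserve spectral subspaces. -/
theorem map_mem_spectralSubspace {L : E →ₗ[ℝ] E} {L' : E' →ₗ[ℝ] E'} {R : E →ₗ[ℝ] E'}
    (h : ∀ x, R (L x) = L' (R x)) {S : Set ℂ} {x : E} (hx : x ∈ spectralSubspace L S) :
    R x ∈ spectralSubspace L' S := by
  have hcomm : ∀ z : ℂ ⊗[ℝ] E, R.baseChange ℂ (L.baseChange ℂ z) =
      L'.baseChange ℂ (R.baseChange ℂ z) := by
    intro z
    induction z with
    | zero => simp
    | add x y hx hy => simp only [map_add, hx, hy]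
    | tmul a x => simp [h]
  have hle : complexSpectralSubspace L S ≤
      (complexSpectralSubspace L' S).comap (R.baseChange ℂ) := by
    conv_lhs => rw [complexSpectralSubspace]
    refine iSup₂_le fun μ hμ w hw => ?_
    have hle' : Module.End.maxGenEigenspace (L'.baseChange ℂ : Module.End ℂ (ℂ ⊗[ℝ] E')) μ ≤
        complexSpectralSubspace L' S :=
      le_iSup₂_of_le (f := fun (μ : ℂ) (_ : μ ∈ S) =>
        Module.End.maxGenEigenspace (L'.baseChange ℂ : Module.End ℂ (ℂ ⊗[ℝ] E')) μ) μ hμ le_rfl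
    refine hle' ?_
    rw [Module.End.mem_maxGenEigenspace] at hw ⊢
    obtain ⟨n, hn⟩ := hw
    refine ⟨n, ?_⟩
    -- `R` intertwines the powers of `L - μ` and `L' - μ`, so it maps generalised eigenvectors to
    -- generalised eigenvectors for the same `μ`.
    have hpow : ∀ (n : ℕ) (y : ℂ ⊗[ℝ] E),
        (((L'.baseChange ℂ : Module.End ℂ (ℂ ⊗[ℝ] E')) - μ • 1) ^ n) (R.baseChange ℂ y) =
          R.baseChange ℂ ((((L.baseChange ℂ : Module.End ℂ (ℂ ⊗[ℝ] E)) - μ • 1) ^ n) y) := by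
      intro n
      induction n with
      | zero => intro y; simp
      | succ n ih =>
        intro y
        rw [pow_succ, pow_succ, Module.End.mul_apply, Module.End.mul_apply, ← ih]
        congr 1
        simp only [LinearMap.sub_apply, LinearMap.smul_apply, Module.End.one_apply, map_sub,
          map_smul, hcomm]
    rw [hpow, hn, map_zero]
  have hR : toComplexification E' (R x) = R.baseChange ℂ (toComplexification E x) := by
    simp [toComplexification]
  change toComplexification E' (R x) ∈ complexSpectralSubspace L' S
  rw [hR]
  exact hle hx

end Splitting

/-! ### Exponential growth on generalised eigenspaces -/

section Growth

open NormedSpace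

theorem hasSum_exp_apply {𝕜 W : Type*} [RCLike 𝕜] [NormedAddCommGroup W] [NormedSpace 𝕜 W]
    [CompleteSpace W] (A : W →L[𝕜] W) (z : W) :
    HasSum (fun n : ℕ => ((n.factorial : 𝕜)⁻¹) • (A ^ n) z) (exp A z) := by
  have h : HasSum (fun n : ℕ => ((n.factorial : 𝕜)⁻¹) • (A ^ n)) (exp A) :=
    exp_series_hasSum_exp' (𝕂 := 𝕜) A
  have h2 := h.map (ContinuousLinearMap.apply 𝕜 W z) (ContinuousLinearMap.apply 𝕜 W z).continuous
  simpa [Function.comp_def] using h2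

theorem exp_smul_one_add {W : Type*} [NormedAddCommGroup W] [NormedSpace ℂ W] [CompleteSpace W]
    (c : ℂ) (A : W →L[ℂ] W) : exp (c • (1 : W →L[ℂ] W) + A) = Complex.exp c • exp A := by
  let _ : NormedAlgebra ℚ (W →L[ℂ] W) := NormedAlgebra.restrictScalars ℚ ℂ _
  rw [exp_add_of_commute ((Commute.one_left A).smul_left c)]
  have h : exp (c • (1 : W →L[ℂ] W)) = Complex.exp c • (1 : W →L[ℂ] W) := by
    rw [← Algebra.algebraMap_eq_smul_one, ← Algebra.algebraMap_eq_smul_one,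
      ← algebraMap_exp_comm, Complex.exp_eq_exp_ℂ]
  rw [h, smul_mul_assoc, one_mul]

/-- The growth of `exp (t T)` on a generalised eigenvector. -/
theorem exists_norm_exp_apply_le {W : Type*} [NormedAddCommGroup W] [NormedSpace ℂ W]
    [CompleteSpace W] (T : W →L[ℂ] W) (μ : ℂ) {n : ℕ} {z : W}
    (hz : ((T - μ • (1 : W →L[ℂ] W)) ^ n) z = 0) {σ : ℝ} (hσ : 0 < σ) :
    ∃ C, ∀ t : ℝ, ‖exp ((t : ℂ) • T) z‖ ≤ C * Real.exp (t * μ.re + σ * |t|) := by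
  set N := T - μ • (1 : W →L[ℂ] W) with hN
  refine ⟨∑ i ∈ Finset.range n, (σ ^ i)⁻¹ * ‖(N ^ i) z‖, fun t => ?_⟩
  have hT : (t : ℂ) • T = ((t : ℂ) * μ) • (1 : W →L[ℂ] W) + (t : ℂ) • N := by
    rw [hN, smul_sub, smul_smul]
    abel
  -- `N` is nilpotent on `z`, so the exponential series stops and `exp (tT) z` is `exp (tμ)` times a
  -- polynomial in `t`.
  have hsum : exp ((t : ℂ) • N) z =
      ∑ i ∈ Finset.range n, ((i.factorial : ℂ)⁻¹) • (((t : ℂ) • N) ^ i) z := by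
    refine (hasSum_exp_apply ((t : ℂ) • N) z).unique (hasSum_sum_of_ne_finset_zero fun i hi => ?_)
    have hni : n ≤ i := by simpa using hi
    have h0 : (N ^ i) z = 0 := by
      rw [← Nat.sub_add_cancel hni, pow_add, mul_apply_eq_comp, hz, map_zero]
    rw [smul_pow, smul_apply, h0, smul_zero, smul_zero]
  rw [hT, exp_smul_one_add, smul_apply, norm_smul, Complex.norm_exp, hsum,
    Real.exp_add, mul_comm (Real.exp _) (Real.exp _), ← mul_assoc, mul_comm]
  have hre : ((t : ℂ) * μ).re = t * μ.re := by simp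
  rw [hre]
  refine mul_le_mul_of_nonneg_right ?_ (Real.exp_pos _).le
  rw [Finset.sum_mul]
  refine (norm_sum_le _ _).trans (Finset.sum_le_sum fun i _ => ?_)
  rw [smul_pow, smul_apply, norm_smul, norm_smul, norm_inv, norm_pow,
    Complex.norm_natCast, Complex.norm_real, Real.norm_eq_abs]
  -- Each power of `|t|` is absorbed by `exp (σ|t|)`, at the price of the constant `(σ ^ i)⁻¹`.
  have h1 := Real.pow_div_factorial_le_exp (σ * |t|) (by positivity) i
  rw [mul_pow] at h1
  have h2 : (i.factorial : ℝ)⁻¹ * |t| ^ i ≤ (σ ^ i)⁻¹ * Real.exp (σ * |t|) := by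
    rw [inv_mul_eq_div (σ ^ i), le_div_iff₀ (by positivity)]
    refine le_trans (le_of_eq ?_) h1
    field_simp
  calc (i.factorial : ℝ)⁻¹ * (|t| ^ i * ‖(N ^ i) z‖)
      = ((i.factorial : ℝ)⁻¹ * |t| ^ i) * ‖(N ^ i) z‖ := by ring
    _ ≤ ((σ ^ i)⁻¹ * Real.exp (σ * |t|)) * ‖(N ^ i) z‖ := by gcongr
    _ = _ := by ring

variable {E : Type*} [NormedAddCommGroup E] [NormedSpace ℝ E] [FiniteDimensional ℝ E]

/-- Growth of `exp (t L)` on the real points of a sum of generalised eigenspaces. -/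
theorem exists_norm_exp_apply_le_of_mem (L : E →L[ℝ] E) {S : Set ℂ} {I : Set ℝ} {φ : ℝ → ℝ}
    (hφ : ∀ μ ∈ S, Module.End.HasEigenvalue
      ((L : E →ₗ[ℝ] E).baseChange ℂ : Module.End ℂ (ℂ ⊗[ℝ] E)) μ →
      ∃ σ > 0, ∀ t ∈ I, t * μ.re + σ * |t| ≤ φ t)
    {x : E} (hx : x ∈ spectralSubspace (L : E →ₗ[ℝ] E) S) :
    ∃ C, ∀ t ∈ I, ‖exp (t • L) x‖ ≤ C * Real.exp (φ t) := by
  have : CompleteSpace E := FiniteDimensional.complete ℝ E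
  let LC : Module.End ℂ (ℂ ⊗[ℝ] E) := (L : E →ₗ[ℝ] E).baseChange ℂ
  -- Coordinates provide a norm on the complexification. Estimates return to `E` because the
  -- embedding `J₀` is injective on a finite-dimensional space, hence antilipschitz.
  let e := (Module.finBasis ℂ (ℂ ⊗[ℝ] E)).equivFun
  let W := Fin (Module.finrank ℂ (ℂ ⊗[ℝ] E)) → ℂ
  let T : W →L[ℂ] W := LinearMap.toContinuousLinearMap (e.toLinearMap ∘ₗ LC ∘ₗ e.symm.toLinearMap)
  have hTe : ∀ z, T (e z) = e (LC z) := fun z => by simp [T]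
  let J₀ : E →ₗ[ℝ] W := (e.toLinearMap.restrictScalars ℝ) ∘ₗ toComplexification E
  let J : E →L[ℝ] W := LinearMap.toContinuousLinearMap J₀
  have hJ0 : ∀ x, J x = e (toComplexification E x) := fun x => rfl
  have hJT : ∀ x, J (L x) = T (J x) := by
    intro x
    rw [hJ0, hJ0, hTe]
    simp [toComplexification, LC]
  have hJpow : ∀ (t : ℝ) (n : ℕ) (x : E), J (((t • L) ^ n) x) = (((t : ℂ) • T) ^ n) (J x) := by
    intro t n
    induction n with
    | zero => intro x; simp
    | succ n ih =>
      intro x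
      rw [pow_succ, pow_succ, mul_apply_eq_comp, mul_apply_eq_comp, ih,
        smul_apply, smul_apply, map_smul, hJT]
      rfl
  have hJexp : ∀ (t : ℝ) (x : E), J (exp (t • L) x) = exp ((t : ℂ) • T) (J x) := by
    intro t x
    have h1 := J.hasSum (hasSum_exp_apply (t • L) x)
    have h2 := hasSum_exp_apply ((t : ℂ) • T) (J x)
    refine h1.unique (h2.congr_fun fun n => ?_)
    have h3 : ∀ q : W, ((n.factorial : ℝ)⁻¹) • q = ((n.factorial : ℂ)⁻¹) • q := by
      intro q
      funext i
      change ((n.factorial : ℝ)⁻¹) • q i = ((n.factorial : ℂ)⁻¹) * q i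
      rw [Complex.real_smul]
      push_cast
      rfl
    rw [map_smul, hJpow, h3]
  obtain ⟨c, hc, hanti⟩ := J₀.exists_antilipschitzWith (LinearMap.ker_eq_bot.2
    (e.injective.comp toComplexification_injective))
  -- Vectors with the required growth form a complex subspace, so it suffices to treat each
  -- generalised eigenspace.
  let V : Submodule ℂ W :=
    { carrier := {z | ∃ C, ∀ t ∈ I, ‖exp ((t : ℂ) • T) z‖ ≤ C * Real.exp (φ t)}
      add_mem' := by
        rintro a b ⟨C₁, h₁⟩ ⟨C₂, h₂⟩
        refine ⟨C₁ + C₂, fun t ht => ?_⟩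
        rw [map_add, add_mul]
        exact (norm_add_le _ _).trans (add_le_add (h₁ t ht) (h₂ t ht))
      zero_mem' := ⟨0, fun t _ => by simp⟩
      smul_mem' := by
        rintro a z ⟨C, h⟩
        refine ⟨‖a‖ * C, fun t ht => ?_⟩
        rw [map_smul, norm_smul, mul_assoc]
        exact mul_le_mul_of_nonneg_left (h t ht) (norm_nonneg _) }
  have hV : complexSpectralSubspace (L : E →ₗ[ℝ] E) S ≤ V.comap e.toLinearMap := by
    refine iSup₂_le fun μ hμ z hz => ?_
    obtain ⟨n, hn⟩ := Module.End.mem_maxGenEigenspace _ _ _ |>.1 hz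
    by_cases hev : Module.End.HasEigenvalue LC μ
    · obtain ⟨σ, hσ, hle⟩ := hφ μ hμ hev
      have hpow : ∀ (n : ℕ) (y : ℂ ⊗[ℝ] E), ((T - μ • (1 : W →L[ℂ] W)) ^ n) (e y) =
          e (((LC - μ • 1) ^ n) y) := by
        intro n
        induction n with
        | zero => intro y; simp
        | succ n ih =>
          intro y
          rw [pow_succ, pow_succ, mul_apply_eq_comp, Module.End.mul_apply, ← ih]
          congr 1
          simp [hTe]
      obtain ⟨C, hC⟩ := exists_norm_exp_apply_le T μ (n := n) (z := e z)
        (by rw [hpow]; exact (congrArg e hn).trans (map_zero e)) hσ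
      have hC0 : 0 ≤ C := by simpa using (norm_nonneg _).trans (hC 0)
      refine ⟨C, fun t ht => (hC t).trans ?_⟩
      gcongr
      exact hle t ht
    -- If `μ` is not an eigenvalue, its generalised eigenspace is zero; so the growth hypothesis is
    -- needed at eigenvalues only.
    · have hinj : Function.Injective (LC - μ • 1 : Module.End ℂ (ℂ ⊗[ℝ] E)) := by
        rw [Module.End.hasEigenvalue_iff, not_not, Module.End.eigenspace_def] at hev
        exact LinearMap.ker_eq_bot.1 hev
      have hz0 : z = 0 := by
        have := (Module.End.coe_pow (LC - μ • 1) n) ▸ hinj.iterate n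
        exact this (hn.trans (map_zero _).symm)
      rw [hz0]
      exact Submodule.zero_mem _
  obtain ⟨C, hC⟩ : J x ∈ V := hV hx
  refine ⟨c * C, fun t ht => ?_⟩
  have h1 := hanti.le_mul_dist (exp (t • L) x) 0
  rw [map_zero, dist_zero_right, dist_zero_right] at h1
  refine h1.trans ?_
  rw [mul_assoc]
  refine mul_le_mul_of_nonneg_left ?_ c.coe_nonneg
  change ‖J _‖ ≤ _
  rw [hJexp]
  exact hC t ht

/-- Uniform version on the range of a projection into a spectral subspace. -/
theorem exists_norm_exp_comp_le (L : E →L[ℝ] E) {S : Set ℂ} {I : Set ℝ} {φ : ℝ → ℝ}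
    (hφ : ∀ μ ∈ S, Module.End.HasEigenvalue
      ((L : E →ₗ[ℝ] E).baseChange ℂ : Module.End ℂ (ℂ ⊗[ℝ] E)) μ →
      ∃ σ > 0, ∀ t ∈ I, t * μ.re + σ * |t| ≤ φ t)
    {P : E →L[ℝ] E} (hP : ∀ x, P x ∈ spectralSubspace (L : E →ₗ[ℝ] E) S) :
    ∃ M, 0 ≤ M ∧ ∀ t ∈ I, ‖exp (t • L) ∘L P‖ ≤ M * Real.exp (φ t) := by
  have : CompleteSpace E := FiniteDimensional.complete ℝ E
  -- The constants so far depend on the vector; uniform boundedness of the rescaled operators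
  -- removes this dependence.
  obtain ⟨M, hM⟩ := banach_steinhaus
    (g := fun t : I => Real.exp (-φ t) • (exp ((t : ℝ) • L) ∘L P)) (fun x => by
      obtain ⟨C, hC⟩ := exists_norm_exp_apply_le_of_mem L hφ (hP x)
      refine ⟨C, fun t => ?_⟩
      rw [smul_apply, norm_smul, Real.norm_of_nonneg (Real.exp_pos _).le,
        Real.exp_neg, inv_mul_le_iff₀ (Real.exp_pos _), mul_comm]
      exact hC t t.2)
  refine ⟨|M|, abs_nonneg _, fun t ht => ?_⟩
  have h := (hM ⟨t, ht⟩).trans (le_abs_self M)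
  rwa [norm_smul, Real.norm_of_nonneg (Real.exp_pos _).le, Real.exp_neg,
    inv_mul_le_iff₀ (Real.exp_pos _), mul_comm] at h

end Growth

/-! ### The center, stable and unstable projections -/

section

/-- Commuting projections `Pc`, `Ps`, `Pu` onto the center, stable and unstable subspaces of `L`
together with an exponential dichotomy of rate `β`. -/
structure SpectralSplitting {E : Type*} [NormedAddCommGroup E] [NormedSpace ℝ E]
    [FiniteDimensional ℝ E] (L Pc Ps Pu : E →L[ℝ] E) (β : ℝ) : Prop where
  coe_centerProj : ∀ x, (centerProj (L : E →ₗ[ℝ] E) x : E) = Pc x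
  coe_hyperbolicProj : ∀ x, (hyperbolicProj (L : E →ₗ[ℝ] E) x : E) = Ps x + Pu x
  sum_eq : Pc + Ps + Pu = 1
  commute_center : Commute L Pc
  commute_stable : Commute L Ps
  commute_unstable : Commute L Pu
  center_stable : Pc ∘L Ps = 0
  center_unstable : Pc ∘L Pu = 0
  stable_center : Ps ∘L Pc = 0
  unstable_center : Pu ∘L Pc = 0
  rate_pos : 0 < β
  bound_stable : ∃ M, 0 ≤ M ∧ ∀ t : ℝ, 0 ≤ t →
    ‖NormedSpace.exp (t • L) ∘L Ps‖ ≤ M * Real.exp (-β * t)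
  bound_unstable : ∃ M, 0 ≤ M ∧ ∀ t : ℝ, t ≤ 0 →
    ‖NormedSpace.exp (t • L) ∘L Pu‖ ≤ M * Real.exp (β * t)
  bound_center : ∀ η : ℝ, 0 < η → ∃ M, 0 ≤ M ∧ ∀ t : ℝ,
    ‖NormedSpace.exp (t • L) ∘L Pc‖ ≤ M * Real.exp (η * |t|)

variable {E : Type*} [NormedAddCommGroup E] [NormedSpace ℝ E] [FiniteDimensional ℝ E]

/-- Projections attached to a three-fold direct decomposition. -/
theorem exists_projections {p q r : Submodule ℝ E}
    (hex : ∀ x, ∃ a ∈ p, ∃ b ∈ q, ∃ c ∈ r, a + b + c = x)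
    (huniq : ∀ a ∈ p, ∀ b ∈ q, ∀ c ∈ r, a + b + c = 0 → a = 0 ∧ b = 0 ∧ c = 0) :
    ∃ P Q R : E →L[ℝ] E, ∀ a ∈ p, ∀ b ∈ q, ∀ c ∈ r,
      P (a + b + c) = a ∧ Q (a + b + c) = b ∧ R (a + b + c) = c := by
  choose a ha b hb c hc h using hex
  have key : ∀ a' ∈ p, ∀ b' ∈ q, ∀ c' ∈ r, a (a' + b' + c') = a' ∧ b (a' + b' + c') = b' ∧
      c (a' + b' + c') = c' := by
    intro a' ha' b' hb' c' hc'
    have h0 := huniq _ (sub_mem (ha (a' + b' + c')) ha') _ (sub_mem (hb (a' + b' + c')) hb') _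
      (sub_mem (hc (a' + b' + c')) hc') (by
        have := h (a' + b' + c')
        rw [show a (a' + b' + c') - a' + (b (a' + b' + c') - b') + (c (a' + b' + c') - c') =
          (a (a' + b' + c') + b (a' + b' + c') + c (a' + b' + c')) - (a' + b' + c') by abel,
          this, sub_self])
    exact ⟨sub_eq_zero.1 h0.1, sub_eq_zero.1 h0.2.1, sub_eq_zero.1 h0.2.2⟩
  have hadd : ∀ x y, a (x + y) = a x + a y ∧ b (x + y) = b x + b y ∧ c (x + y) = c x + c y := by
    intro x y
    have := key _ (add_mem (ha x) (ha y)) _ (add_mem (hb x) (hb y)) _ (add_mem (hc x) (hc y))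
    rwa [show a x + a y + (b x + b y) + (c x + c y) =
      (a x + b x + c x) + (a y + b y + c y) by abel, h, h] at this
  have hsmul : ∀ (t : ℝ) x, a (t • x) = t • a x ∧ b (t • x) = t • b x ∧ c (t • x) = t • c x := by
    intro t x
    have := key _ (p.smul_mem t (ha x)) _ (q.smul_mem t (hb x)) _ (r.smul_mem t (hc x))
    rwa [← smul_add, ← smul_add, h] at this
  exact ⟨LinearMap.toContinuousLinearMap ⟨⟨a, fun x y => (hadd x y).1⟩, fun t x => (hsmul t x).1⟩,
    LinearMap.toContinuousLinearMap ⟨⟨b, fun x y => (hadd x y).2.1⟩, fun t x => (hsmul t x).2.1⟩,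
    LinearMap.toContinuousLinearMap ⟨⟨c, fun x y => (hadd x y).2.2⟩, fun t x => (hsmul t x).2.2⟩,
    key⟩

/-- The three half-plane conditions on the spectrum are invariant under conjugation, so the
decomposition is real. It is `L`-invariant because `L` commutes with itself, and there are finitely
many eigenvalues, so those off the imaginary axis stay at distance greater than some `β > 0` from
it. -/
theorem exists_spectralSplitting (L : E →L[ℝ] E) :
    ∃ (Pc Ps Pu : E →L[ℝ] E) (β : ℝ), SpectralSplitting L Pc Ps Pu β := by
  let L' : E →ₗ[ℝ] E := L
  let C : Set ℂ := {μ | μ.re = 0}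
  let S : Set ℂ := {μ | μ.re < 0}
  let U : Set ℂ := {μ | 0 < μ.re}
  have hSU : Disjoint S U := Set.disjoint_left.2 fun μ (h1 : μ.re < 0) (h2 : 0 < μ.re) =>
    lt_asymm h1 h2
  have hCSU : Disjoint C (S ∪ U) := Set.disjoint_left.2 fun μ (h1 : μ.re = 0) h2 =>
    h2.elim (fun (h : μ.re < 0) => h.ne h1) (fun (h : 0 < μ.re) => h.ne' h1)
  have hH : S ∪ U = {μ | μ.re ≠ 0} := by
    ext μ
    exact (ne_iff_lt_or_gt (a := μ.re)).symm
  have hcC : ∀ μ ∈ C, (starRingEnd ℂ) μ ∈ C := fun μ (h : μ.re = 0) => by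
    change ((starRingEnd ℂ) μ).re = 0; simpa using h
  have hcS : ∀ μ ∈ S, (starRingEnd ℂ) μ ∈ S := fun μ (h : μ.re < 0) => by
    change ((starRingEnd ℂ) μ).re < 0; simpa using h
  have hcU : ∀ μ ∈ U, (starRingEnd ℂ) μ ∈ U := fun μ (h : 0 < μ.re) => by
    change 0 < ((starRingEnd ℂ) μ).re; simpa using h
  have hcH : ∀ μ ∈ S ∪ U, (starRingEnd ℂ) μ ∈ S ∪ U := fun μ h => h.imp (hcS μ) (hcU μ)
  have huniv : C ∪ (S ∪ U) = Set.univ := by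
    rw [hH]
    ext μ
    exact ⟨fun _ => trivial, fun _ => em (μ.re = 0)⟩
  have hsH : ∀ {x}, x ∈ spectralSubspace L' S → x ∈ spectralSubspace L' (S ∪ U) :=
    fun h => spectralSubspace_mono L' Set.subset_union_left h
  have huH : ∀ {x}, x ∈ spectralSubspace L' U → x ∈ spectralSubspace L' (S ∪ U) :=
    fun h => spectralSubspace_mono L' Set.subset_union_right h
  have hex : ∀ x, ∃ a ∈ spectralSubspace L' C, ∃ b ∈ spectralSubspace L' S,
      ∃ c ∈ spectralSubspace L' U, a + b + c = x := by
    intro x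
    have hx : x ∈ spectralSubspace L' (C ∪ (S ∪ U)) := by
      rw [huniv, spectralSubspace_univ]; exact Submodule.mem_top
    obtain ⟨a, ha, h, hh, rfl⟩ := exists_add_of_mem_spectralSubspace_union L' hCSU hcC hcH hx
    obtain ⟨b, hb, c, hc, rfl⟩ := exists_add_of_mem_spectralSubspace_union L' hSU hcS hcU hh
    exact ⟨a, ha, b, hb, c, hc, add_assoc _ _ _⟩
  have huniq : ∀ a ∈ spectralSubspace L' C, ∀ b ∈ spectralSubspace L' S,
      ∀ c ∈ spectralSubspace L' U, a + b + c = 0 → a = 0 ∧ b = 0 ∧ c = 0 := by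
    intro a ha b hb c hc h
    have h1 := Submodule.disjoint_def.1 (disjoint_spectralSubspace L' hCSU) a ha (by
      rw [add_assoc] at h
      rw [eq_neg_of_add_eq_zero_left h]
      exact neg_mem (add_mem (hsH hb) (huH hc)))
    rw [h1, zero_add] at h
    have h2 := Submodule.disjoint_def.1 (disjoint_spectralSubspace L' hSU) b hb (by
      rw [eq_neg_of_add_eq_zero_left h]
      exact neg_mem hc)
    rw [h2, zero_add] at h
    exact ⟨h1, h2, h⟩
  obtain ⟨Pc, Ps, Pu, hP⟩ := exists_projections hex huniq
  have hmap : ∀ {T : Set ℂ} {x}, x ∈ spectralSubspace L' T → L x ∈ spectralSubspace L' T :=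
    fun hx => map_mem_spectralSubspace (R := L') (fun _ => rfl) hx
  have h00 : ∀ T : Set ℂ, (0 : E) ∈ spectralSubspace L' T := fun T => zero_mem _
  have hPc : ∀ a ∈ spectralSubspace L' C, Pc a = a ∧ Ps a = 0 ∧ Pu a = 0 := fun a ha => by
    simpa using hP a ha 0 (h00 _) 0 (h00 _)
  have hPs : ∀ a ∈ spectralSubspace L' S, Pc a = 0 ∧ Ps a = a ∧ Pu a = 0 := fun a ha => by
    simpa using hP 0 (h00 _) a ha 0 (h00 _)
  have hPu : ∀ a ∈ spectralSubspace L' U, Pc a = 0 ∧ Ps a = 0 ∧ Pu a = a := fun a ha => by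
    simpa using hP 0 (h00 _) 0 (h00 _) a ha
  have hmc : ∀ x, Pc x ∈ spectralSubspace L' C := fun x => by
    obtain ⟨a, ha, b, hb, c, hc, rfl⟩ := hex x
    rwa [(hP a ha b hb c hc).1]
  have hms : ∀ x, Ps x ∈ spectralSubspace L' S := fun x => by
    obtain ⟨a, ha, b, hb, c, hc, rfl⟩ := hex x
    rwa [(hP a ha b hb c hc).2.1]
  have hmu : ∀ x, Pu x ∈ spectralSubspace L' U := fun x => by
    obtain ⟨a, ha, b, hb, c, hc, rfl⟩ := hex x
    rwa [(hP a ha b hb c hc).2.2]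
  -- the spectral gap
  obtain ⟨β, hβ, hgap⟩ : ∃ β : ℝ, 0 < β ∧ ∀ μ : ℂ, Module.End.HasEigenvalue
      (L'.baseChange ℂ : Module.End ℂ (ℂ ⊗[ℝ] E)) μ → μ.re ≠ 0 → β < |μ.re| := by
    have hfin := Module.End.finite_hasEigenvalue (L'.baseChange ℂ : Module.End ℂ (ℂ ⊗[ℝ] E))
    have : ∀ᶠ β in 𝓝[>] (0 : ℝ), ∀ μ ∈ {μ : ℂ | Module.End.HasEigenvalue
        (L'.baseChange ℂ : Module.End ℂ (ℂ ⊗[ℝ] E)) μ}, μ.re ≠ 0 → β < |μ.re| := by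
      rw [hfin.eventually_all]
      intro μ _
      by_cases h : μ.re = 0
      · exact Eventually.of_forall fun _ h' => absurd h h'
      · filter_upwards [Ioo_mem_nhdsGT (abs_pos.2 h)] with β hβ _ using hβ.2
    obtain ⟨β, h1, h2⟩ := (this.and self_mem_nhdsWithin).exists
    exact ⟨β, h2, h1⟩
  refine ⟨Pc, Ps, Pu, β, ?_⟩
  constructor
  · intro x
    obtain ⟨a, ha, b, hb, c, hc, rfl⟩ := hex x
    rw [(hP a ha b hb c hc).1, add_assoc, centerProj, map_add]
    have h1 : b + c ∈ hyperbolicSubspace L' := by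
      have := add_mem (hsH hb) (huH hc)
      rwa [hH] at this
    have ha' : a ∈ centerSubspace (L : E →ₗ[ℝ] E) := ha
    rw [Submodule.projectionOnto_apply_of_mem_right _ h1,
      Submodule.projectionOnto_apply_of_mem_left _ ha', add_zero]
  · intro x
    obtain ⟨a, ha, b, hb, c, hc, rfl⟩ := hex x
    rw [(hP a ha b hb c hc).2.1, (hP a ha b hb c hc).2.2, add_assoc, hyperbolicProj, map_add]
    have h1 : b + c ∈ hyperbolicSubspace L' := by
      have := add_mem (hsH hb) (huH hc)
      rwa [hH] at this
    have ha' : a ∈ centerSubspace (L : E →ₗ[ℝ] E) := ha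
    rw [Submodule.projectionOnto_apply_of_mem_right _ ha',
      Submodule.projectionOnto_apply_of_mem_left _ h1, zero_add]
  · ext x
    obtain ⟨a, ha, b, hb, c, hc, rfl⟩ := hex x
    obtain ⟨h1, h2, h3⟩ := hP a ha b hb c hc
    simp only [add_apply, h1, h2, h3]
    rfl
  · ext x
    obtain ⟨a, ha, b, hb, c, hc, rfl⟩ := hex x
    have h1 := hP a ha b hb c hc
    have h2 := hP _ (hmap ha) _ (hmap hb) _ (hmap hc)
    rw [← map_add, ← map_add] at h2
    rw [mul_apply_eq_comp, mul_apply_eq_comp, h1.1, h2.1]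
  · ext x
    obtain ⟨a, ha, b, hb, c, hc, rfl⟩ := hex x
    have h1 := hP a ha b hb c hc
    have h2 := hP _ (hmap ha) _ (hmap hb) _ (hmap hc)
    rw [← map_add, ← map_add] at h2
    rw [mul_apply_eq_comp, mul_apply_eq_comp, h1.2.1, h2.2.1]
  · ext x
    obtain ⟨a, ha, b, hb, c, hc, rfl⟩ := hex x
    have h1 := hP a ha b hb c hc
    have h2 := hP _ (hmap ha) _ (hmap hb) _ (hmap hc)
    rw [← map_add, ← map_add] at h2
    rw [mul_apply_eq_comp, mul_apply_eq_comp, h1.2.2, h2.2.2]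
  · ext x; exact (hPs _ (hms x)).1
  · ext x; exact (hPu _ (hmu x)).1
  · ext x; exact (hPc _ (hmc x)).2.1
  · ext x; exact (hPc _ (hmc x)).2.2
  · exact hβ
  · refine exists_norm_exp_comp_le L (I := Set.Ici 0) (φ := fun t => -β * t)
      (fun μ (hμ : μ.re < 0) hev => ?_) hms
    have h := hgap μ hev hμ.ne
    rw [abs_of_neg hμ] at h
    -- The strict gap `|Re μ| - β` is the room that absorbs the polynomial factors, so that the rate
    -- is exactly `β`.
    refine ⟨-μ.re - β, by linarith, fun t ht => ?_⟩
    rw [abs_of_nonneg ht]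
    exact le_of_eq (by ring)
  · refine exists_norm_exp_comp_le L (I := Set.Iic 0) (φ := fun t => β * t)
      (fun μ (hμ : 0 < μ.re) hev => ?_) hmu
    have h := hgap μ hev hμ.ne'
    rw [abs_of_pos hμ] at h
    refine ⟨μ.re - β, by linarith, fun t ht => ?_⟩
    rw [abs_of_nonpos ht]
    exact le_of_eq (by ring)
  · intro η hη
    obtain ⟨M, hM, h⟩ := exists_norm_exp_comp_le L (I := Set.univ) (φ := fun t => η * |t|)
      (fun μ (hμ : μ.re = 0) _ => ⟨η, hη, fun t _ => by rw [hμ]; simp⟩) hmc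
    exact ⟨M, hM, fun t => h t trivial⟩

end

/-! ### The Lyapunov–Perron kernel and variation of constants -/

noncomputable section

/-- The signed indicator of the interval between `0` and `t`. -/
def signedIndicator (t s : ℝ) : ℝ := (if s ≤ t then 1 else 0) - (if s ≤ 0 then 1 else 0)

theorem abs_signedIndicator_le (t s : ℝ) : |signedIndicator t s| ≤ 1 := by
  unfold signedIndicator
  split_ifs <;> simp

theorem abs_eq_of_signedIndicator_ne_zero {t s : ℝ} (h : signedIndicator t s ≠ 0) :
    |t| = |t - s| + |s| := by
  unfold signedIndicator at h
  split_ifs at h with h1 h2 h2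
  · simp at h
  · rw [abs_of_nonneg (by linarith : 0 ≤ t), abs_of_nonneg (by linarith : 0 ≤ t - s),
      abs_of_nonneg (by linarith : 0 ≤ s)]
    ring
  · rw [abs_of_nonpos (by linarith : t ≤ 0), abs_of_nonpos (by linarith : t - s ≤ 0),
      abs_of_nonpos h2]
    ring
  · simp at h

theorem measurable_signedIndicator : Measurable fun p : ℝ × ℝ => signedIndicator p.1 p.2 :=
  (Measurable.ite (measurableSet_le measurable_snd measurable_fst) measurable_const
    measurable_const).sub
    (Measurable.ite (measurableSet_le measurable_snd measurable_const) measurable_const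
    measurable_const)

variable {E : Type*} [NormedAddCommGroup E] [NormedSpace ℝ E]

theorem integrable_signedIndicator_smul_iff {h : ℝ → E} (t : ℝ) :
    Integrable (fun s => signedIndicator t s • h s) ↔ IntervalIntegrable h volume 0 t := by
  rcases le_total 0 t with ht | ht
  · rw [intervalIntegrable_iff_integrableOn_Ioc_of_le ht,
      ← integrable_indicator_iff measurableSet_Ioc]
    refine iff_of_eq (congrArg (fun f => Integrable f volume) (funext fun s => ?_))
    unfold signedIndicator
    rw [Set.indicator_apply]
    by_cases h1 : s ≤ t <;> by_cases h2 : s ≤ 0 <;>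
      simp [h1, h2, Set.mem_Ioc]; grind
  · rw [intervalIntegrable_iff, Set.uIoc_of_ge ht,
      ← integrable_indicator_iff measurableSet_Ioc, ← integrable_neg_iff]
    refine iff_of_eq (congrArg (fun f => Integrable f volume) (funext fun s => ?_))
    unfold signedIndicator
    rw [Pi.neg_apply, Set.indicator_apply]
    by_cases h1 : s ≤ t <;> by_cases h2 : s ≤ 0 <;>
      simp [h1, h2, Set.mem_Ioc]; grind

theorem integral_signedIndicator_smul (h : ℝ → E) (t : ℝ) :
    ∫ s, signedIndicator t s • h s = ∫ s in (0 : ℝ)..t, h s := by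
  rcases le_total 0 t with ht | ht
  · rw [intervalIntegral.integral_of_le ht, ← integral_indicator measurableSet_Ioc]
    refine congrArg (fun f => integral volume f) (funext fun s => ?_)
    unfold signedIndicator
    rw [Set.indicator_apply]
    by_cases h1 : s ≤ t <;> by_cases h2 : s ≤ 0 <;>
      simp [h1, h2, Set.mem_Ioc]; grind
  · rw [intervalIntegral.integral_of_ge ht, ← integral_indicator measurableSet_Ioc, ← integral_neg]
    refine congrArg (fun f => integral volume f) (funext fun s => ?_)
    unfold signedIndicator
    rw [Set.indicator_apply]
    by_cases h1 : s ≤ t <;> by_cases h2 : s ≤ 0 <;>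
      simp [h1, h2, Set.mem_Ioc]; grind

/-- The Lyapunov–Perron kernel. -/
def lyapunovPerron (L Pc Ps Pu : E →L[ℝ] E) (t s : ℝ) : E →L[ℝ] E :=
  signedIndicator t s • (NormedSpace.exp ((t - s) • L) ∘L Pc) +
    (if s ≤ t then (1 : ℝ) else 0) • (NormedSpace.exp ((t - s) • L) ∘L Ps) -
    (if s ≤ t then (0 : ℝ) else 1) • (NormedSpace.exp ((t - s) • L) ∘L Pu)

/-- For each pair of times only one term is present: the stable one for `s ≤ t`, the unstable one
otherwise. This is why a single constant `M` suffices. -/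
theorem norm_lyapunovPerron_hyperbolic_le {L Ps Pu : E →L[ℝ] E} {β M : ℝ}
    (hs : ∀ t : ℝ, 0 ≤ t → ‖NormedSpace.exp (t • L) ∘L Ps‖ ≤ M * Real.exp (-β * t))
    (hu : ∀ t : ℝ, t ≤ 0 → ‖NormedSpace.exp (t • L) ∘L Pu‖ ≤ M * Real.exp (β * t)) (t s : ℝ) :
    ‖(if s ≤ t then (1 : ℝ) else 0) • (NormedSpace.exp ((t - s) • L) ∘L Ps) -
      (if s ≤ t then (0 : ℝ) else 1) • (NormedSpace.exp ((t - s) • L) ∘L Pu)‖ ≤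
      M * Real.exp (-β * |t - s|) := by
  by_cases hst : s ≤ t
  · simp only [hst, if_true, one_smul, zero_smul, sub_zero]
    rw [abs_of_nonneg (by linarith : 0 ≤ t - s)]
    exact hs _ (by linarith)
  · simp only [hst, if_false, one_smul, zero_smul, zero_sub, norm_neg]
    rw [abs_of_nonpos (by linarith : t - s ≤ 0), neg_mul_neg]
    exact hu _ (by linarith)

section

variable [CompleteSpace E]

theorem exp_add_smul (L : E →L[ℝ] E) (s t : ℝ) :
    NormedSpace.exp ((s + t) • L) = NormedSpace.exp (s • L) * NormedSpace.exp (t • L) := by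
  let _ : NormedAlgebra ℚ (E →L[ℝ] E) := NormedAlgebra.restrictScalars ℚ ℝ _
  rw [add_smul, NormedSpace.exp_add_of_commute]
  exact ((Commute.refl L).smul_left s).smul_right t

theorem exp_smul_neg_mul (L : E →L[ℝ] E) (t : ℝ) :
    NormedSpace.exp (t • L) * NormedSpace.exp ((-t) • L) = 1 := by
  rw [← exp_add_smul, add_neg_cancel, zero_smul, NormedSpace.exp_zero]

theorem continuous_exp_smul (L : E →L[ℝ] E) :
    Continuous fun t : ℝ => NormedSpace.exp (t • L) :=
  continuous_iff_continuousAt.2 fun t => (hasDerivAt_exp_smul_const L t).continuousAt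

theorem hasDerivAt_exp_smul_apply (L : E →L[ℝ] E) {c : ℝ → E} {c' : E} {t : ℝ}
    (hc : HasDerivAt c c' t) :
    HasDerivAt (fun t => NormedSpace.exp (t • L) (c t))
      (L (NormedSpace.exp (t • L) (c t)) + NormedSpace.exp (t • L) c') t := by
  exact (hasDerivAt_exp_smul_const' L t).clm_apply hc

theorem stronglyMeasurable_lyapunovPerron (L Pc Ps Pu : E →L[ℝ] E) :
    StronglyMeasurable (Function.uncurry (lyapunovPerron L Pc Ps Pu)) := by
  have hexp : ∀ P : E →L[ℝ] E, StronglyMeasurable fun p : ℝ × ℝ =>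
      NormedSpace.exp ((p.1 - p.2) • L) ∘L P := fun P =>
    (((continuous_exp_smul L).comp (continuous_fst.sub continuous_snd)).clm_comp
      continuous_const).stronglyMeasurable
  have hite : ∀ a b : ℝ, Measurable fun p : ℝ × ℝ => if p.2 ≤ p.1 then a else b := fun a b =>
    Measurable.ite (measurableSet_le measurable_snd measurable_fst) measurable_const
      measurable_const
  exact ((measurable_signedIndicator.stronglyMeasurable.smul (hexp Pc)).add
    ((hite 1 0).stronglyMeasurable.smul (hexp Ps))).sub
    ((hite 0 1).stronglyMeasurable.smul (hexp Pu))

/-- The center term lives where `|t| = |t - s| + |s|`; its growth `exp (η|t - s|)` must be beaten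
with decay `η` to spare, hence `2η ≤ ξ`. For the hyperbolic terms `|s| ≤ |t| + |t - s|`, so the
weight consumes `ξ` of the decay rate `β` and at least `η` must remain. The two estimates add up to
the factor `2`. -/
theorem IsKernel.lyapunovPerron {L Pc Ps Pu : E →L[ℝ] E} {η β ξ M : ℝ} (hη : 0 < η)
    (hM : 0 ≤ M)
    (hs : ∀ t : ℝ, 0 ≤ t → ‖NormedSpace.exp (t • L) ∘L Ps‖ ≤ M * Real.exp (-β * t))
    (hu : ∀ t : ℝ, t ≤ 0 → ‖NormedSpace.exp (t • L) ∘L Pu‖ ≤ M * Real.exp (β * t))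
    (hc : ∀ t : ℝ, ‖NormedSpace.exp (t • L) ∘L Pc‖ ≤ M * Real.exp (η * |t|))
    (h1 : 2 * η ≤ ξ) (h2 : ξ + η ≤ β) :
    IsKernel (lyapunovPerron L Pc Ps Pu) (2 * M) η ξ where
  meas := stronglyMeasurable_lyapunovPerron L Pc Ps Pu
  bound t s := by
    have hcen : ‖signedIndicator t s • (NormedSpace.exp ((t - s) • L) ∘L Pc)‖ *
        Real.exp (ξ * |s|) ≤ M * Real.exp (ξ * |t|) * Real.exp (-η * |t - s|) := by
      by_cases h0 : signedIndicator t s = 0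
      · rw [h0, zero_smul, norm_zero, zero_mul]; positivity
      · have habs := abs_eq_of_signedIndicator_ne_zero h0
        have hn : ‖signedIndicator t s • (NormedSpace.exp ((t - s) • L) ∘L Pc)‖ ≤
            M * Real.exp (η * |t - s|) := by
          rw [norm_smul, Real.norm_eq_abs]
          exact (mul_le_of_le_one_left (norm_nonneg _) (abs_signedIndicator_le t s)).trans
            (hc _)
        refine (mul_le_mul_of_nonneg_right hn (Real.exp_pos _).le).trans ?_
        rw [mul_assoc, mul_assoc, ← Real.exp_add, ← Real.exp_add]
        refine mul_le_mul_of_nonneg_left (Real.exp_le_exp.2 ?_) hM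
        rw [habs]
        have := mul_le_mul_of_nonneg_right h1 (abs_nonneg (t - s))
        linarith
    have hhyp := norm_lyapunovPerron_hyperbolic_le hs hu t s
    have hhyp' := (mul_le_mul_of_nonneg_right hhyp (Real.exp_pos (ξ * |s|)).le)
    have hhyp'' : M * Real.exp (-β * |t - s|) * Real.exp (ξ * |s|) ≤
        M * Real.exp (ξ * |t|) * Real.exp (-η * |t - s|) := by
      rw [mul_assoc, mul_assoc, ← Real.exp_add, ← Real.exp_add]
      refine mul_le_mul_of_nonneg_left (Real.exp_le_exp.2 ?_) hM
      have h3 : |s| ≤ |t| + |t - s| := by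
        have := abs_sub_abs_le_abs_sub s t
        rw [abs_sub_comm] at this
        linarith
      have h4 := mul_le_mul_of_nonneg_left h3 (by linarith : 0 ≤ ξ)
      have h5 := mul_le_mul_of_nonneg_right h2 (abs_nonneg (t - s))
      linarith
    have hadd := norm_add_le (signedIndicator t s • (NormedSpace.exp ((t - s) • L) ∘L Pc))
      ((if s ≤ t then (1 : ℝ) else 0) • (NormedSpace.exp ((t - s) • L) ∘L Ps) -
        (if s ≤ t then (0 : ℝ) else 1) • (NormedSpace.exp ((t - s) • L) ∘L Pu))
    rw [← add_sub_assoc] at hadd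
    have := mul_le_mul_of_nonneg_right hadd (Real.exp_pos (ξ * |s|)).le
    change ‖QuiverCM.lyapunovPerron L Pc Ps Pu t s‖ * _ ≤ _ at this
    linarith

/-- Without the center term no weight is needed, so bounded functions have bounded images. This
yields the bounded hyperbolic parts of orbits on the center manifold. -/
theorem IsKernel.lyapunovPerron_hyperbolic {L Ps Pu : E →L[ℝ] E} {β M : ℝ}
    (hs : ∀ t : ℝ, 0 ≤ t → ‖NormedSpace.exp (t • L) ∘L Ps‖ ≤ M * Real.exp (-β * t))
    (hu : ∀ t : ℝ, t ≤ 0 → ‖NormedSpace.exp (t • L) ∘L Pu‖ ≤ M * Real.exp (β * t)) :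
    IsKernel (QuiverCM.lyapunovPerron L 0 Ps Pu) M β 0 where
  meas := stronglyMeasurable_lyapunovPerron L 0 Ps Pu
  bound t s := by
    simpa [QuiverCM.lyapunovPerron] using norm_lyapunovPerron_hyperbolic_le hs hu t s

/-- Moving the time from `0` to `t` changes each of the three cut-offs by the signed indicator of
the interval between them, with matching signs; since the projections add up to the identity, the
total change is a full propagator. All dependence on `t` is thereby put into a propagator and an
interval integral. -/
theorem lyapunovPerron_eq {L Pc Ps Pu : E →L[ℝ] E} (hP : Pc + Ps + Pu = 1) (t s : ℝ) :
    lyapunovPerron L Pc Ps Pu t s = NormedSpace.exp (t • L) ∘L lyapunovPerron L Pc Ps Pu 0 s +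
      signedIndicator t s • (NormedSpace.exp (t • L) ∘L NormedSpace.exp ((-s) • L)) := by
  have hexp : NormedSpace.exp ((t - s) • L) =
      NormedSpace.exp (t • L) ∘L NormedSpace.exp ((-s) • L) := by
    rw [sub_eq_add_neg, exp_add_smul]; rfl
  have hu : Pu = 1 - Pc - Ps := by rw [← hP]; abel
  ext x
  simp only [lyapunovPerron, hexp, zero_sub, hu]
  simp only [signedIndicator, add_apply, sub_apply, smul_apply, ContinuousLinearMap.comp_apply,
    map_add, map_sub, map_smul, one_apply_eq_self]
  by_cases h1 : s ≤ t <;> by_cases h2 : s ≤ 0 <;> simp [h1, h2] <;> abel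

/-- Integrals against the Lyapunov–Perron kernel satisfy the variation of constants formula. -/
theorem integral_lyapunovPerron {L Pc Ps Pu : E →L[ℝ] E} (hP : Pc + Ps + Pu = 1)
    {M η ξ C : ℝ} (hη : 0 < η) (hK : IsKernel (lyapunovPerron L Pc Ps Pu) M η ξ) {g : ℝ → E}
    (hgm : StronglyMeasurable g) (hgb : ∀ s, ‖g s‖ ≤ C * Real.exp (ξ * |s|)) (t : ℝ) :
    IntervalIntegrable (fun s => NormedSpace.exp ((-s) • L) (g s)) volume 0 t ∧
    ∫ s, lyapunovPerron L Pc Ps Pu t s (g s) = NormedSpace.exp (t • L)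
      ((∫ s, lyapunovPerron L Pc Ps Pu 0 s (g s)) +
        ∫ s in (0 : ℝ)..t, NormedSpace.exp ((-s) • L) (g s)) := by
  have hi := hK.integrable hη hgm hgb t
  have hi0 := hK.integrable hη hgm hgb 0
  have hsplit : ∀ s, signedIndicator t s • NormedSpace.exp ((-s) • L) (g s) =
      NormedSpace.exp ((-t) • L) (lyapunovPerron L Pc Ps Pu t s (g s)) -
        lyapunovPerron L Pc Ps Pu 0 s (g s) := by
    intro s
    have hinv : ∀ x, NormedSpace.exp ((-t) • L) (NormedSpace.exp (t • L) x) = x := fun x => by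
      have := exp_smul_neg_mul L (-t)
      rw [neg_neg] at this
      exact congrArg (fun T : E →L[ℝ] E => T x) this
    rw [lyapunovPerron_eq hP t s]
    simp only [add_apply, smul_apply, ContinuousLinearMap.comp_apply, map_add, map_smul, hinv]
    abel
  have hint : Integrable fun s => signedIndicator t s • NormedSpace.exp ((-s) • L) (g s) := by
    simp only [hsplit]
    exact ((NormedSpace.exp ((-t) • L)).integrable_comp hi).sub hi0
  refine ⟨(integrable_signedIndicator_smul_iff t).1 hint, ?_⟩
  have hsum : Integrable fun s => lyapunovPerron L Pc Ps Pu 0 s (g s) +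
      signedIndicator t s • NormedSpace.exp ((-s) • L) (g s) := hi0.add hint
  rw [← integral_signedIndicator_smul, ← integral_add hi0 hint,
    ← ContinuousLinearMap.integral_comp_comm _ hsum]
  refine congrArg (fun f => integral volume f) (funext fun s => ?_)
  rw [lyapunovPerron_eq hP t s]
  simp only [add_apply, smul_apply, ContinuousLinearMap.comp_apply, map_add, map_smul]

theorem continuous_integral_lyapunovPerron {L Pc Ps Pu : E →L[ℝ] E} (hP : Pc + Ps + Pu = 1)
    {M η ξ C : ℝ} (hη : 0 < η) (hK : IsKernel (lyapunovPerron L Pc Ps Pu) M η ξ) {g : ℝ → E}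
    (hgm : StronglyMeasurable g) (hgb : ∀ s, ‖g s‖ ≤ C * Real.exp (ξ * |s|)) :
    Continuous fun t => ∫ s, lyapunovPerron L Pc Ps Pu t s (g s) := by
  have h := integral_lyapunovPerron hP hη hK hgm hgb
  rw [funext fun t => (h t).2]
  exact (continuous_exp_smul L).clm_apply (continuous_const.add
    (intervalIntegral.continuous_primitive (fun a b => (h a).1.symm.trans (h b).1) 0))

/-- Integrals against the Lyapunov–Perron kernel solve the inhomogeneous linear equation. -/
theorem hasDerivAt_integral_lyapunovPerron {L Pc Ps Pu : E →L[ℝ] E} (hP : Pc + Ps + Pu = 1)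
    {M η ξ C : ℝ} (hη : 0 < η) (hK : IsKernel (lyapunovPerron L Pc Ps Pu) M η ξ) {g : ℝ → E}
    (hgc : Continuous g) (hgb : ∀ s, ‖g s‖ ≤ C * Real.exp (ξ * |s|)) (t : ℝ) :
    HasDerivAt (fun t => ∫ s, lyapunovPerron L Pc Ps Pu t s (g s))
      (L (∫ s, lyapunovPerron L Pc Ps Pu t s (g s)) + g t) t := by
  have h := integral_lyapunovPerron hP hη hK hgc.stronglyMeasurable hgb
  have hc : Continuous fun s => NormedSpace.exp ((-s) • L) (g s) :=
    ((continuous_exp_smul L).comp continuous_neg).clm_apply hgc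
  rw [funext fun t => (h t).2, (h t).2]
  have h1 := hasDerivAt_exp_smul_apply L (((hc.integral_hasStrictDerivAt 0 t).hasDerivAt).const_add
    (∫ s, lyapunovPerron L Pc Ps Pu 0 s (g s)))
  have h2 : NormedSpace.exp (t • L) (NormedSpace.exp ((-t) • L) (g t)) = g t :=
    congrArg (fun T : E →L[ℝ] E => T (g t)) (exp_smul_neg_mul L t)
  rwa [h2] at h1

end

end

/-! ### Global flows of Lipschitz vector fields -/

section

variable {E : Type*} [NormedAddCommGroup E] [NormedSpace ℝ E]

theorem IsSolution.shift {F : E → E} {x : E} {γ : ℝ → E} (h : IsSolution F x γ) (t₀ : ℝ) :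
    IsSolution F (γ t₀) fun t => γ (t + t₀) :=
  ⟨congrArg γ (zero_add t₀), fun t => (h.2 (t + t₀)).comp_add_const t t₀⟩

theorem IsSolution.continuous {F : E → E} {x : E} {γ : ℝ → E} (h : IsSolution F x γ) :
    Continuous γ :=
  continuous_iff_continuousAt.2 fun t => (h.2 t).continuousAt

theorem IsSolution.eq {F : E → E} {C : NNReal} (hF : LipschitzWith C F) {x : E} {γ γ' : ℝ → E}
    (h : IsSolution F x γ) (h' : IsSolution F x γ') : γ = γ' :=
  ODE_solution_unique_univ (v := fun _ => F) (s := fun _ => Set.univ) (t₀ := 0)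
    (fun _ => hF.lipschitzOnWith) (fun t => ⟨h.2 t, trivial⟩) (fun t => ⟨h'.2 t, trivial⟩)
    (h.1.trans h'.1.symm)

theorem norm_le_mul_exp_of_norm_le {E : Type*} [NormedAddCommGroup E] {h : ℝ → E} {C ξ : ℝ} (hξ : 0 ≤ ξ) (hh : ∀ s, ‖h s‖ ≤ C)
    (s : ℝ) : ‖h s‖ ≤ C * Real.exp (ξ * |s|) := by
  have hC : 0 ≤ C := (norm_nonneg _).trans (hh s)
  exact (hh s).trans (le_mul_of_one_le_right hC (Real.one_le_exp (by positivity)))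

/-- A globally Lipschitz vector field on a complete space has a unique global flow. -/
theorem existsUnique_isSolution [CompleteSpace E] {F : E → E} {C : NNReal}
    (hF : LipschitzWith C F) (x : E) : ∃! γ : ℝ → E, IsSolution F x γ := by
  -- With `L = 0` and the identity as center projection, the kernel is the signed indicator and the
  -- fixed point equation is the Picard equation. The kernel constant is `2`, so decay rate `4C + 1`
  -- gives the contraction constant `4C / (4C + 1) < 1`: a weight of large enough growth yields a
  -- global solution at once.
  have hη : (0 : ℝ) < 4 * C + 1 := by positivity
  have hP : (1 : E →L[ℝ] E) + 0 + 0 = 1 := by simp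
  have hK : IsKernel (lyapunovPerron (0 : E →L[ℝ] E) 1 0 0) (2 * 1) (4 * C + 1)
      (2 * (4 * C + 1)) := by
    refine IsKernel.lyapunovPerron (β := 3 * (4 * C + 1)) hη zero_le_one (fun t _ => ?_)
      (fun t _ => ?_) (fun t => ?_) le_rfl (by linarith)
    · simp; positivity
    · simp; positivity
    · rw [smul_zero, NormedSpace.exp_zero, one_mul]
      exact (ContinuousLinearMap.norm_id_le (𝕜 := ℝ) (E := E)).trans
        (Real.one_le_exp (by positivity))
  have hlip : ∀ y y', ‖F y - F y'‖ ≤ C * ‖y - y'‖ := fun y y' => by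
    rw [← dist_eq_norm, ← dist_eq_norm]
    exact hF.dist_le_mul y y'
  obtain ⟨w, hwm, ⟨C', hC'⟩, hw⟩ := exists_integral_fixedPoint (C := ‖F x‖) hK hη
    (by norm_num) C.2 (by
      change (C : ℝ) * _ < 1
      rw [← mul_div_assoc, div_lt_one hη]; linarith)
    (f := fun _ w => F (x + w)) (fun _ y y' => by simpa using hlip (x + y) (x + y'))
    (norm_le_mul_exp_of_norm_le (by positivity) fun _ => by simp)
    (fun w hw => hF.continuous.comp_stronglyMeasurable (stronglyMeasurable_const.add hw))
  have hgb : ∀ s, ‖F (x + w s)‖ ≤ (‖F x‖ + C * C') * Real.exp (2 * (4 * C + 1) * |s|) := fun s => by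
    have h1 := hlip (x + w s) x
    rw [add_sub_cancel_left] at h1
    have h2 := norm_le_insert' (F (x + w s)) (F x)
    have h3 := mul_le_mul_of_nonneg_left (hC' s) C.2
    have h4 := norm_le_mul_exp_of_norm_le (ξ := 2 * (4 * C + 1)) (by positivity)
      (fun _ : ℝ => le_refl ‖F x‖) s
    change (C : ℝ) * _ ≤ C * _ at h3
    linarith
  have hgm : StronglyMeasurable fun s => F (x + w s) :=
    hF.continuous.comp_stronglyMeasurable (stronglyMeasurable_const.add hwm)
  have hwc : Continuous w := by
    rw [funext hw]
    exact continuous_integral_lyapunovPerron hP hη hK hgm hgb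
  have hsol : IsSolution F x fun t => x + w t := by
    refine ⟨?_, fun t => ?_⟩
    · have h0 : w 0 = 0 := by
        rw [hw]
        simp [lyapunovPerron, signedIndicator]
      simp only [h0, add_zero]
    · have := hasDerivAt_integral_lyapunovPerron hP hη hK
        (g := fun s => F (x + w s)) (hF.continuous.comp (continuous_const.add hwc)) hgb t
      rw [← funext hw, zero_apply, zero_add] at this
      exact this.const_add x
  exact ⟨_, hsol, fun γ hγ => hγ.eq hF hsol⟩

end

/-! ### Graphs over the center subspace -/

section

variable {E : Type*} [NormedAddCommGroup E] [NormedSpace ℝ E] [FiniteDimensional ℝ E]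

theorem centerProj_add_hyperbolicProj (L : E →ₗ[ℝ] E) (x : E) :
    (centerProj L x : E) + hyperbolicProj L x = x :=
  Submodule.projection_add_projection_eq_self (isCompl_center_hyperbolic L) x

theorem centerProj_add (L : E →ₗ[ℝ] E) (a : centerSubspace L) (b : hyperbolicSubspace L) :
    centerProj L (a + b) = a := by
  rw [map_add, centerProj, Submodule.projectionOnto_apply_left,
    Submodule.projectionOnto_apply_right, add_zero]

theorem hyperbolicProj_add (L : E →ₗ[ℝ] E) (a : centerSubspace L) (b : hyperbolicSubspace L) :
    hyperbolicProj L (a + b) = b := by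
  rw [map_add, hyperbolicProj, Submodule.projectionOnto_apply_left,
    Submodule.projectionOnto_apply_right, zero_add]

theorem mem_centerGraph_iff {L : E →L[ℝ] E}
    {φ : centerSubspace (L : E →ₗ[ℝ] E) → hyperbolicSubspace (L : E →ₗ[ℝ] E)} {y : E} :
    y ∈ centerGraph L φ ↔
      φ (centerProj (L : E →ₗ[ℝ] E) y) = hyperbolicProj (L : E →ₗ[ℝ] E) y := by
  constructor
  · rintro ⟨x, rfl⟩
    simp only [centerProj_add, hyperbolicProj_add]
  · intro h
    refine ⟨centerProj (L : E →ₗ[ℝ] E) y, ?_⟩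
    simp only [h]
    exact centerProj_add_hyperbolicProj _ _

/-- The splitting is direct, so a point of the graph reveals both its argument and its value.
Uniqueness of the center manifold map rests on this, since the graph is prescribed. -/
theorem centerGraph_injective (L : E →L[ℝ] E) : Function.Injective (centerGraph L) := by
  intro φ ψ h
  funext x
  have hx : (x : E) + φ x ∈ centerGraph L ψ := h ▸ ⟨x, rfl⟩
  rw [mem_centerGraph_iff, centerProj_add, hyperbolicProj_add] at hx
  exact hx.symm

/-- The defining bound holds over all times, so it is unaffected by a shift in time; uniqueness
identifies the given orbit with the bounded one. -/
theorem centerManifold_invariant {L : E →L[ℝ] E} {F : E → E} {C : NNReal}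
    (hF : LipschitzWith C F) {x : E} {γ : ℝ → E} (hγ : IsSolution F x γ)
    (hx : x ∈ centerManifold L F) (t : ℝ) : γ t ∈ centerManifold L F := by
  obtain ⟨γ', hγ', B, hB⟩ := hx
  obtain rfl := hγ.eq hF hγ'
  exact ⟨_, hγ.shift t, B, fun s => hB (s + t)⟩

end

/-! ### The center manifold as the solution set of the Lyapunov–Perron equation -/

namespace SpectralSplitting

variable {E : Type*} [NormedAddCommGroup E] [NormedSpace ℝ E] [FiniteDimensional ℝ E]
  {L Pc Ps Pu : E →L[ℝ] E} {β : ℝ}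

theorem center_center (hS : SpectralSplitting L Pc Ps Pu β) : Pc ∘L Pc = Pc := by
  have h : Pc ∘L (Pc + Ps + Pu) = Pc := by rw [hS.sum_eq]; rfl
  rwa [ContinuousLinearMap.comp_add, ContinuousLinearMap.comp_add, hS.center_stable,
    hS.center_unstable, add_zero, add_zero] at h

theorem exp_apply_comm {P : E →L[ℝ] E} (h : Commute L P) (t : ℝ) (x : E) :
    P (NormedSpace.exp (t • L) x) = NormedSpace.exp (t • L) (P x) := by
  have := FiniteDimensional.complete ℝ E
  let _ : NormedAlgebra ℚ (E →L[ℝ] E) := NormedAlgebra.restrictScalars ℚ ℝ _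
  exact (congrArg (fun T : E →L[ℝ] E => T x) ((h.smul_left t).exp_left).eq).symm

/-- The signed indicator vanishes at `t = 0`. Consequently the integral term of the equation is
hyperbolic at time `0`, and the parameter `x` is the center coordinate of the initial point. -/
theorem center_lyapunovPerron_zero (hS : SpectralSplitting L Pc Ps Pu β) (s : ℝ) (x : E) :
    Pc (lyapunovPerron L Pc Ps Pu 0 s x) = 0 := by
  have h1 : ∀ x, Pc (Ps x) = 0 := fun x => congrArg (fun T : E →L[ℝ] E => T x) hS.center_stable
  have h2 : ∀ x, Pc (Pu x) = 0 := fun x => congrArg (fun T : E →L[ℝ] E => T x) hS.center_unstable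
  simp only [lyapunovPerron, signedIndicator, sub_self, zero_smul, zero_add, map_sub, map_smul,
    sub_apply, smul_apply, ContinuousLinearMap.comp_apply, exp_apply_comm hS.commute_center, h1, h2,
    map_zero, smul_zero]

theorem hyperbolic_lyapunovPerron (hS : SpectralSplitting L Pc Ps Pu β) (t s : ℝ) (x : E) :
    (Ps + Pu) (lyapunovPerron L Pc Ps Pu t s x) = lyapunovPerron L 0 Ps Pu t s x := by
  have h1 : ∀ x, Pc (Ps x) = 0 := fun x => congrArg (fun T : E →L[ℝ] E => T x) hS.center_stable
  have h2 : ∀ x, Pc (Pu x) = 0 := fun x => congrArg (fun T : E →L[ℝ] E => T x) hS.center_unstable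
  have h3 : ∀ x, Pc (Pc x) = Pc x := fun x => congrArg (fun T : E →L[ℝ] E => T x) hS.center_center
  have h4 : Ps + Pu = 1 - Pc := by rw [← hS.sum_eq]; abel
  rw [h4, sub_apply, one_apply_eq_self, sub_eq_iff_eq_add]
  simp only [lyapunovPerron, map_sub, map_add, map_smul, add_apply, sub_apply, smul_apply,
    zero_apply, ContinuousLinearMap.comp_apply, exp_apply_comm hS.commute_center, h1, h2, h3, map_zero, smul_zero,
    zero_add, sub_zero]
  abel

/-- A vector whose orbit under the linear flow has a bounded hyperbolic part is central. -/
theorem hyperbolic_eq_zero_of_bounded (hS : SpectralSplitting L Pc Ps Pu β) {x : E} {B : ℝ}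
    (hB : ∀ t : ℝ, ‖(Ps + Pu) (NormedSpace.exp (t • L) x)‖ ≤ B) : (Ps + Pu) x = 0 := by
  have := FiniteDimensional.complete ℝ E
  have key : ∀ {P : E →L[ℝ] E} {M : ℝ} {ι : ℝ}, Commute L P → P ∘L Pc = 0 → 0 ≤ M →
      (∀ t : ℝ, 0 ≤ t → ‖NormedSpace.exp ((ι * t) • L) ∘L P‖ ≤ M * Real.exp (-β * t)) →
      P x = 0 := by
    intro P M ι hcomm hPc hM hP
    have hPh : ∀ y, P ((Ps + Pu) y) = P y := fun y => by
      have h1 : P (Pc y) = 0 := congrArg (fun T : E →L[ℝ] E => T y) hPc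
      have h4 : Ps + Pu = 1 - Pc := by rw [← hS.sum_eq]; abel
      rw [h4, sub_apply, map_sub, h1, sub_zero, one_apply_eq_self]
    have hbd : ∀ t : ℝ, 0 ≤ t → ‖P x‖ ≤ M * Real.exp (-β * t) * B := by
      intro t ht
      -- Flow backwards along the orbit and forwards again inside the range of `P`: the first vector
      -- stays bounded and the second factor decays. For `P = Pu` the directions are exchanged,
      -- which is the role of `ι = ±1`.
      have hid : P x = (NormedSpace.exp ((ι * t) • L) ∘L P)
          ((Ps + Pu) (NormedSpace.exp ((-(ι * t)) • L) x)) := by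
        rw [ContinuousLinearMap.comp_apply, hPh, exp_apply_comm hcomm]
        exact (congrArg (fun T : E →L[ℝ] E => T (P x)) (exp_smul_neg_mul L (ι * t))).symm
      rw [hid]
      refine (ContinuousLinearMap.le_opNorm _ _).trans
        (mul_le_mul (hP t ht) (hB _) (norm_nonneg _) (by positivity))
    have hlim : Tendsto (fun t : ℝ => M * Real.exp (-β * t) * B) atTop (𝓝 (M * 0 * B)) := by
      refine ((Real.tendsto_exp_atBot.comp ?_).const_mul M).mul_const B
      exact tendsto_id.const_mul_atTop_of_neg (neg_lt_zero.2 hS.rate_pos)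
    rw [mul_zero, zero_mul] at hlim
    have h0 := ge_of_tendsto hlim ((eventually_ge_atTop 0).mono hbd)
    exact norm_le_zero_iff.1 h0
  obtain ⟨M, hM, hs⟩ := hS.bound_stable
  obtain ⟨M', hM', hu⟩ := hS.bound_unstable
  rw [add_apply, key (ι := 1) hS.commute_stable hS.stable_center hM (by simpa using hs),
    key (ι := -1) hS.commute_unstable hS.unstable_center hM' fun t ht => by
      simpa using hu (-t) (by linarith), add_zero]

end SpectralSplitting

/-- A vector field `F` whose nonlinear part `F - L` is bounded and has a Lipschitz constant that is
small in comparison with the Lyapunov–Perron kernel of its linear part `L`. -/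
structure NonlinearSplitting {E : Type*} [NormedAddCommGroup E] [NormedSpace ℝ E]
    [FiniteDimensional ℝ E] (L Pc Ps Pu : E →L[ℝ] E) (F : E → E) (β M N η ξ δ C : ℝ) : Prop
    extends SpectralSplitting L Pc Ps Pu β where
  norm_stable : ∀ t : ℝ, 0 ≤ t → ‖NormedSpace.exp (t • L) ∘L Ps‖ ≤ M * Real.exp (-β * t)
  norm_unstable : ∀ t : ℝ, t ≤ 0 → ‖NormedSpace.exp (t • L) ∘L Pu‖ ≤ M * Real.exp (β * t)
  isKernel : IsKernel (lyapunovPerron L Pc Ps Pu) N η ξ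
  decay_pos : 0 < η
  weight_nonneg : 0 ≤ ξ
  bound_nonneg : 0 ≤ N
  lipschitz_nonneg : 0 ≤ δ
  small : δ * (2 * N / η) < 1
  lipschitz : ∀ x y, ‖(F x - L x) - (F y - L y)‖ ≤ δ * ‖x - y‖
  bounded : ∀ x, ‖F x - L x‖ ≤ C

namespace NonlinearSplitting

variable {E : Type*} [NormedAddCommGroup E] [NormedSpace ℝ E] [FiniteDimensional ℝ E]
  {L Pc Ps Pu : E →L[ℝ] E} {F : E → E} {β M N η ξ δ C : ℝ}

theorem norm_hyperbolicProj (hN : NonlinearSplitting L Pc Ps Pu F β M N η ξ δ C) (y : E) :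
    ‖hyperbolicProj (L : E →ₗ[ℝ] E) y‖ = ‖(Ps + Pu) y‖ := by
  rw [add_apply, ← hN.coe_hyperbolicProj y]
  rfl

theorem center_coe (hN : NonlinearSplitting L Pc Ps Pu F β M N η ξ δ C)
    (x : centerSubspace (L : E →ₗ[ℝ] E)) : Pc (x : E) = x := by
  rw [← hN.coe_centerProj]
  simpa using congrArg Subtype.val (centerProj_add (L : E →ₗ[ℝ] E) x 0)

theorem hyperbolic_exp_coe (hN : NonlinearSplitting L Pc Ps Pu F β M N η ξ δ C)
    (x : centerSubspace (L : E →ₗ[ℝ] E)) (t : ℝ) :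
    (Ps + Pu) (NormedSpace.exp (t • L) (x : E)) = 0 := by
  have h4 : Ps + Pu = 1 - Pc := by rw [← hN.sum_eq]; abel
  rw [h4, sub_apply, SpectralSplitting.exp_apply_comm hN.commute_center, hN.center_coe,
    one_apply_eq_self, sub_self]

theorem continuous_nonlinear (hN : NonlinearSplitting L Pc Ps Pu F β M N η ξ δ C) :
    Continuous fun x => F x - L x := by
  refine (LipschitzWith.of_dist_le_mul (K := ⟨δ, hN.lipschitz_nonneg⟩) fun x y => ?_).continuous
  rw [dist_eq_norm, dist_eq_norm]
  exact hN.lipschitz x y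

/-- The hyperbolic projection removes the center term of the kernel, and the remaining kernel is
bounded in weight `0`. The nonlinear part is bounded, so the estimate is uniform in `t` and in the
curve `γ`. -/
theorem norm_hyperbolic_integral_le (hN : NonlinearSplitting L Pc Ps Pu F β M N η ξ δ C)
    {γ : ℝ → E} (hγ : StronglyMeasurable γ) (t : ℝ) :
    ‖(Ps + Pu) (∫ s, lyapunovPerron L Pc Ps Pu t s (F (γ s) - L (γ s)))‖ ≤ C * (2 * M / β) := by
  have := FiniteDimensional.complete ℝ E
  have hm : StronglyMeasurable fun s => F (γ s) - L (γ s) :=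
    hN.continuous_nonlinear.comp_stronglyMeasurable hγ
  rw [← ContinuousLinearMap.integral_comp_comm _ (hN.isKernel.integrable hN.decay_pos hm
    (norm_le_mul_exp_of_norm_le hN.weight_nonneg fun s => hN.bounded _) t)]
  simp only [hN.hyperbolic_lyapunovPerron]
  refine ((IsKernel.lyapunovPerron_hyperbolic hN.norm_stable hN.norm_unstable).norm_integral_le
    hN.rate_pos (norm_le_mul_exp_of_norm_le le_rfl fun s => hN.bounded _) t).trans_eq ?_
  simp

theorem center_integral_zero (hN : NonlinearSplitting L Pc Ps Pu F β M N η ξ δ C)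
    {γ : ℝ → E} (hγ : StronglyMeasurable γ) :
    Pc (∫ s, lyapunovPerron L Pc Ps Pu 0 s (F (γ s) - L (γ s))) = 0 := by
  have := FiniteDimensional.complete ℝ E
  have hm : StronglyMeasurable fun s => F (γ s) - L (γ s) :=
    hN.continuous_nonlinear.comp_stronglyMeasurable hγ
  rw [← ContinuousLinearMap.integral_comp_comm _ (hN.isKernel.integrable hN.decay_pos hm
    (norm_le_mul_exp_of_norm_le hN.weight_nonneg fun s => hN.bounded _) 0)]
  simp only [hN.center_lyapunovPerron_zero, integral_zero]

theorem hasDerivAt_integral (hN : NonlinearSplitting L Pc Ps Pu F β M N η ξ δ C)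
    {γ : ℝ → E} (hγ : Continuous γ) (t : ℝ) :
    HasDerivAt (fun t => ∫ s, lyapunovPerron L Pc Ps Pu t s (F (γ s) - L (γ s)))
      (L (∫ s, lyapunovPerron L Pc Ps Pu t s (F (γ s) - L (γ s))) + (F (γ t) - L (γ t))) t := by
  have := FiniteDimensional.complete ℝ E
  exact hasDerivAt_integral_lyapunovPerron hN.sum_eq hN.decay_pos hN.isKernel
    (g := fun s => F (γ s) - L (γ s)) (hN.continuous_nonlinear.comp hγ)
    (norm_le_mul_exp_of_norm_le hN.weight_nonneg fun s => hN.bounded _) t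

/-- Solutions of the Lyapunov–Perron equation lie on the center manifold. -/
theorem mem_centerManifold (hN : NonlinearSplitting L Pc Ps Pu F β M N η ξ δ C)
    (x : centerSubspace (L : E →ₗ[ℝ] E)) {w : ℝ → E} (hwm : StronglyMeasurable w)
    (hw : ∀ t, w t = ∫ s, lyapunovPerron L Pc Ps Pu t s
      (F (NormedSpace.exp (s • L) (x : E) + w s) - L (NormedSpace.exp (s • L) (x : E) + w s))) :
    (x : E) + w 0 ∈ centerManifold L F := by
  have := FiniteDimensional.complete ℝ E
  have hec : Continuous fun s : ℝ => NormedSpace.exp (s • L) (x : E) :=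
    (continuous_exp_smul L).clm_apply continuous_const
  have hγm : StronglyMeasurable fun s : ℝ => NormedSpace.exp (s • L) (x : E) + w s :=
    hec.stronglyMeasurable.add hwm
  have hwc : Continuous w := by
    rw [funext hw]
    exact continuous_integral_lyapunovPerron hN.sum_eq hN.decay_pos hN.isKernel
      (hN.continuous_nonlinear.comp_stronglyMeasurable hγm)
      (norm_le_mul_exp_of_norm_le hN.weight_nonneg fun s => hN.bounded _)
  refine ⟨fun s => NormedSpace.exp (s • L) (x : E) + w s, ⟨by simp, fun t => ?_⟩,
    C * (2 * M / β), fun t => ?_⟩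
  · have h1 := hN.hasDerivAt_integral
      (γ := fun s => NormedSpace.exp (s • L) (x : E) + w s) (hec.add hwc) t
    simp only [← hw] at h1
    have h2 := (hasDerivAt_exp_smul_apply L (hasDerivAt_const t (x : E))).add h1
    refine h2.congr_deriv ?_
    simp only [map_zero, add_zero, map_add]
    abel
  · rw [hN.norm_hyperbolicProj, map_add, hN.hyperbolic_exp_coe, zero_add, hw t]
    exact hN.norm_hyperbolic_integral_le hγm t

/-- Every orbit with bounded hyperbolic part is a solution of the Lyapunov–Perron equation. -/
theorem eq_of_mem_centerManifold (hN : NonlinearSplitting L Pc Ps Pu F β M N η ξ δ C)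
    {u : ℝ → centerSubspace (L : E →ₗ[ℝ] E) → E} (hum : ∀ x, StronglyMeasurable fun t => u t x)
    (hu : ∀ t x, u t x = ∫ s, lyapunovPerron L Pc Ps Pu t s
      (F (NormedSpace.exp (s • L) (x : E) + u s x) -
        L (NormedSpace.exp (s • L) (x : E) + u s x)))
    {y : E} (hy : y ∈ centerManifold L F) :
    (centerProj (L : E →ₗ[ℝ] E) y : E) + u 0 (centerProj (L : E →ₗ[ℝ] E) y) = y := by
  have := FiniteDimensional.complete ℝ E
  obtain ⟨γ, hγ, B, hB⟩ := hy
  have hγc := hγ.continuous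
  set z : ℝ → E := fun t => ∫ s, lyapunovPerron L Pc Ps Pu t s (F (γ s) - L (γ s)) with hz
  -- Both `γ` and `z` solve the linear equation with the same inhomogeneity `F(γ) - L γ`, so their
  -- difference follows the linear flow. Its hyperbolic part is bounded, hence zero, and the
  -- difference equals `exp (tL) x`.
  have hd : ∀ t, HasDerivAt (fun t => γ t - z t) (L (γ t - z t)) t := fun t =>
    ((hγ.2 t).sub (hN.hasDerivAt_integral hγc t)).congr_deriv (by
      rw [map_sub]; abel)
  have hdexp : (fun t => γ t - z t) = fun t => NormedSpace.exp (t • L) (γ 0 - z 0) := by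
    refine IsSolution.eq (F := L) (x := γ 0 - z 0) L.lipschitz ⟨rfl, hd⟩ ⟨by simp, fun t => ?_⟩
    simpa using hasDerivAt_exp_smul_apply L (hasDerivAt_const t (γ 0 - z 0))
  have hbd : ∀ t : ℝ, ‖(Ps + Pu) (NormedSpace.exp (t • L) (γ 0 - z 0))‖ ≤
      B + C * (2 * M / β) := fun t => by
    rw [← congrFun hdexp t, map_sub]
    refine (norm_sub_le _ _).trans (add_le_add ?_
      (hN.norm_hyperbolic_integral_le hγc.stronglyMeasurable t))
    rw [← hN.norm_hyperbolicProj]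
    exact hB t
  have hh0 := hN.hyperbolic_eq_zero_of_bounded hbd
  have hz0 : Pc (z 0) = 0 := hN.center_integral_zero hγc.stronglyMeasurable
  set x := centerProj (L : E →ₗ[ℝ] E) y with hx
  have hd0 : γ 0 - z 0 = x := by
    have h1 : Pc (γ 0 - z 0) + (Ps + Pu) (γ 0 - z 0) = γ 0 - z 0 := by
      rw [← add_apply, ← add_assoc, hN.sum_eq, one_apply_eq_self]
    rw [← h1, hh0, map_sub, hz0, hγ.1, hx, hN.coe_centerProj, sub_zero, add_zero]
  have hγz : ∀ t, γ t = NormedSpace.exp (t • L) (x : E) + z t := fun t => by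
    rw [← hd0, ← congrFun hdexp t, sub_add_cancel]
  have hγm : StronglyMeasurable fun s : ℝ => NormedSpace.exp (s • L) (x : E) + u s x :=
    ((continuous_exp_smul L).clm_apply continuous_const).stronglyMeasurable.add (hum x)
  have hi1 : ∀ t, Integrable fun s => lyapunovPerron L Pc Ps Pu t s (F (γ s) - L (γ s)) :=
    fun t => hN.isKernel.integrable hN.decay_pos
      (hN.continuous_nonlinear.comp_stronglyMeasurable hγc.stronglyMeasurable)
      (norm_le_mul_exp_of_norm_le hN.weight_nonneg fun s => hN.bounded _) t
  have hi2 : ∀ t, Integrable fun s => lyapunovPerron L Pc Ps Pu t s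
      (F (NormedSpace.exp (s • L) (x : E) + u s x) -
        L (NormedSpace.exp (s • L) (x : E) + u s x)) :=
    fun t => hN.isKernel.integrable hN.decay_pos
      (hN.continuous_nonlinear.comp_stronglyMeasurable hγm)
      (norm_le_mul_exp_of_norm_le hN.weight_nonneg fun s => hN.bounded _) t
  -- Now `z` and `u · x` solve the same fixed point equation and both lie in the weighted space, so
  -- the contraction estimate with constant `0` forces them to agree.
  have hdiff := hN.isKernel.norm_le_of_integral_eq hN.decay_pos hN.bound_nonneg
    hN.lipschitz_nonneg hN.small le_rfl (w := fun t => z t - u t x)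
    (g := fun s => (F (γ s) - L (γ s)) - (F (NormedSpace.exp (s • L) (x : E) + u s x) -
        L (NormedSpace.exp (s • L) (x : E) + u s x)))
    (fun t => by
      simp only [map_sub (lyapunovPerron L Pc Ps Pu t _) (F (γ _) - L (γ _))]
      rw [integral_sub (hi1 t) (hi2 t), ← hu t x])
    (fun s => by
      refine (hN.lipschitz _ _).trans_eq ?_
      rw [hγz s, add_sub_add_left_eq_sub, zero_mul, add_zero])
    ⟨C * (2 * N / η) + C * (2 * N / η), fun t => by
      rw [add_mul]
      refine (norm_sub_le _ _).trans (add_le_add ?_ ?_)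
      · exact hN.isKernel.norm_integral_le hN.decay_pos
          (norm_le_mul_exp_of_norm_le hN.weight_nonneg fun s => hN.bounded _) t
      · rw [hu t x]
        exact hN.isKernel.norm_integral_le hN.decay_pos
          (norm_le_mul_exp_of_norm_le hN.weight_nonneg fun s => hN.bounded _) t⟩ 0
  rw [zero_mul, zero_div, zero_mul, norm_le_zero_iff, sub_eq_zero] at hdiff
  rw [← hdiff, ← hd0, sub_add_cancel, hγ.1]

end NonlinearSplitting

/-! ### The center manifold theorem for one vector field -/

section

variable {E : Type u} [NormedAddCommGroup E] [NormedSpace ℝ E] [FiniteDimensional ℝ E]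

/-- The spectral bounds of a splitting with one common constant. -/
theorem SpectralSplitting.exists_bound {L Pc Ps Pu : E →L[ℝ] E} {β : ℝ}
    (hS : SpectralSplitting L Pc Ps Pu β) {η : ℝ} (hη : 0 < η) :
    ∃ M, 0 < M ∧
      (∀ t : ℝ, 0 ≤ t → ‖NormedSpace.exp (t • L) ∘L Ps‖ ≤ M * Real.exp (-β * t)) ∧
      (∀ t : ℝ, t ≤ 0 → ‖NormedSpace.exp (t • L) ∘L Pu‖ ≤ M * Real.exp (β * t)) ∧
      ∀ t : ℝ, ‖NormedSpace.exp (t • L) ∘L Pc‖ ≤ M * Real.exp (η * |t|) := by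
  obtain ⟨M₁, hM₁, hs⟩ := hS.bound_stable
  obtain ⟨M₂, hM₂, hu⟩ := hS.bound_unstable
  obtain ⟨M₃, hM₃, hc⟩ := hS.bound_center η hη
  refine ⟨M₁ + M₂ + M₃ + 1, by positivity, fun t ht => (hs t ht).trans ?_,
    fun t ht => (hu t ht).trans ?_, fun t => (hc t).trans ?_⟩ <;>
  exact mul_le_mul_of_nonneg_right (by linarith) (Real.exp_pos _).le

/-- The global center manifold theorem for a single vector field. -/
theorem exists_pos_forall_isCenterManifoldMap (L : E →L[ℝ] E) (k : ℕ) (hk : 1 ≤ k) :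
    ∃ ε : ℝ, 0 < ε ∧ ∀ F : E → E, ContDiff ℝ k F → F 0 = 0 → HasFDerivAt F L 0 →
      GlobalBounds L F k ε →
      (∃ C : NNReal, LipschitzWith C F) ∧ ∃ φ, IsCenterManifoldMap L F k φ := by
  have := FiniteDimensional.complete ℝ E
  obtain ⟨Pc, Ps, Pu, β, hS⟩ := exists_spectralSplitting L
  have hβ := hS.rate_pos
  -- The weights in use are `2ηi` for `1 ≤ i ≤ k`. The kernel estimate requires `2η ≤ 2ηi` and `2ηi
  -- + η ≤ β`; the case `i = k` dictates this choice.
  set η : ℝ := β / (2 * k + 1) with hηdef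
  have hk' : (1 : ℝ) ≤ k := by exact_mod_cast hk
  have hη : 0 < η := by positivity
  have hβη : β = (2 * k + 1) * η := by rw [hηdef]; field_simp
  obtain ⟨M, hM, hs, hu, hc⟩ := hS.exists_bound hη
  have hK : ∀ i : ℕ, 1 ≤ i → i ≤ k →
      IsKernel (lyapunovPerron L Pc Ps Pu) (2 * M) η (i * (2 * η)) := by
    intro i hi hik
    have hi' : (1 : ℝ) ≤ i := by exact_mod_cast hi
    have hik' : (i : ℝ) ≤ k := by exact_mod_cast hik
    refine IsKernel.lyapunovPerron hη hM.le hs hu hc ?_ ?_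
    · nlinarith
    · rw [hβη]; nlinarith
  -- With kernel constant `2M`, this is precisely the threshold below which `δ · 2(2M)/η < 1`.
  refine ⟨η / (2 * (2 * M)), by positivity, fun F hF hF0 hF' hFb => ?_⟩
  obtain ⟨hGb, δ, hδε, hδ⟩ := hFb
  have hδ0 : 0 ≤ δ := (norm_nonneg _).trans (hδ 0)
  have hκ : δ * (2 * (2 * M) / η) < 1 := by
    rw [lt_div_iff₀ (by positivity)] at hδε
    rwa [← mul_div_assoc, div_lt_one hη]
  have hG : ContDiff ℝ k fun x => F x - L x := hF.sub L.contDiff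
  have hFd : Differentiable ℝ F := hF.differentiable (by
    exact_mod_cast (by omega : k ≠ 0))
  have hGd : ∀ x, HasFDerivAt (fun x => F x - L x) (fderiv ℝ F x - L) x := fun x =>
    (hFd x).hasFDerivAt.sub L.hasFDerivAt
  have hGlip : ∀ x y, ‖(F x - L x) - (F y - L y)‖ ≤ δ * ‖x - y‖ := fun x y =>
    Convex.norm_image_sub_le_of_norm_hasFDerivWithin_le (s := Set.univ)
      (f := fun x => F x - L x) (fun z _ => (hGd z).hasFDerivWithinAt)
      (fun z _ => hδ z) convex_univ (Set.mem_univ y) (Set.mem_univ x)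
  obtain ⟨C, hC⟩ := hGb 0 zero_le
  have hN : NonlinearSplitting L Pc Ps Pu F β M (2 * M) η (2 * η) δ C :=
    { hS with
      norm_stable := hs
      norm_unstable := hu
      isKernel := by simpa using hK 1 le_rfl hk
      decay_pos := hη
      weight_nonneg := by positivity
      bound_nonneg := by positivity
      lipschitz_nonneg := hδ0
      small := hκ
      lipschitz := hGlip
      bounded := fun x => by simpa using hC x }
  have hlip : LipschitzWith (⟨δ, hδ0⟩ + ‖L‖₊) F := by
    have h1 : LipschitzWith ⟨δ, hδ0⟩ fun x => F x - L x :=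
      LipschitzWith.of_dist_le_mul fun x y => by
        rw [dist_eq_norm, dist_eq_norm]; exact hGlip x y
    simpa using h1.add L.lipschitz
  refine ⟨⟨_, hlip⟩, ?_⟩
  obtain ⟨m, rfl⟩ : ∃ m, k = m + 1 := ⟨k - 1, by omega⟩
  obtain ⟨u, hum, hueq, hucd, hu0, hu0'⟩ := exists_contDiff_integral_solution
    (P := centerSubspace (L : E →ₗ[ℝ] E)) hη (σ := 2 * η) (by positivity) (by positivity) hδ0 hκ hK
    (ℓ := fun s => NormedSpace.exp (s • L) ∘L (centerSubspace (L : E →ₗ[ℝ] E)).subtypeL)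
    (Cℓ := M) ((continuous_exp_smul L).clm_comp continuous_const).stronglyMeasurable
    (fun s => by
      have h1 : NormedSpace.exp (s • L) ∘L (centerSubspace (L : E →ₗ[ℝ] E)).subtypeL =
          (NormedSpace.exp (s • L) ∘L Pc) ∘L (centerSubspace (L : E →ₗ[ℝ] E)).subtypeL := by
        ext x
        simp [hN.center_coe x]
      rw [h1]
      refine (ContinuousLinearMap.opNorm_comp_le _ _).trans
        ((mul_le_of_le_one_right (norm_nonneg _) (Submodule.norm_subtypeL_le _)).trans
          ((hc s).trans ?_))
      refine mul_le_mul_of_nonneg_left (Real.exp_le_exp.2 ?_) hM.le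
      nlinarith [abs_nonneg s])
    hG hGb (fun x => by rw [(hGd x).fderiv]; exact hδ x) (by simp [hF0])
    (by rw [(hGd 0).fderiv, hF'.fderiv, sub_self])
  simp only [ContinuousLinearMap.comp_apply, Submodule.subtypeL_apply] at hueq
  let π : E →L[ℝ] hyperbolicSubspace (L : E →ₗ[ℝ] E) :=
    LinearMap.toContinuousLinearMap (hyperbolicProj (L : E →ₗ[ℝ] E))
  -- The value at time `0` has no center component, so it already lies in the hyperbolic subspace
  -- and the projection only changes its type.
  have hπ : ∀ x, (π (u 0 x) : E) = u 0 x := fun x => by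
    have h1 : Pc (u 0 x) = 0 := by
      rw [hueq]
      exact hN.center_integral_zero (((continuous_exp_smul L).clm_apply
        continuous_const).stronglyMeasurable.add (hum x))
    have h2 := centerProj_add_hyperbolicProj (L : E →ₗ[ℝ] E) (u 0 x)
    rwa [hN.coe_centerProj, h1, zero_add] at h2
  have hgraph : centerGraph L (fun x => π (u 0 x)) = centerManifold L F := by
    refine Set.Subset.antisymm ?_ fun y hy => ?_
    · rintro _ ⟨x, rfl⟩
      simp only [hπ]
      exact hN.mem_centerManifold x (hum x) fun t => hueq t x
    · refine ⟨centerProj (L : E →ₗ[ℝ] E) y, ?_⟩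
      simp only [hπ]
      exact hN.eq_of_mem_centerManifold hum hueq hy
  refine ⟨fun x => π (u 0 x), π.contDiff.comp (hucd 0), by simp [hu0], ?_, ?_, hgraph⟩
  · have := π.hasFDerivAt.comp (0 : centerSubspace (L : E →ₗ[ℝ] E)) (hu0' 0)
    rwa [ContinuousLinearMap.comp_zero] at this
  · intro x γ hγ hx t
    rw [hgraph] at hx ⊢
    exact centerManifold_invariant hlip hγ hx t

end

/-! ### Maps intertwining two vector fields -/

section

variable {E E' : Type*} [NormedAddCommGroup E] [NormedSpace ℝ E] [FiniteDimensional ℝ E]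
  [NormedAddCommGroup E'] [NormedSpace ℝ E'] [FiniteDimensional ℝ E']

/-- `R` preserves both summands, so applying `R` to the decomposition of `x` gives the decomposition
of `R x`. -/
theorem centerProj_map {L : E →ₗ[ℝ] E} {L' : E' →ₗ[ℝ] E'} {R : E →ₗ[ℝ] E'}
    (h : ∀ x, R (L x) = L' (R x)) (x : E) :
    (centerProj L' (R x) : E') = R (centerProj L x) := by
  have h1 := centerProj_add L' ⟨_, map_mem_spectralSubspace h (centerProj L x).2⟩
    ⟨_, map_mem_spectralSubspace h (hyperbolicProj L x).2⟩
  simp only [← map_add, centerProj_add_hyperbolicProj] at h1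
  rw [h1]

theorem hyperbolicProj_map {L : E →ₗ[ℝ] E} {L' : E' →ₗ[ℝ] E'} {R : E →ₗ[ℝ] E'}
    (h : ∀ x, R (L x) = L' (R x)) (x : E) :
    (hyperbolicProj L' (R x) : E') = R (hyperbolicProj L x) := by
  have h1 := hyperbolicProj_add L' ⟨_, map_mem_spectralSubspace h (centerProj L x).2⟩
    ⟨_, map_mem_spectralSubspace h (hyperbolicProj L x).2⟩
  simp only [← map_add, centerProj_add_hyperbolicProj] at h1
  rw [h1]

/-- Linear maps that intertwine vector fields map center manifolds to center manifolds. -/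
theorem map_mem_centerManifold {L : E →L[ℝ] E} {L' : E' →L[ℝ] E'} {F : E → E} {F' : E' → E'}
    {R : E →ₗ[ℝ] E'} (hL : ∀ x, R (L x) = L' (R x)) (hF : ∀ x, R (F x) = F' (R x)) {x : E}
    (hx : x ∈ centerManifold L F) : R x ∈ centerManifold L' F' := by
  obtain ⟨γ, hγ, C, hC⟩ := hx
  let T : E →L[ℝ] E' := LinearMap.toContinuousLinearMap R
  refine ⟨fun t => T (γ t), ⟨congrArg R hγ.1, fun t => ?_⟩, ‖T‖ * C, fun t => ?_⟩
  · refine (T.hasFDerivAt.comp_hasDerivAt t (hγ.2 t)).congr_deriv ?_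
    exact hF (γ t)
  · have h1 : (hyperbolicProj (L' : E' →ₗ[ℝ] E') (R (γ t)) : E') =
        T (hyperbolicProj (L : E →ₗ[ℝ] E) (γ t)) :=
      hyperbolicProj_map (L := (L : E →ₗ[ℝ] E)) (L' := (L' : E' →ₗ[ℝ] E')) hL (γ t)
    change ‖(hyperbolicProj (L' : E' →ₗ[ℝ] E') (R (γ t)) : E')‖ ≤ _
    rw [h1]
    exact (T.le_opNorm _).trans (mul_le_mul_of_nonneg_left (hC t) (norm_nonneg _))

end

end QuiverCM

/-! ### Assembly for quiver representations -/

theorem theorem8p2 :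
    ∃ ε : ∀ (E : Type u) [NormedAddCommGroup E] [NormedSpace ℝ E] [FiniteDimensional ℝ E],
        (E →L[ℝ] E) → ℕ → ℝ,
      (∀ (E : Type u) [NormedAddCommGroup E] [NormedSpace ℝ E] [FiniteDimensional ℝ E]
        (L : E →L[ℝ] E) (k : ℕ), 1 ≤ k → 0 < ε E L k) ∧
      ∀ (V : Type v) [Quiver.{w} V] (E : V → Type u) [∀ v, NormedAddCommGroup (E v)]
        [∀ v, NormedSpace ℝ (E v)] [∀ v, FiniteDimensional ℝ (E v)]
        (R : ∀ ⦃v w : V⦄, (v ⟶ w) → (E v →ₗ[ℝ] E w))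
        (k : ℕ) (_ : 1 ≤ k)
        (L : ∀ v, E v →L[ℝ] E v) (F : ∀ v, E v → E v),
        IsEquivariant R (fun v => ⇑(L v)) →
        IsEquivariant R F →
        (∀ v, ContDiff ℝ k (F v)) →
        (∀ v, F v 0 = 0) →
        (∀ v, HasFDerivAt (F v) (L v) 0) →
        (∀ v, GlobalBounds (L v) (F v) k (ε (E v) (L v) k)) →
        -- the flow of each `F v` is defined for all times
        (∀ v x, ∃! γ : ℝ → E v, IsSolution (F v) x γ) ∧
        -- each `F v` admits a unique global center manifold
        (∀ v, ∃! φ, IsCenterManifoldMap (L v) (F v) k φ) ∧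
        (∀ ⦃v w : V⦄ (a : v ⟶ w),
          R a '' centerManifold (L v) (F v) ⊆ centerManifold (L w) (F w)) ∧
        ∃ (hc : IsSubrepresentation R (fun v => centerSubspace (L v : E v →ₗ[ℝ] E v)))
          (hh : IsSubrepresentation R (fun v => hyperbolicSubspace (L v : E v →ₗ[ℝ] E v))),
          ∀ φ : ∀ v, centerSubspace (L v : E v →ₗ[ℝ] E v) →
              hyperbolicSubspace (L v : E v →ₗ[ℝ] E v),
            (∀ v, IsCenterManifoldMap (L v) (F v) k (φ v)) →
            (∀ ⦃v w : V⦄ (a : v ⟶ w),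
              restrictRep R _ hh a ∘ φ v = φ w ∘ restrictRep R _ hc a) ∧
            IsEquivariant (restrictRep R _ hc) (fun v => centerReduction (L v) (F v) (φ v)) := by

  classical
  refine ⟨fun E _ _ _ L k => if hk : 1 ≤ k then
    (exists_pos_forall_isCenterManifoldMap L k hk).choose else 0, fun E _ _ _ L k hk => ?_, ?_⟩
  · simp only [hk, dif_pos]
    exact (exists_pos_forall_isCenterManifoldMap L k hk).choose_spec.1
  intro V _ E _ _ _ R k hk L F hL hF hFc hF0 hF' hFb
  have key : ∀ v, (∃ C : NNReal, LipschitzWith C (F v)) ∧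
      ∃ φ, IsCenterManifoldMap (L v) (F v) k φ := fun v => by
    have hb := hFb v
    simp only [hk, dif_pos] at hb
    exact (exists_pos_forall_isCenterManifoldMap (L v) k hk).choose_spec.2 (F v) (hFc v) (hF0 v)
      (hF' v) hb
  have hL' : ∀ ⦃v w : V⦄ (a : v ⟶ w) x, R a (L v x) = L w (R a x) :=
    fun v w a x => (congrFun (hL a) x).symm
  have hF'' : ∀ ⦃v w : V⦄ (a : v ⟶ w) x, R a (F v x) = F w (R a x) :=
    fun v w a x => (congrFun (hF a) x).symm
  have hR : ∀ ⦃v w : V⦄ (a : v ⟶ w) {x}, x ∈ centerManifold (L v) (F v) →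
      R a x ∈ centerManifold (L w) (F w) :=
    fun v w a x hx => map_mem_centerManifold (hL' a) (hF'' a) hx
  have hc : IsSubrepresentation R (fun v => centerSubspace (L v : E v →ₗ[ℝ] E v)) :=
    fun v w a x hx => map_mem_spectralSubspace (hL' a) hx
  have hh : IsSubrepresentation R (fun v => hyperbolicSubspace (L v : E v →ₗ[ℝ] E v)) :=
    fun v w a x hx => map_mem_spectralSubspace (hL' a) hx
  refine ⟨fun v x => ?_, fun v => ?_, fun v w a => Set.image_subset_iff.2 fun x hx => hR a hx,
    hc, hh, fun φ hφ => ?_⟩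
  · have := FiniteDimensional.complete ℝ (E v)
    obtain ⟨C, hC⟩ := (key v).1
    exact existsUnique_isSolution hC x
  · obtain ⟨φ, hφ⟩ := (key v).2
    exact ⟨φ, hφ, fun ψ hψ => centerGraph_injective (L v) (hψ.graph_eq.trans hφ.graph_eq.symm)⟩
  have hφR : ∀ ⦃v w : V⦄ (a : v ⟶ w), restrictRep R _ hh a ∘ φ v = φ w ∘ restrictRep R _ hc a := by
    intro v w a
    funext x
    have h1 : (x : E v) + φ v x ∈ centerManifold (L v) (F v) := (hφ v).graph_eq ▸ ⟨x, rfl⟩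
    have h2 := hR a h1
    -- The image point `R x + R (φ x)` lies on the target graph, with center component `R x` and
    -- hyperbolic component `R (φ x)`; comparing components gives the commutation.
    rw [← (hφ w).graph_eq, map_add] at h2
    have h3 : ((restrictRep R _ hc a x : centerSubspace (L w : E w →ₗ[ℝ] E w)) : E w) +
        (restrictRep R _ hh a (φ v x) : hyperbolicSubspace (L w : E w →ₗ[ℝ] E w)) ∈
        centerGraph (L w) (φ w) := h2
    rw [mem_centerGraph_iff, centerProj_add, hyperbolicProj_add] at h3
    exact h3.symm
  refine ⟨hφR, fun v w a => funext fun x => Subtype.ext ?_⟩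
  have h1 : (φ w (restrictRep R _ hc a x) : E w) = R a (φ v x) :=
    (congrArg Subtype.val (congrFun (hφR a) x)).symm
  have h2 : ((restrictRep R _ hc a x : centerSubspace (L w : E w →ₗ[ℝ] E w)) : E w) = R a x := rfl
  change (centerProj (L w : E w →ₗ[ℝ] E w)
    (F w ((restrictRep R _ hc a x : centerSubspace (L w : E w →ₗ[ℝ] E w)) +
      (φ w (restrictRep R _ hc a x) : E w))) : E w) =
    R a (centerProj (L v : E v →ₗ[ℝ] E v) (F v (x + φ v x)))
  -- By equivariance of `φ`, the argument of `F w` is the image under `R` of the corresponding point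
  -- on the source graph; then `R` passes through `F` and through the center projection.
  rw [h1, h2, ← map_add, ← hF'' a]
  exact centerProj_map (L := (L v : E v →ₗ[ℝ] E v)) (L' := (L w : E w →ₗ[ℝ] E w)) (hL' a) _
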